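/- Let $M$ be a closed (compact, without boundary) connected smooth manifold of dimension $n$, and let $\mathcal{M}_1$ be the space of smooth Riemannian metrics on $M$ of volume one. For $g\in\mathcal{M}_1$ let $s_g$ be the scalar curvature of $g$, let $d\mu_g$ be its Riemannian measure, and let $$S(g)=\int_M s_g^2\,d\mu_g .$$ Suppose that $g\in\mathcal{M}_1$ is a critical point of $S:\mathcal{M}_1\to\mathbb{R}$, that is, $\frac{d}{dt}S(g_t)\big|_{t=0}=0$ for every smooth curve $(g_t)_{t\in\mathbb{R}}$ in $\mathcal{M}_1$ with $g_0=g$. Then $s_g$ attains a maximum $\max s_g$ and a minimum $\min s_g$ on $M$, and the following hold. 1. If $n>4$ and $\max s_g\ge|\min s_g|$, then $s_g$ is a nonnegative constant. 2. If $n<4$ and $\min s_g\le-|\max s_g|$, then $s_g$ is a nonpositive constant. -/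

import Mathlib

open scoped Manifold ContDiff Bundle

noncomputable section

namespace RiemGeom

/-- The Euclidean space `ℝⁿ` on which an `n`-dimensional manifold is modelled. -/
abbrev Model (n : ℕ) : Type := EuclideanSpace ℝ (Fin n)

section Local

variable {n : ℕ}

/-- The `i`-th partial derivative of a function on `ℝⁿ`. -/
def partialDeriv (i : Fin n) (f : Model n → ℝ) (y : Model n) : ℝ :=
  fderiv ℝ f y (EuclideanSpace.single i 1)

variable (G : Model n → Matrix (Fin n) (Fin n) ℝ)

/-- The Christoffel symbol
`Γᵏᵢⱼ = ½ ∑ₗ gᵏˡ (∂ᵢ gⱼₗ + ∂ⱼ gᵢₗ - ∂ₗ gᵢⱼ)` of a matrix-valued function `G = (gᵢⱼ)`. -/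
def christoffel (k i j : Fin n) (y : Model n) : ℝ :=
  (1 / 2) * ∑ l, (G y)⁻¹ k l *
    (partialDeriv i (fun z => G z j l) y + partialDeriv j (fun z => G z i l) y
      - partialDeriv l (fun z => G z i j) y)

/-- The Ricci curvature
`Rᵢⱼ = ∑ₖ (∂ₖ Γᵏᵢⱼ - ∂ⱼ Γᵏᵢₖ) + ∑ₖ ∑ₗ (Γᵏₖₗ Γˡᵢⱼ - Γᵏⱼₗ Γˡᵢₖ)`,
with the sign for which round spheres have positive Ricci curvature. -/
def localRicci (i j : Fin n) (y : Model n) : ℝ :=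
  (∑ k, (partialDeriv k (christoffel G k i j) y - partialDeriv j (christoffel G k i k) y))
    + ∑ k, ∑ l, (christoffel G k k l y * christoffel G l i j y
        - christoffel G k j l y * christoffel G l i k y)

/-- The scalar curvature `∑ᵢⱼ gⁱʲ Rᵢⱼ` in coordinates. -/
def localScalar (y : Model n) : ℝ :=
  ∑ i, ∑ j, (G y)⁻¹ i j * localRicci G i j y

end Local

section Manifold

variable {n : ℕ} {M : Type*} [TopologicalSpace M] [ChartedSpace (Model n) M]
  [IsManifold (𝓡 n) ∞ M]

variable (n M) in
/-- Smooth Riemannian metrics on the smooth `n`-manifold `M`. -/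
abbrev Metric : Type _ :=
  Bundle.ContMDiffRiemannianMetric (𝓡 n) ∞ (Model n) (fun x : M => TangentSpace (𝓡 n) x)

/-- The `i`-th coordinate vector `∂ᵢ` of the preferred chart at `c`, at the point of `M` whose
coordinates in this chart are `y`. -/
def coordVector (c : M) (i : Fin n) (y : Model n) :
    TangentSpace (𝓡 n) ((extChartAt (𝓡 n) c).symm y) :=
  mfderiv 𝓘(ℝ, Model n) (𝓡 n) (extChartAt (𝓡 n) c).symm y
    (EuclideanSpace.single i (1 : ℝ) : Model n)

/-- The coefficient matrix `gᵢⱼ = g(∂ᵢ, ∂ⱼ)` of a metric in the preferred chart at `c`, as a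
function of the coordinates `y` (meaningful for `y` in the image of the chart). -/
def coeff (g : Metric n M) (c : M) (y : Model n) : Matrix (Fin n) (Fin n) ℝ :=
  Matrix.of fun i j =>
    g.inner ((extChartAt (𝓡 n) c).symm y) (coordVector c i y) (coordVector c j y)

/-- The scalar curvature `s_g` of a metric, computed at `x` in the preferred chart at `x`. -/
def scalarCurvature (g : Metric n M) (x : M) : ℝ :=
  localScalar (coeff g x) (extChartAt (𝓡 n) x x)

/-- The Riemannian measure on the domain of the preferred chart at `c`: the measure
`√det(gᵢⱼ) dy` on the image of the chart, transported to `M`. -/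
def chartMeasure [MeasurableSpace M] (g : Metric n M) (c : M) : MeasureTheory.Measure M :=
  ((MeasureTheory.volume.restrict (extChartAt (𝓡 n) c).target).withDensity
    (fun y => ENNReal.ofReal (Real.sqrt (coeff g c y).det))).map (extChartAt (𝓡 n) c).symm

variable [T2Space M] [CompactSpace M]

variable (n M) in
/-- A smooth partition of unity whose function with index `c` is supported in the domain of the
preferred chart at `c`. -/
def chartPartition : SmoothPartitionOfUnity M (𝓡 n) M Set.univ :=
  (SmoothPartitionOfUnity.exists_isSubordinate_chartAt_source (𝓡 n) M).choose

variable [MeasurableSpace M]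

/-- The Riemannian measure `dμ_g`, glued from the chart measures by a partition of unity. -/
def riemMeasure (g : Metric n M) : MeasureTheory.Measure M :=
  MeasureTheory.Measure.sum fun c : M =>
    (chartMeasure g c).withDensity (fun x => ENNReal.ofReal (chartPartition n M c x))

/-- The squared `L²`-norm of the scalar curvature, `S(g) = ∫_M s_g² dμ_g`. -/
def energy (g : Metric n M) : ℝ :=
  ∫ x, scalarCurvature g x ^ 2 ∂(riemMeasure g)

/-- A smooth curve of metrics: `(t, x) ↦ γ t x` is jointly smooth. -/
def IsSmoothCurve (γ : ℝ → Metric n M) : Prop :=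
  ContMDiff (𝓘(ℝ, ℝ).prod (𝓡 n)) ((𝓡 n).prod 𝓘(ℝ, Model n →L[ℝ] Model n →L[ℝ] ℝ)) ∞
    (fun p : ℝ × M => Bundle.TotalSpace.mk' (Model n →L[ℝ] Model n →L[ℝ] ℝ)
      (E := fun x : M => TangentSpace (𝓡 n) x →L[ℝ] TangentSpace (𝓡 n) x →L[ℝ] ℝ)
      p.2 ((γ p.1).inner p.2))

/-- `g` is a critical point of `S` restricted to the space of metrics of volume one: it has volume
one, and the derivative of `S` at `g` vanishes along every smooth curve of metrics of volume one
through `g`. -/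
def IsCritical (g : Metric n M) : Prop :=
  riemMeasure g Set.univ = 1 ∧
    ∀ γ : ℝ → Metric n M, IsSmoothCurve γ → γ 0 = g →
      (∀ t, riemMeasure (γ t) Set.univ = 1) →
      HasDerivAt (fun t => energy (γ t)) 0 0

end Manifold

end RiemGeom

end

/-! Only conformal variations are needed. For a smooth `f` with values in `[0, 1]` and mean `m = ∫ f
dμ_g`, the metrics `w ^ (2 / n) • g` with `w = 1 + a(t) (f - m)` have volume element `w dμ_g`, hence
volume one. Differentiating their energy by the conformal transformation law of the scalar curvature
gives `∫ ((1 - 4/n) (f - m) s² - (4 (n - 1) / n) s Δf) dμ_g = 0`. Since the volume is one, `m s²`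
and `f S(g)` have the same integral. Green's identity then moves `Δ` onto `s`, and localising with
bump functions yields the pointwise equation `(n - 4) (s² - S(g)) = 4 (n - 1) Δs`
(`eulerLagrange_eq_zero`).

Suppose `n > 4` and let `p` be a maximum point of `s`. There `Δs ≤ 0`, so `s(p)² ≤ S(g)`. The
hypothesis on the minimum makes `s(p)²` the maximum of `s²`, while `S(g)` is the mean of `s²`. A
continuous function whose maximum does not exceed its mean is constant, because the measure charges
open sets; so `s²` is constant, and `s` is constant by connectedness. For `n < 4` the same argument
runs at a minimum point, where `Δs ≥ 0`. Dimension zero is trivial, as `s = 0`.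

Because everything is defined in coordinates, the supporting facts are proved there: independence of
the scalar curvature from the chart (`IsPullbackAt.localScalar_eq`, `scalarCurvature_eq`), the
conformal law (`IsConformalAt.localScalar_eq`), Green's identity (`integral_green`), the sign of the
Laplacian at extrema, and the agreement of the glued measure with each chart measure
(`riemMeasure_restrict_source`). The variation itself is `first_variation`. -/

noncomputable section

namespace RiemGeom

open Filter Topology

/-! ### Metrics and Christoffel symbols on `ℝⁿ` as multilinear maps. -/

section TensorCalculus

variable {n : ℕ}

/-- The `i`-th standard basis vector of `ℝⁿ`. -/
abbrev stdVec (i : Fin n) : Model n := EuclideanSpace.single i 1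

lemma stdVec_apply (i j : Fin n) : (stdVec i : Model n) j = if j = i then 1 else 0 := by
  simp [stdVec]

lemma sum_smul_stdVec (v : Model n) : ∑ i, v i • (stdVec i : Model n) = v := by
  ext j
  simp [Finset.sum_apply, Pi.single_apply]

lemma sum_apply_stdVec_mul (α : Model n →L[ℝ] ℝ) (v : Model n) :
    ∑ i, α (stdVec i) * v i = α v := by
  conv_rhs => rw [← sum_smul_stdVec v]
  simp [mul_comm]

lemma linear_sum_apply_stdVec_mul (α : Model n →ₗ[ℝ] ℝ) (v : Model n) :
    ∑ i, α (stdVec i) * v i = α v := by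
  conv_rhs => rw [← sum_smul_stdVec v]
  simp [mul_comm]

lemma fderiv_apply_eq_sum (f : Model n → ℝ) (y v : Model n) :
    fderiv ℝ f y v = ∑ i, partialDeriv i f y * v i :=
  (sum_apply_stdVec_mul (fderiv ℝ f y) v).symm

lemma fderiv_bilin_apply {F : Type*} [NormedAddCommGroup F] [NormedSpace ℝ F]
    {B : Model n → Model n →L[ℝ] Model n →L[ℝ] F} {y : Model n} (hB : DifferentiableAt ℝ B y)
    (v a b : Model n) : fderiv ℝ (fun z => B z a b) y v = fderiv ℝ B y v a b := by
  have h1 : HasFDerivAt (fun z => B z a b) _ y :=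
    (hB.hasFDerivAt.clm_apply (hasFDerivAt_const a y)).clm_apply (hasFDerivAt_const b y)
  rw [h1.fderiv]
  simp

/-- The bilinear form with coefficient matrix `G y`. -/
def metricForm (G : Model n → Matrix (Fin n) (Fin n) ℝ) (y : Model n) :
    Model n →L[ℝ] Model n →L[ℝ] ℝ :=
  ∑ i, ∑ j, G y i j • (EuclideanSpace.proj (𝕜 := ℝ) i : Model n →L[ℝ] ℝ).smulRight
    (EuclideanSpace.proj (𝕜 := ℝ) j : Model n →L[ℝ] ℝ)

/-- The Christoffel symbols as a bilinear map `(v, w) ↦ Γ(v, w)`. -/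
def connForm (G : Model n → Matrix (Fin n) (Fin n) ℝ) (y : Model n) :
    Model n →L[ℝ] Model n →L[ℝ] Model n :=
  ∑ k, ∑ i, ∑ j, christoffel G k i j y • (EuclideanSpace.proj (𝕜 := ℝ) i : Model n →L[ℝ] ℝ).smulRight
    ((EuclideanSpace.proj (𝕜 := ℝ) j : Model n →L[ℝ] ℝ).smulRight (stdVec k : Model n))

lemma metricForm_apply (G : Model n → Matrix (Fin n) (Fin n) ℝ) (y v w : Model n) :
    metricForm G y v w = ∑ i, ∑ j, G y i j * v i * w j := by
  simp [metricForm, mul_assoc]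

lemma metricForm_stdVec (G : Model n → Matrix (Fin n) (Fin n) ℝ) (y : Model n) (i j : Fin n) :
    metricForm G y (stdVec i) (stdVec j) = G y i j := by
  simp [metricForm_apply]

lemma connForm_apply (G : Model n → Matrix (Fin n) (Fin n) ℝ) (y v w : Model n) (k : Fin n) :
    connForm G y v w k = ∑ i, ∑ j, christoffel G k i j y * v i * w j := by
  simp only [connForm, sum_apply, WithLp.ofLp_sum, Finset.sum_apply]
  rw [Finset.sum_eq_single k]
  · simp [mul_assoc]
  · intro b _ hb
    simp [hb.symm]
  · simp

lemma connForm_stdVec (G : Model n → Matrix (Fin n) (Fin n) ℝ) (y : Model n) (i j k : Fin n) :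
    connForm G y (stdVec i) (stdVec j) k = christoffel G k i j y := by
  simp [connForm_apply]

/-- A matrix-valued function is, near `y`, a smooth nondegenerate symmetric metric. -/
structure IsMetricAt (G : Model n → Matrix (Fin n) (Fin n) ℝ) (y : Model n) : Prop where
  eventually_smooth : ∀ᶠ z in 𝓝 y, ∀ i j, ContDiffAt ℝ ∞ (fun z => G z i j) z
  det_ne : (G y).det ≠ 0
  symm : ∀ z i j, G z i j = G z j i

section Smoothness

variable {G : Model n → Matrix (Fin n) (Fin n) ℝ} {y : Model n}

lemma contDiffAt_smul_const {F : Type*} [NormedAddCommGroup F] [NormedSpace ℝ F]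
    {f : Model n → ℝ} (hf : ContDiffAt ℝ ∞ f y) (c : F) :
    ContDiffAt ℝ ∞ (fun z => f z • c) y :=
  hf.smul contDiffAt_const

lemma contDiffAt_det {m : Type*} [Fintype m] [DecidableEq m] {A : Model n → Matrix m m ℝ}
    (hA : ∀ i j, ContDiffAt ℝ ∞ (fun z => A z i j) y) :
    ContDiffAt ℝ ∞ (fun z => (A z).det) y := by
  simp only [Matrix.det_apply]
  refine ContDiffAt.sum fun σ _ => ?_
  refine ContDiffAt.const_smul _ ?_
  exact contDiffAt_prod fun i _ => hA _ _

lemma contDiffAt_inv_apply (hG : ∀ i j, ContDiffAt ℝ ∞ (fun z => G z i j) y)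
    (hd : (G y).det ≠ 0) (i j : Fin n) : ContDiffAt ℝ ∞ (fun z => (G z)⁻¹ i j) y := by
  have h : (fun z => (G z)⁻¹ i j) = fun z => ((G z).det)⁻¹ * (G z).adjugate i j := by
    ext z
    rw [Matrix.inv_def, Matrix.smul_apply, Ring.inverse_eq_inv', smul_eq_mul]
  rw [h]
  refine ((contDiffAt_det hG).inv hd).mul ?_
  simp only [Matrix.adjugate_apply]
  refine contDiffAt_det fun a b => ?_
  by_cases hab : a = j
  · subst hab
    simpa using contDiffAt_const
  · simpa [Matrix.updateRow_ne hab] using hG a b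

lemma contDiffAt_partialDeriv {f : Model n → ℝ} (hf : ContDiffAt ℝ ∞ f y) (i : Fin n) :
    ContDiffAt ℝ ∞ (partialDeriv i f) y := by
  unfold partialDeriv
  exact (hf.fderiv_right (m := ∞) (by simp)).clm_apply contDiffAt_const

namespace IsMetricAt

variable (h : IsMetricAt G y)
include h

lemma smooth (i j : Fin n) : ContDiffAt ℝ ∞ (fun z => G z i j) y :=
  h.eventually_smooth.self_of_nhds i j

lemma contDiffAt_inv (i j : Fin n) : ContDiffAt ℝ ∞ (fun z => (G z)⁻¹ i j) y :=
  contDiffAt_inv_apply h.smooth h.det_ne i j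

lemma contDiffAt_christoffel (k i j : Fin n) : ContDiffAt ℝ ∞ (christoffel G k i j) y := by
  unfold christoffel
  refine contDiffAt_const.mul (ContDiffAt.sum fun l _ => (h.contDiffAt_inv k l).mul ?_)
  exact ((contDiffAt_partialDeriv (h.smooth _ _) _).add
    (contDiffAt_partialDeriv (h.smooth _ _) _)).sub (contDiffAt_partialDeriv (h.smooth _ _) _)

lemma contDiffAt_localScalar : ContDiffAt ℝ ∞ (localScalar G) y := by
  unfold localScalar localRicci
  have hc := h.contDiffAt_christoffel
  refine ContDiffAt.sum fun i _ => ContDiffAt.sum fun j _ => (h.contDiffAt_inv i j).mul ?_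
  refine ContDiffAt.add (ContDiffAt.sum fun k _ => ?_)
    (ContDiffAt.sum fun k _ => ContDiffAt.sum fun l _ => ?_)
  · exact (contDiffAt_partialDeriv (hc _ _ _) _).sub (contDiffAt_partialDeriv (hc _ _ _) _)
  · exact ((hc _ _ _).mul (hc _ _ _)).sub ((hc _ _ _).mul (hc _ _ _))

lemma contDiffAt_metricForm : ContDiffAt ℝ ∞ (metricForm G) y := by
  unfold metricForm
  exact ContDiffAt.sum fun i _ => ContDiffAt.sum fun j _ => contDiffAt_smul_const (h.smooth i j) _

lemma contDiffAt_connForm : ContDiffAt ℝ ∞ (connForm G) y := by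
  unfold connForm
  exact ContDiffAt.sum fun k _ => ContDiffAt.sum fun i _ => ContDiffAt.sum fun j _ =>
    contDiffAt_smul_const (h.contDiffAt_christoffel k i j) _

lemma differentiableAt_metricForm : DifferentiableAt ℝ (metricForm G) y :=
  h.contDiffAt_metricForm.differentiableAt (by simp)

lemma differentiableAt_connForm : DifferentiableAt ℝ (connForm G) y :=
  h.contDiffAt_connForm.differentiableAt (by simp)

lemma metricForm_symm (z v w : Model n) : metricForm G z v w = metricForm G z w v := by
  rw [metricForm_apply, metricForm_apply, Finset.sum_comm]
  refine Finset.sum_congr rfl fun i _ => Finset.sum_congr rfl fun j _ => ?_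
  rw [h.symm z j i]; ring

lemma christoffel_symm (z : Model n) (k i j : Fin n) :
    christoffel G k i j z = christoffel G k j i z := by
  unfold christoffel
  have : (fun z => G z i j) = fun z => G z j i := by ext z; exact h.symm z i j
  simp only [this]
  congr 1
  refine Finset.sum_congr rfl fun l _ => ?_
  ring

lemma connForm_symm (z v w : Model n) : connForm G z v w = connForm G z w v := by
  ext k
  rw [connForm_apply, connForm_apply, Finset.sum_comm]
  refine Finset.sum_congr rfl fun i _ => Finset.sum_congr rfl fun j _ => ?_
  rw [h.christoffel_symm z k j i]; ring

lemma isUnit_det : IsUnit (G y).det := h.det_ne.isUnit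

/-- Nondegeneracy of the metric. Vector identities below are proved by pairing both sides with an
arbitrary `z`, which reduces them to the Koszul formula or to the defining property of `raise`. -/
lemma eq_of_metricForm_eq {u u' : Model n}
    (hu : ∀ z, metricForm G y u z = metricForm G y u' z) : u = u' := by
  have key : ∀ x : Model n, (∀ z, metricForm G y x z = 0) → x = 0 := by
    intro x hx
    have h0 : Matrix.vecMul (fun i => x i) (G y) = 0 := by
      ext j
      have := hx (stdVec j)
      rw [metricForm_apply] at this
      simpa [stdVec_apply, Matrix.vecMul, dotProduct, mul_comm] using this
    have h1 := Matrix.eq_zero_of_vecMul_eq_zero h.det_ne h0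
    ext i
    exact congrFun h1 i
  refine sub_eq_zero.1 (key _ fun z => ?_)
  simp [hu z]

lemma eventually : ∀ᶠ z in 𝓝 y, IsMetricAt G z := by
  have h2 : ∀ᶠ z in 𝓝 y, (G z).det ≠ 0 :=
    (contDiffAt_det h.smooth).continuousAt.eventually_ne h.det_ne
  filter_upwards [h.eventually_smooth.eventually_nhds, h2] with z hz1 hz2
  exact ⟨hz1, hz2, h.symm⟩

end IsMetricAt

/-- The vector dual to a linear form. -/
def raise (G : Model n → Matrix (Fin n) (Fin n) ℝ) (y : Model n) :
    (Model n →ₗ[ℝ] ℝ) →ₗ[ℝ] Model n where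
  toFun α := ∑ k, (∑ j, (G y)⁻¹ k j * α (stdVec j)) • (stdVec k : Model n)
  map_add' α β := by
    simp [mul_add, Finset.sum_add_distrib, add_smul]
  map_smul' c α := by
    simp only [LinearMap.smul_apply, smul_eq_mul, RingHom.id_apply, Finset.smul_sum, smul_smul,
      Finset.mul_sum]
    refine Finset.sum_congr rfl fun k _ => ?_
    congr 1
    exact Finset.sum_congr rfl fun j _ => by ring

lemma raise_apply (α : Model n →ₗ[ℝ] ℝ) (k : Fin n) :
    raise G y α k = ∑ j, (G y)⁻¹ k j * α (stdVec j) := by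
  simp [raise, Finset.sum_apply, Pi.single_apply]

namespace IsMetricAt

lemma metricForm_raise (h : IsMetricAt G y) (α : Model n →ₗ[ℝ] ℝ) (z : Model n) :
    metricForm G y (raise G y α) z = α z := by
  rw [metricForm_apply, ← linear_sum_apply_stdVec_mul α z, Finset.sum_comm]
  refine Finset.sum_congr rfl fun j _ => ?_
  rw [← Finset.sum_mul]
  congr 1
  have h1 : (G y * (G y)⁻¹) = 1 := Matrix.mul_nonsing_inv _ h.isUnit_det
  calc ∑ i, G y i j * raise G y α i
      = ∑ i, ∑ l, (G y j i * (G y)⁻¹ i l) * α (stdVec l) := by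
        refine Finset.sum_congr rfl fun i _ => ?_
        rw [raise_apply, Finset.mul_sum, h.symm y i j]
        exact Finset.sum_congr rfl fun l _ => by ring
    _ = ∑ l, (G y * (G y)⁻¹) j l * α (stdVec l) := by
        rw [Finset.sum_comm]
        exact Finset.sum_congr rfl fun l _ => by rw [Matrix.mul_apply, Finset.sum_mul]
    _ = α (stdVec j) := by simp [h1, Matrix.one_apply]

lemma fderiv_metricForm (h : IsMetricAt G y) (v a b : Model n) :
    fderiv ℝ (metricForm G) y v a b
      = ∑ i, ∑ j, ∑ l, partialDeriv i (fun z => G z j l) y * v i * a j * b l := by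
  rw [← fderiv_bilin_apply h.differentiableAt_metricForm, fderiv_apply_eq_sum]
  refine Finset.sum_congr rfl fun i _ => ?_
  have : partialDeriv i (fun z => metricForm G z a b) y
      = ∑ j, ∑ l, partialDeriv i (fun z => G z j l) y * a j * b l := by
    unfold partialDeriv
    have h2 : HasFDerivAt (fun z => metricForm G z a b)
        (∑ j, ∑ l, (b l) • ((a j) • fderiv ℝ (fun z => G z j l) y)) y := by
      simp only [metricForm_apply]
      refine HasFDerivAt.fun_sum fun j _ => HasFDerivAt.fun_sum fun l _ => ?_
      exact (((h.smooth j l).differentiableAt (by simp)).hasFDerivAt.mul_const (a j)).mul_const (b l)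
    rw [h2.fderiv]
    simp only [sum_apply, smul_apply, smul_eq_mul]
    exact Finset.sum_congr rfl fun j _ => Finset.sum_congr rfl fun l _ => by ring
  rw [this, Finset.sum_mul]
  refine Finset.sum_congr rfl fun j _ => ?_
  rw [Finset.sum_mul]
  exact Finset.sum_congr rfl fun l _ => by ring

set_option synthInstance.maxHeartbeats 200000 in
/-- The Koszul formula. -/
lemma koszul (h : IsMetricAt G y) (v w z : Model n) :
    2 * metricForm G y (connForm G y v w) z = fderiv ℝ (metricForm G) y v w z
      + fderiv ℝ (metricForm G) y w v z - fderiv ℝ (metricForm G) y z v w := by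
  -- Half the right-hand side of the formula, as a linear form in `z`; the definition of the
  -- Christoffel symbols says that `Γ(v, w)` is this form with its index raised.
  let α : Model n →ₗ[ℝ] ℝ :=
    { toFun := fun z => (1 / 2) * (fderiv ℝ (metricForm G) y v w z
        + fderiv ℝ (metricForm G) y w v z - fderiv ℝ (metricForm G) y z v w)
      map_add' := fun a b => by
        simp only [map_add, add_apply]; ring
      map_smul' := fun c a => by
        simp only [map_smul, smul_apply, smul_eq_mul, RingHom.id_apply]; ring }
  have hα : connForm G y v w = raise G y α := by
    ext k
    rw [connForm_apply, raise_apply]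
    have : ∀ l, α (stdVec l) = ∑ i, ∑ j, (1 / 2) * (partialDeriv i (fun z => G z j l) y
        + partialDeriv j (fun z => G z i l) y - partialDeriv l (fun z => G z i j) y)
          * v i * w j := by
      intro l
      simp only [α, LinearMap.coe_mk, AddHom.coe_mk, h.fderiv_metricForm]
      have e2 : ∑ i, ∑ j, ∑ m, partialDeriv i (fun z => G z j m) y * w i * v j
            * (stdVec l : Model n) m
          = ∑ i, ∑ j, partialDeriv j (fun z => G z i l) y * v i * w j := by
        rw [Finset.sum_comm]
        refine Finset.sum_congr rfl fun i _ => Finset.sum_congr rfl fun j _ => ?_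
        simp; ring
      have e1 : ∑ i, ∑ j, ∑ m, partialDeriv i (fun z => G z j m) y * v i * w j
            * (stdVec l : Model n) m
          = ∑ i, ∑ j, partialDeriv i (fun z => G z j l) y * v i * w j := by
        refine Finset.sum_congr rfl fun i _ => Finset.sum_congr rfl fun j _ => ?_
        simp
      have e3 : ∑ i, ∑ j, ∑ m, partialDeriv i (fun z => G z j m) y
            * (stdVec l : Model n) i * v j * w m
          = ∑ i, ∑ j, partialDeriv l (fun z => G z i j) y * v i * w j := by
        rw [Finset.sum_eq_single l]
        · simp
        · intro b _ hb
          simp [hb]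
        · simp
      rw [e1, e2, e3, ← Finset.sum_add_distrib, ← Finset.sum_sub_distrib, Finset.mul_sum]
      refine Finset.sum_congr rfl fun i _ => ?_
      rw [← Finset.sum_add_distrib, ← Finset.sum_sub_distrib, Finset.mul_sum]
      exact Finset.sum_congr rfl fun j _ => by ring
    simp only [this, christoffel]
    simp only [Finset.mul_sum, Finset.sum_mul]
    rw [Finset.sum_comm' (t' := Finset.univ) (s' := fun _ => Finset.univ) (by simp)]
    conv_rhs => rw [Finset.sum_comm]
    rw [Finset.sum_comm]
    refine Finset.sum_congr rfl fun i _ => ?_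
    conv_rhs => rw [Finset.sum_comm]
    exact Finset.sum_congr rfl fun j _ => Finset.sum_congr rfl fun l _ => by ring
  rw [hα, h.metricForm_raise]
  simp [α]

/-- The equation `∇g = 0`. In the sum of the Koszul formulas for `(v, a, b)` and `(v, b, a)` the
derivatives in the directions `a` and `b` cancel. -/
lemma metricForm_compat (h : IsMetricAt G y) (v a b : Model n) :
    fderiv ℝ (metricForm G) y v a b
      = metricForm G y (connForm G y v a) b + metricForm G y a (connForm G y v b) := by
  have hs : ∀ x a b, fderiv ℝ (metricForm G) y x a b = fderiv ℝ (metricForm G) y x b a := by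
    intro x a b
    rw [← fderiv_bilin_apply h.differentiableAt_metricForm,
      ← fderiv_bilin_apply h.differentiableAt_metricForm]
    congr 2
    ext z
    exact h.metricForm_symm z a b
  have h1 := h.koszul v a b
  have h2 := h.koszul v b a
  rw [h.metricForm_symm y a]
  have h3 := hs v a b
  have h4 := hs a v b
  have h5 := hs b v a
  linarith

end IsMetricAt

end Smoothness

end TensorCalculus

/-! ### Curvature, Ricci form and scalar curvature without indices. -/

section Curvature

variable {n : ℕ}

/-- The curvature operator `v ↦ R(v, w) z` of a connection form `Γ` at `y`. -/
def curv (Γ : Model n → Model n →L[ℝ] Model n →L[ℝ] Model n) (y w z : Model n) :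
    Model n →L[ℝ] Model n :=
  ((fderiv ℝ Γ y).flip z).flip w - fderiv ℝ Γ y w z + (Γ y).flip (Γ y z w) - (Γ y w).comp (Γ y z)

lemma curv_apply (Γ : Model n → Model n →L[ℝ] Model n →L[ℝ] Model n) (y w z v : Model n) :
    curv Γ y w z v = fderiv ℝ Γ y v z w - fderiv ℝ Γ y w z v + Γ y v (Γ y z w)
      - Γ y w (Γ y z v) := rfl

/-- The trace of an endomorphism of `ℝⁿ`, as the sum of its diagonal entries. -/
def diagSum (T : Model n →ₗ[ℝ] Model n) : ℝ := ∑ k, T (stdVec k) k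

lemma diagSum_eq_trace (T : Model n →ₗ[ℝ] Model n) :
    diagSum T = LinearMap.trace ℝ (Model n) T := by
  rw [LinearMap.trace_eq_matrix_trace ℝ (EuclideanSpace.basisFun (Fin n) ℝ).toBasis]
  simp [diagSum, Matrix.trace, LinearMap.toMatrix_apply]

set_option synthInstance.maxHeartbeats 200000 in
/-- The Ricci form of a connection form. -/
def ricForm (Γ : Model n → Model n →L[ℝ] Model n →L[ℝ] Model n) (y : Model n) :
    Model n →ₗ[ℝ] Model n →ₗ[ℝ] ℝ :=
  LinearMap.mk₂ ℝ (fun z w => diagSum (curv Γ y w z : Model n →ₗ[ℝ] Model n))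
    (fun a b c => by
      simp only [diagSum, ContinuousLinearMap.coe_coe, curv_apply, map_add, add_apply,
        ← Finset.sum_add_distrib]
      refine Finset.sum_congr rfl fun k _ => ?_
      simp only [PiLp.add_apply, PiLp.sub_apply]; ring)
    (fun r a b => by
      simp only [diagSum, ContinuousLinearMap.coe_coe, curv_apply, map_smul, smul_apply,
        smul_eq_mul, Finset.mul_sum]
      refine Finset.sum_congr rfl fun k _ => ?_
      simp only [PiLp.add_apply, PiLp.sub_apply, PiLp.smul_apply, smul_eq_mul]; ring)
    (fun a b c => by
      simp only [diagSum, ContinuousLinearMap.coe_coe, curv_apply, map_add, add_apply,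
        ← Finset.sum_add_distrib]
      refine Finset.sum_congr rfl fun k _ => ?_
      simp only [PiLp.add_apply, PiLp.sub_apply]; ring)
    (fun r a b => by
      simp only [diagSum, ContinuousLinearMap.coe_coe, curv_apply, map_smul, smul_apply,
        smul_eq_mul, Finset.mul_sum]
      refine Finset.sum_congr rfl fun k _ => ?_
      simp only [PiLp.add_apply, PiLp.sub_apply, PiLp.smul_apply, smul_eq_mul]; ring)

lemma ricForm_apply (Γ : Model n → Model n →L[ℝ] Model n →L[ℝ] Model n) (y z w : Model n) :
    ricForm Γ y z w = diagSum (curv Γ y w z : Model n →ₗ[ℝ] Model n) := rfl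

variable {G G' : Model n → Matrix (Fin n) (Fin n) ℝ} {y : Model n}

lemma fderiv_connForm_stdVec (h : IsMetricAt G y) (v : Model n) (i j k : Fin n) :
    fderiv ℝ (connForm G) y v (stdVec i) (stdVec j) k
      = fderiv ℝ (christoffel G k i j) y v := by
  rw [← fderiv_bilin_apply h.differentiableAt_connForm]
  have h1 : DifferentiableAt ℝ (fun z => connForm G z (stdVec i) (stdVec j)) y :=
    (h.differentiableAt_connForm.clm_apply (differentiableAt_const _)).clm_apply
      (differentiableAt_const _)
  have h2 : HasFDerivAt (fun z => (EuclideanSpace.proj (𝕜 := ℝ) k : Model n →L[ℝ] ℝ)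
      (connForm G z (stdVec i) (stdVec j))) _ y :=
    (EuclideanSpace.proj (𝕜 := ℝ) k : Model n →L[ℝ] ℝ).hasFDerivAt.comp y h1.hasFDerivAt
  have h3 : (fun z => (EuclideanSpace.proj (𝕜 := ℝ) k : Model n →L[ℝ] ℝ)
      (connForm G z (stdVec i) (stdVec j))) = christoffel G k i j := by
    ext z
    exact connForm_stdVec G z i j k
  rw [h3] at h2
  rw [h2.fderiv]
  rfl

/-- The index formula is the trace of the curvature operator written out in the standard basis. This
allows curvature to be treated as a tensor from here on. -/
lemma localRicci_eq (h : IsMetricAt G y) (i j : Fin n) :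
    localRicci G i j y = ricForm (connForm G) y (stdVec i) (stdVec j) := by
  rw [ricForm_apply, diagSum, localRicci, ← Finset.sum_add_distrib]
  refine Finset.sum_congr rfl fun k _ => ?_
  rw [ContinuousLinearMap.coe_coe, curv_apply]
  simp only [PiLp.add_apply, PiLp.sub_apply]
  rw [fderiv_connForm_stdVec h, fderiv_connForm_stdVec h, Finset.sum_sub_distrib]
  have e : ∀ a b c : Fin n, connForm G y (stdVec a) (connForm G y (stdVec b) (stdVec c)) k
      = ∑ l, christoffel G k a l y * christoffel G l b c y := by
    intro a b c
    rw [connForm_apply, Finset.sum_eq_single a]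
    · simp only [connForm_stdVec]
      simp
    · intro b _ hb
      simp [hb]
    · simp
  rw [e, e]
  simp only [partialDeriv]
  ring

/-- Turns a contraction with the inverse metric into the trace of an endomorphism, which does not
depend on the basis. Scalar curvature, Laplacian and squared gradient are all brought to this form.
-/
lemma sum_inv_mul_eq_diagSum (h : IsMetricAt G y) {B : Model n → Model n → ℝ}
    {T : Model n →ₗ[ℝ] Model n} (hT : ∀ v z, metricForm G y (T v) z = B v z) :
    ∑ i, ∑ j, (G y)⁻¹ i j * B (stdVec i) (stdVec j) = diagSum T := by
  unfold diagSum
  refine Finset.sum_congr rfl fun i _ => ?_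
  have h1 : G y * (G y)⁻¹ = 1 := Matrix.mul_nonsing_inv _ h.isUnit_det
  have hinv : ∀ a b, (G y)⁻¹ a b = (G y)⁻¹ b a := by
    have : (G y).transpose = G y := by ext a b; exact h.symm y b a
    intro a b
    conv_lhs => rw [← this, ← Matrix.transpose_nonsing_inv]
    rfl
  calc ∑ j, (G y)⁻¹ i j * B (stdVec i) (stdVec j)
      = ∑ j, ∑ k, (G y k j * (G y)⁻¹ j i) * T (stdVec i) k := by
        refine Finset.sum_congr rfl fun j _ => ?_
        rw [← hT, metricForm_apply, Finset.mul_sum]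
        refine Finset.sum_congr rfl fun k _ => ?_
        rw [Finset.sum_eq_single j]
        · simp [hinv i j]; ring
        · intro b _ hb
          simp [hb]
        · simp
    _ = ∑ k, (G y * (G y)⁻¹) k i * T (stdVec i) k := by
        rw [Finset.sum_comm]
        refine Finset.sum_congr rfl fun k _ => ?_
        rw [Matrix.mul_apply, Finset.sum_mul]
    _ = T (stdVec i) i := by simp [h1, Matrix.one_apply]

/-- The endomorphism representing a bilinear form with respect to the metric. -/
def raiseEnd (G : Model n → Matrix (Fin n) (Fin n) ℝ) (y : Model n)
    (B : Model n →ₗ[ℝ] Model n →ₗ[ℝ] ℝ) : Model n →ₗ[ℝ] Model n :=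
  (raise G y).comp B

lemma metricForm_raiseEnd (h : IsMetricAt G y) (B : Model n →ₗ[ℝ] Model n →ₗ[ℝ] ℝ)
    (v z : Model n) : metricForm G y (raiseEnd G y B v) z = B v z :=
  h.metricForm_raise (B v) z

lemma localScalar_eq (h : IsMetricAt G y) :
    localScalar G y = diagSum (raiseEnd G y (ricForm (connForm G) y)) := by
  rw [← sum_inv_mul_eq_diagSum h (metricForm_raiseEnd h _)]
  unfold localScalar
  simp only [localRicci_eq h]

end Curvature

/-! ### Invariance of the scalar curvature under coordinate changes. -/

section Pullback

variable {n : ℕ}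

lemma minSmoothness_two_le_infty : minSmoothness ℝ 2 ≤ (∞ : WithTop ℕ∞) := by
  rw [minSmoothness_of_isRCLikeNormedField]
  exact WithTop.coe_le_coe.2 le_top

set_option synthInstance.maxHeartbeats 400000 in
lemma fderiv_bilin_comp {E F : Type*} [NormedAddCommGroup E] [NormedSpace ℝ E]
    [NormedAddCommGroup F] [NormedSpace ℝ F]
    {B : E → E →L[ℝ] E →L[ℝ] F} {ψ a b : E → E} {y : E}
    (hB : DifferentiableAt ℝ B (ψ y)) (hψ : DifferentiableAt ℝ ψ y)
    (ha : DifferentiableAt ℝ a y) (hb : DifferentiableAt ℝ b y) (x : E) :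
    fderiv ℝ (fun z => B (ψ z) (a z) (b z)) y x = fderiv ℝ B (ψ y) (fderiv ℝ ψ y x) (a y) (b y)
      + B (ψ y) (fderiv ℝ a y x) (b y) + B (ψ y) (a y) (fderiv ℝ b y x) := by
  have h0 : HasFDerivAt (fun z => B (ψ z)) ((fderiv ℝ B (ψ y)).comp (fderiv ℝ ψ y)) y :=
    HasFDerivAt.comp (g := B) y hB.hasFDerivAt hψ.hasFDerivAt
  have h1 : HasFDerivAt (fun z => B (ψ z) (a z) (b z)) _ y :=
    (h0.clm_apply ha.hasFDerivAt).clm_apply hb.hasFDerivAt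
  rw [h1.fderiv]
  simp
  abel

lemma fderiv_clm_apply_comp {E F : Type*} [NormedAddCommGroup E] [NormedSpace ℝ E]
    [NormedAddCommGroup F] [NormedSpace ℝ F]
    {J : E → E →L[ℝ] F} {a : E → E} {y : E}
    (hJ : DifferentiableAt ℝ J y) (ha : DifferentiableAt ℝ a y) (x : E) :
    fderiv ℝ (fun z => J z (a z)) y x = fderiv ℝ J y x (a y) + J y (fderiv ℝ a y x) := by
  rw [(hJ.hasFDerivAt.clm_apply ha.hasFDerivAt).fderiv]
  simp
  abel

variable {G G' : Model n → Matrix (Fin n) (Fin n) ℝ} {φ : Model n → Model n} {y : Model n}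

/-- `G'` is the pullback of the metric `G` under the map `φ` near `y`. -/
structure IsPullbackAt (G' G : Model n → Matrix (Fin n) (Fin n) ℝ) (φ : Model n → Model n)
    (y : Model n) : Prop where
  source : IsMetricAt G' y
  target : IsMetricAt G (φ y)
  smooth : ∀ᶠ z in 𝓝 y, ContDiffAt ℝ ∞ φ z
  eq : ∀ᶠ z in 𝓝 y, ∀ v w,
    metricForm G' z v w = metricForm G (φ z) (fderiv ℝ φ z v) (fderiv ℝ φ z w)

namespace IsPullbackAt

variable (h : IsPullbackAt G' G φ y)
include h

lemma eventually : ∀ᶠ z in 𝓝 y, IsPullbackAt G' G φ z := by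
  have h1 := h.smooth.self_of_nhds.continuousAt.eventually h.target.eventually
  filter_upwards [h.source.eventually, h1, h.smooth.eventually_nhds, h.eq.eventually_nhds]
    with z a b c d
  exact ⟨a, b, c, d⟩

lemma differentiableAt : DifferentiableAt ℝ φ y :=
  h.smooth.self_of_nhds.differentiableAt (by simp)

lemma contDiffAt_fderiv : ContDiffAt ℝ ∞ (fderiv ℝ φ) y :=
  h.smooth.self_of_nhds.fderiv_right (m := ∞) (by simp)

lemma contDiffAt_fderiv_fderiv : ContDiffAt ℝ ∞ (fderiv ℝ (fderiv ℝ φ)) y :=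
  h.contDiffAt_fderiv.fderiv_right (m := ∞) (by simp)

lemma differentiableAt_fderiv : DifferentiableAt ℝ (fderiv ℝ φ) y :=
  h.contDiffAt_fderiv.differentiableAt (by simp)

lemma hessian_symm (v w : Model n) :
    fderiv ℝ (fderiv ℝ φ) y v w = fderiv ℝ (fderiv ℝ φ) y w v :=
  (h.smooth.self_of_nhds.isSymmSndFDerivAt minSmoothness_two_le_infty) v w

/-- A vector killed by the differential is `G'`-orthogonal to everything, and `G'` is nondegenerate.
-/
lemma injective : Function.Injective (fderiv ℝ φ y) := by
  rw [injective_iff_map_eq_zero]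
  intro v hv
  refine h.source.eq_of_metricForm_eq fun z => ?_
  rw [h.eq.self_of_nhds, hv]
  simp

lemma surjective : Function.Surjective (fderiv ℝ φ y) :=
  (LinearMap.injective_iff_surjective (f := (fderiv ℝ φ y : Model n →ₗ[ℝ] Model n))).1 h.injective

lemma fderiv_metricForm (x a b : Model n) :
    fderiv ℝ (metricForm G') y x a b
      = fderiv ℝ (metricForm G) (φ y) (fderiv ℝ φ y x) (fderiv ℝ φ y a) (fderiv ℝ φ y b)
        + metricForm G (φ y) (fderiv ℝ (fderiv ℝ φ) y x a) (fderiv ℝ φ y b)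
        + metricForm G (φ y) (fderiv ℝ φ y a) (fderiv ℝ (fderiv ℝ φ) y x b) := by
  have hJ := h.differentiableAt_fderiv
  have hJa : ∀ a, DifferentiableAt ℝ (fun z => fderiv ℝ φ z a) y := fun a =>
    hJ.clm_apply (differentiableAt_const a)
  have hd : ∀ a, fderiv ℝ (fun z => fderiv ℝ φ z a) y x = fderiv ℝ (fderiv ℝ φ) y x a := by
    intro a
    rw [fderiv_clm_apply_comp hJ (differentiableAt_const a)]
    simp
  rw [← fderiv_bilin_apply h.source.differentiableAt_metricForm]
  have e : (fun z => metricForm G' z a b) =ᶠ[𝓝 y]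
      fun z => metricForm G (φ z) (fderiv ℝ φ z a) (fderiv ℝ φ z b) := by
    filter_upwards [h.eq] with z hz using hz a b
  rw [e.fderiv_eq, fderiv_bilin_comp h.target.differentiableAt_metricForm h.differentiableAt
    (hJa a) (hJa b), hd, hd]

/-- The transformation law of the Christoffel symbols. -/
lemma map_connForm (v w : Model n) :
    fderiv ℝ φ y (connForm G' y v w)
      = connForm G (φ y) (fderiv ℝ φ y v) (fderiv ℝ φ y w) + fderiv ℝ (fderiv ℝ φ) y v w := by
  refine h.target.eq_of_metricForm_eq fun x => ?_
  obtain ⟨z, rfl⟩ := h.surjective x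
  rw [← h.eq.self_of_nhds, map_add, add_apply]
  -- The Koszul formula for `G'` acquires six terms with the second derivative of `φ`. By its
  -- symmetry four of them cancel, leaving twice the pairing of `D²φ(v, w)` with `Dφ z`.
  have h1 := h.source.koszul v w z
  have h2 := h.target.koszul (fderiv ℝ φ y v) (fderiv ℝ φ y w) (fderiv ℝ φ y z)
  rw [h.fderiv_metricForm, h.fderiv_metricForm, h.fderiv_metricForm] at h1
  rw [h.hessian_symm w v, h.hessian_symm z v, h.hessian_symm z w] at h1
  rw [h.target.metricForm_symm _ (fderiv ℝ φ y v) (fderiv ℝ (fderiv ℝ φ) y w z),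
    h.target.metricForm_symm _ (fderiv ℝ φ y w) (fderiv ℝ (fderiv ℝ φ) y v z)] at h1
  linarith

-- The law `map_connForm` holds on a neighbourhood, so it may be differentiated in the direction
-- `x`.
set_option synthInstance.maxHeartbeats 200000 in
lemma map_fderiv_connForm (x v w : Model n) :
    fderiv ℝ (fderiv ℝ φ) y x (connForm G' y v w)
        + fderiv ℝ φ y (fderiv ℝ (connForm G') y x v w)
      = fderiv ℝ (connForm G) (φ y) (fderiv ℝ φ y x) (fderiv ℝ φ y v) (fderiv ℝ φ y w)
        + connForm G (φ y) (fderiv ℝ (fderiv ℝ φ) y x v) (fderiv ℝ φ y w)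
        + connForm G (φ y) (fderiv ℝ φ y v) (fderiv ℝ (fderiv ℝ φ) y x w)
        + fderiv ℝ (fderiv ℝ (fderiv ℝ φ)) y x v w := by
  have hJ := h.differentiableAt_fderiv
  have hJa : ∀ a, DifferentiableAt ℝ (fun z => fderiv ℝ φ z a) y := fun a =>
    hJ.clm_apply (differentiableAt_const a)
  have hd : ∀ a, fderiv ℝ (fun z => fderiv ℝ φ z a) y x = fderiv ℝ (fderiv ℝ φ) y x a := by
    intro a
    rw [fderiv_clm_apply_comp hJ (differentiableAt_const a)]
    simp
  have hJJ : DifferentiableAt ℝ (fderiv ℝ (fderiv ℝ φ)) y :=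
    h.contDiffAt_fderiv_fderiv.differentiableAt (by simp)
  have hΓ' : DifferentiableAt ℝ (fun z => connForm G' z v w) y :=
    (h.source.differentiableAt_connForm.clm_apply (differentiableAt_const v)).clm_apply
      (differentiableAt_const w)
  have hΓ : DifferentiableAt ℝ
      (fun z => connForm G (φ z) (fderiv ℝ φ z v) (fderiv ℝ φ z w)) y :=
    ((DifferentiableAt.comp (g := connForm G) y h.target.differentiableAt_connForm
      h.differentiableAt).clm_apply (hJa v)).clm_apply
      (hJa w)
  have e : (fun z => fderiv ℝ φ z (connForm G' z v w)) =ᶠ[𝓝 y]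
      fun z => connForm G (φ z) (fderiv ℝ φ z v) (fderiv ℝ φ z w)
        + fderiv ℝ (fderiv ℝ φ) z v w := by
    filter_upwards [h.eventually] with z hz using hz.map_connForm v w
  have e1 := congrArg (fun L : Model n →L[ℝ] Model n => L x) e.fderiv_eq
  have hJJa : DifferentiableAt ℝ (fun z => fderiv ℝ (fderiv ℝ φ) z v w) y :=
    (hJJ.clm_apply (differentiableAt_const v)).clm_apply (differentiableAt_const w)
  rw [fderiv_clm_apply_comp hJ hΓ', fderiv_fun_add hΓ hJJa, add_apply,
    fderiv_bilin_comp h.target.differentiableAt_connForm h.differentiableAt (hJa v) (hJa w),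
    hd, hd, fderiv_bilin_apply h.source.differentiableAt_connForm, fderiv_bilin_apply hJJ] at e1
  exact e1

lemma third_symm_left (x v w : Model n) :
    fderiv ℝ (fderiv ℝ (fderiv ℝ φ)) y x v w = fderiv ℝ (fderiv ℝ (fderiv ℝ φ)) y v x w := by
  have := (h.contDiffAt_fderiv.isSymmSndFDerivAt minSmoothness_two_le_infty) x v
  rw [this]

lemma third_symm_right (x v w : Model n) :
    fderiv ℝ (fderiv ℝ (fderiv ℝ φ)) y x v w = fderiv ℝ (fderiv ℝ (fderiv ℝ φ)) y x w v := by
  have hJJ : DifferentiableAt ℝ (fderiv ℝ (fderiv ℝ φ)) y :=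
    h.contDiffAt_fderiv_fderiv.differentiableAt (by simp)
  rw [← fderiv_bilin_apply hJJ, ← fderiv_bilin_apply hJJ]
  have e : (fun z => fderiv ℝ (fderiv ℝ φ) z v w) =ᶠ[𝓝 y]
      fun z => fderiv ℝ (fderiv ℝ φ) z w v := by
    filter_upwards [h.eventually] with z hz using hz.hessian_symm v w
  rw [e.fderiv_eq]

/-- The curvature is a tensor. -/
lemma map_curv (w z v : Model n) :
    fderiv ℝ φ y (curv (connForm G') y w z v)
      = curv (connForm G) (φ y) (fderiv ℝ φ y w) (fderiv ℝ φ y z) (fderiv ℝ φ y v) := by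
  have h1 := eq_sub_of_add_eq' (h.map_fderiv_connForm v z w)
  have h2 := eq_sub_of_add_eq' (h.map_fderiv_connForm w z v)
  rw [curv_apply, curv_apply, map_sub, map_add, map_sub, h1, h2]
  simp only [h.map_connForm, map_add]
  -- The curvature is antisymmetrised in `v` and `w`, so the symmetric second and third derivatives
  -- of `φ` drop out.
  rw [h.third_symm_left v z w, h.third_symm_left w z v, h.third_symm_right z w v,
    h.hessian_symm w v, h.hessian_symm v z, h.hessian_symm w z,
    h.target.connForm_symm _ _ (fderiv ℝ φ y w), h.target.connForm_symm _ _ (fderiv ℝ φ y v)]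
  abel

/-- The differential of the coordinate change as a linear equivalence. -/
def equiv : Model n ≃ₗ[ℝ] Model n :=
  LinearEquiv.ofBijective (fderiv ℝ φ y : Model n →ₗ[ℝ] Model n) ⟨h.injective, h.surjective⟩

/-- The hypothesis says that `T'` and `T` are conjugate by the differential of `φ`, and conjugate
endomorphisms have the same trace. -/
lemma diagSum_eq {T' T : Model n →ₗ[ℝ] Model n}
    (hT : ∀ v, fderiv ℝ φ y (T' v) = T (fderiv ℝ φ y v)) : diagSum T' = diagSum T := by
  rw [diagSum_eq_trace, diagSum_eq_trace, ← LinearMap.trace_conj' T' h.equiv]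
  congr 1
  ext1 x
  obtain ⟨v, rfl⟩ := h.equiv.surjective x
  rw [LinearEquiv.conj_apply_apply, LinearEquiv.symm_apply_apply]
  exact hT v

lemma ricForm_eq (z w : Model n) :
    ricForm (connForm G') y z w
      = ricForm (connForm G) (φ y) (fderiv ℝ φ y z) (fderiv ℝ φ y w) := by
  rw [ricForm_apply, ricForm_apply]
  exact h.diagSum_eq fun v => h.map_curv w z v

/-- The scalar curvature does not depend on the coordinates. -/
theorem localScalar_eq : localScalar G' y = localScalar G (φ y) := by
  rw [RiemGeom.localScalar_eq h.source, RiemGeom.localScalar_eq h.target]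
  refine h.diagSum_eq fun v => h.target.eq_of_metricForm_eq fun x => ?_
  obtain ⟨z, rfl⟩ := h.surjective x
  rw [← h.eq.self_of_nhds, metricForm_raiseEnd h.source, metricForm_raiseEnd h.target,
    h.ricForm_eq]

end IsPullbackAt

end Pullback

/-! ### Curvature under a conformal change of metric. -/

section Conformal

variable {n : ℕ}

/-- The Laplacian `∑ gⁱʲ (∂ᵢ∂ⱼ f - Γᵏᵢⱼ ∂ₖ f)` in coordinates. -/
def localLaplacian (G : Model n → Matrix (Fin n) (Fin n) ℝ) (f : Model n → ℝ) (y : Model n) : ℝ :=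
  ∑ i, ∑ j, (G y)⁻¹ i j *
    (partialDeriv i (partialDeriv j f) y - ∑ k, christoffel G k i j y * partialDeriv k f y)

/-- The squared norm of the gradient in coordinates. -/
def localGradSq (G : Model n → Matrix (Fin n) (Fin n) ℝ) (f : Model n → ℝ) (y : Model n) : ℝ :=
  ∑ i, ∑ j, (G y)⁻¹ i j * (partialDeriv i f y * partialDeriv j f y)

variable {G G' : Model n → Matrix (Fin n) (Fin n) ℝ} {f : Model n → ℝ} {y : Model n}

/-- The Hessian of a function with respect to the metric `G`. -/
def hessForm (G : Model n → Matrix (Fin n) (Fin n) ℝ) (f : Model n → ℝ) (y : Model n) :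
    Model n →ₗ[ℝ] Model n →ₗ[ℝ] ℝ :=
  LinearMap.mk₂ ℝ (fun v w => fderiv ℝ (fderiv ℝ f) y v w - fderiv ℝ f y (connForm G y v w))
    (fun a b c => by simp only [map_add, add_apply]; ring)
    (fun r a b => by simp only [map_smul, smul_apply, smul_eq_mul]; ring)
    (fun a b c => by simp only [map_add]; ring)
    (fun r a b => by simp only [map_smul, smul_eq_mul]; ring)

lemma hessForm_apply (v w : Model n) :
    hessForm G f y v w = fderiv ℝ (fderiv ℝ f) y v w - fderiv ℝ f y (connForm G y v w) := rfl

/-- The gradient of a function with respect to the metric `G`. -/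
def grad (G : Model n → Matrix (Fin n) (Fin n) ℝ) (f : Model n → ℝ) (y : Model n) : Model n :=
  raise G y (fderiv ℝ f y : Model n →ₗ[ℝ] ℝ)

lemma IsMetricAt.metricForm_grad (h : IsMetricAt G y) (x : Model n) :
    metricForm G y (grad G f y) x = fderiv ℝ f y x :=
  h.metricForm_raise _ x

lemma contDiffAt_fderiv_of_contDiffAt (hf : ContDiffAt ℝ ∞ f y) :
    ContDiffAt ℝ ∞ (fderiv ℝ f) y := hf.fderiv_right (m := ∞) (by simp)

lemma contDiffAt_grad (h : IsMetricAt G y) (hf : ContDiffAt ℝ ∞ f y) :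
    ContDiffAt ℝ ∞ (grad G f) y := by
  have hk : ∀ k, ContDiffAt ℝ ∞ (fun z => ∑ j, (G z)⁻¹ k j * partialDeriv j f z) y := fun k =>
    ContDiffAt.sum fun j _ => (h.contDiffAt_inv k j).mul (contDiffAt_partialDeriv hf j)
  have hk' : ∀ k, ContDiffAt ℝ ∞
      (fun z => (∑ j, (G z)⁻¹ k j * partialDeriv j f z) • (stdVec k : Model n)) y := fun k =>
    contDiffAt_smul_const (hk k) _
  have h1 : ContDiffAt ℝ ∞
      (fun z => ∑ k, (∑ j, (G z)⁻¹ k j * partialDeriv j f z) • (stdVec k : Model n)) y :=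
    ContDiffAt.sum fun k _ => hk' k
  exact h1

lemma partialDeriv_partialDeriv (hf : ContDiffAt ℝ ∞ f y) (i j : Fin n) :
    partialDeriv i (partialDeriv j f) y = fderiv ℝ (fderiv ℝ f) y (stdVec i) (stdVec j) := by
  unfold partialDeriv
  rw [fderiv_clm_apply_comp ((contDiffAt_fderiv_of_contDiffAt hf).differentiableAt (by simp))
    (differentiableAt_const _)]
  simp

lemma localLaplacian_eq (h : IsMetricAt G y) (hf : ContDiffAt ℝ ∞ f y) :
    localLaplacian G f y = diagSum (raiseEnd G y (hessForm G f y)) := by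
  rw [← sum_inv_mul_eq_diagSum h (metricForm_raiseEnd h _)]
  unfold localLaplacian
  refine Finset.sum_congr rfl fun i _ => Finset.sum_congr rfl fun j _ => ?_
  rw [hessForm_apply, partialDeriv_partialDeriv hf, fderiv_apply_eq_sum f]
  congr 2
  exact Finset.sum_congr rfl fun k _ => by rw [connForm_stdVec, mul_comm]

/-- The form `df ⊗ df` is represented by the rank-one endomorphism `v ↦ df(v) grad f`, whose trace
is `df(grad f)`. -/
lemma localGradSq_eq (h : IsMetricAt G y) : localGradSq G f y = fderiv ℝ f y (grad G f y) := by
  have h1 := sum_inv_mul_eq_diagSum h (B := fun v z => fderiv ℝ f y v * fderiv ℝ f y z)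
    (T := (fderiv ℝ f y : Model n →ₗ[ℝ] ℝ).smulRight (grad G f y)) (fun v z => by
      simp [h.metricForm_grad])
  unfold localGradSq
  refine h1.trans ?_
  rw [← sum_apply_stdVec_mul]
  simp [diagSum]

lemma hessian_symm_of_contDiffAt (hf : ContDiffAt ℝ ∞ f y) (v w : Model n) :
    fderiv ℝ (fderiv ℝ f) y v w = fderiv ℝ (fderiv ℝ f) y w v :=
  (hf.isSymmSndFDerivAt minSmoothness_two_le_infty) v w

lemma hessForm_symm (h : IsMetricAt G y) (hf : ContDiffAt ℝ ∞ f y) (v w : Model n) :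
    hessForm G f y v w = hessForm G f y w v := by
  rw [hessForm_apply, hessForm_apply, hessian_symm_of_contDiffAt hf, h.connForm_symm]

/-- The covariant derivative of the gradient is the Hessian with an index raised: differentiate
`g(grad f, b) = df(b)` and use `metricForm_compat`. -/
lemma fderiv_grad (h : IsMetricAt G y) (hf : ∀ᶠ z in 𝓝 y, ContDiffAt ℝ ∞ f z) (x : Model n) :
    fderiv ℝ (grad G f) y x
      = raiseEnd G y (hessForm G f y) x - connForm G y x (grad G f y) := by
  have hf0 := hf.self_of_nhds
  refine h.eq_of_metricForm_eq fun b => ?_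
  have hA : DifferentiableAt ℝ (grad G f) y := (contDiffAt_grad h hf0).differentiableAt (by simp)
  have e : (fun z => metricForm G z (grad G f z) b) =ᶠ[𝓝 y] fun z => fderiv ℝ f z b := by
    filter_upwards [h.eventually] with z hz using hz.metricForm_grad b
  have e1 := congrArg (fun L : Model n →L[ℝ] ℝ => L x) e.fderiv_eq
  have hB : DifferentiableAt ℝ (metricForm G) (id y) := h.differentiableAt_metricForm
  have h2 := fderiv_bilin_comp (ψ := id) (a := grad G f) (b := fun _ => b) hB differentiableAt_id hA
    (differentiableAt_const b) x
  simp only [id_eq, fderiv_id, ContinuousLinearMap.coe_id', fderiv_fun_const, Pi.zero_apply,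
    zero_apply, map_zero, add_zero] at h2
  rw [h2, fderiv_clm_apply_comp ((contDiffAt_fderiv_of_contDiffAt hf0).differentiableAt (by simp))
    (differentiableAt_const b), h.metricForm_compat] at e1
  simp only [fderiv_fun_const, Pi.zero_apply, zero_apply, map_zero, add_zero] at e1
  rw [map_sub, sub_apply, metricForm_raiseEnd h, hessForm_apply]
  rw [h.metricForm_grad] at e1
  linarith

/-- Near `y`, the metric `G'` equals `exp (2 f)` times the metric `G`. -/
structure IsConformalAt (G' G : Model n → Matrix (Fin n) (Fin n) ℝ) (f : Model n → ℝ)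
    (y : Model n) : Prop where
  base : IsMetricAt G y
  smooth : ∀ᶠ z in 𝓝 y, ContDiffAt ℝ ∞ f z
  symm : ∀ z i j, G' z i j = G' z j i
  eq : ∀ᶠ z in 𝓝 y, G' z = Real.exp (2 * f z) • G z

namespace IsConformalAt

variable (h : IsConformalAt G' G f y)
include h

lemma eventually : ∀ᶠ z in 𝓝 y, IsConformalAt G' G f z := by
  filter_upwards [h.base.eventually, h.smooth.eventually_nhds, h.eq.eventually_nhds] with z a b c
  exact ⟨a, b, h.symm, c⟩

lemma isMetricAt : IsMetricAt G' y := by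
  refine ⟨?_, ?_, h.symm⟩
  · filter_upwards [h.base.eventually, h.smooth, h.eq.eventually_nhds] with z h1 h2 h3 i j
    have e : (fun z => G' z i j) =ᶠ[𝓝 z] fun z => Real.exp (2 * f z) * G z i j := by
      filter_upwards [h3] with x hx
      rw [hx]; rfl
    exact ((contDiffAt_const.mul h2).exp.mul (h1.smooth i j)).congr_of_eventuallyEq e
  · rw [h.eq.self_of_nhds, Matrix.det_smul]
    exact mul_ne_zero (pow_ne_zero _ (Real.exp_pos _).ne') h.base.det_ne

lemma metricForm_eq (v w : Model n) :
    metricForm G' y v w = Real.exp (2 * f y) * metricForm G y v w := by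
  rw [metricForm_apply, metricForm_apply, h.eq.self_of_nhds]
  simp only [Matrix.smul_apply, smul_eq_mul, Finset.mul_sum, mul_assoc]

lemma differentiableAt : DifferentiableAt ℝ f y :=
  h.smooth.self_of_nhds.differentiableAt (by simp)

lemma fderiv_metricForm (x v w : Model n) :
    fderiv ℝ (metricForm G') y x v w = Real.exp (2 * f y) *
      (2 * fderiv ℝ f y x * metricForm G y v w + fderiv ℝ (metricForm G) y x v w) := by
  rw [← fderiv_bilin_apply h.isMetricAt.differentiableAt_metricForm,
    ← fderiv_bilin_apply h.base.differentiableAt_metricForm]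
  have e : (fun z => metricForm G' z v w) =ᶠ[𝓝 y]
      fun z => Real.exp (2 * f z) * metricForm G z v w := by
    filter_upwards [h.eventually] with z hz using hz.metricForm_eq v w
  have hg : DifferentiableAt ℝ (fun z => metricForm G z v w) y :=
    (h.base.differentiableAt_metricForm.clm_apply (differentiableAt_const v)).clm_apply
      (differentiableAt_const w)
  have h1 : HasFDerivAt (fun z => Real.exp (2 * f z) * metricForm G z v w) _ y :=
    (h.differentiableAt.hasFDerivAt.const_mul 2).exp.mul hg.hasFDerivAt
  rw [e.fderiv_eq, h1.fderiv]
  simp only [add_apply, smul_apply, smul_eq_mul]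
  ring

/-- Compare the two Koszul formulas and cancel `exp (2 f)`. Each of the three derivatives of the
metric also hits the conformal factor and contributes one of the three extra terms. -/
lemma connForm_eq (v w : Model n) :
    connForm G' y v w = connForm G y v w + fderiv ℝ f y v • w + fderiv ℝ f y w • v
      - metricForm G y v w • grad G f y := by
  refine h.base.eq_of_metricForm_eq fun z => ?_
  have h1 := h.isMetricAt.koszul v w z
  have h2 := h.base.koszul v w z
  rw [h.metricForm_eq, h.fderiv_metricForm, h.fderiv_metricForm, h.fderiv_metricForm] at h1
  simp only [map_add, map_sub, map_smul, add_apply, sub_apply, smul_apply, smul_eq_mul,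
    h.base.metricForm_grad]
  have h3 := (Real.exp_pos (2 * f y)).ne'
  refine mul_left_cancel₀ h3 ?_
  linear_combination (1 / 2) * h1 - (1 / 2) * Real.exp (2 * f y) * h2

lemma fderiv_connForm (x v w : Model n) :
    fderiv ℝ (connForm G') y x v w = fderiv ℝ (connForm G) y x v w
      + fderiv ℝ (fderiv ℝ f) y x v • w + fderiv ℝ (fderiv ℝ f) y x w • v
      - fderiv ℝ (metricForm G) y x v w • grad G f y
      - metricForm G y v w • fderiv ℝ (grad G f) y x := by
  have hf := h.smooth.self_of_nhds
  have hA : DifferentiableAt ℝ (grad G f) y :=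
    (contDiffAt_grad h.base hf).differentiableAt (by simp)
  have ha : DifferentiableAt ℝ (fderiv ℝ f) y :=
    (contDiffAt_fderiv_of_contDiffAt hf).differentiableAt (by simp)
  have hda : ∀ u, HasFDerivAt (fun z => fderiv ℝ f z u) ((fderiv ℝ (fderiv ℝ f) y).flip u) y := by
    intro u
    have : (fderiv ℝ (fderiv ℝ f) y).flip u = fderiv ℝ (fun z => fderiv ℝ f z u) y := by
      ext1 x
      rw [fderiv_clm_apply_comp ha (differentiableAt_const u)]
      simp
    rw [this]
    exact (ha.clm_apply (differentiableAt_const u)).hasFDerivAt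
  have hg : DifferentiableAt ℝ (fun z => metricForm G z v w) y :=
    (h.base.differentiableAt_metricForm.clm_apply (differentiableAt_const v)).clm_apply
      (differentiableAt_const w)
  have hΓ : DifferentiableAt ℝ (fun z => connForm G z v w) y :=
    (h.base.differentiableAt_connForm.clm_apply (differentiableAt_const v)).clm_apply
      (differentiableAt_const w)
  have e : (fun z => connForm G' z v w) =ᶠ[𝓝 y] fun z => connForm G z v w
      + fderiv ℝ f z v • w + fderiv ℝ f z w • v - metricForm G z v w • grad G f z := by
    filter_upwards [h.eventually] with z hz using hz.connForm_eq v w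
  have h1 : HasFDerivAt (fun z => connForm G z v w
      + fderiv ℝ f z v • w + fderiv ℝ f z w • v - metricForm G z v w • grad G f z) _ y :=
    ((hΓ.hasFDerivAt.add ((hda v).smul_const w)).add ((hda w).smul_const v)).sub
      (hg.hasFDerivAt.smul hA.hasFDerivAt)
  rw [← fderiv_bilin_apply h.isMetricAt.differentiableAt_connForm, e.fderiv_eq, h1.fderiv]
  simp only [add_apply, sub_apply, smul_apply, ContinuousLinearMap.smulRight_apply,
    ContinuousLinearMap.flip_apply]
  rw [fderiv_bilin_apply h.base.differentiableAt_connForm,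
    fderiv_bilin_apply h.base.differentiableAt_metricForm]
  abel

/-- The curvature of a conformally changed metric. -/
lemma curv_eq (w z v : Model n) :
    curv (connForm G') y w z v = curv (connForm G) y w z v
      + hessForm G f y v z • w - hessForm G f y w z • v
      - metricForm G y z w • raiseEnd G y (hessForm G f y) v
      + metricForm G y z v • raiseEnd G y (hessForm G f y) w
      + (fderiv ℝ f y z * fderiv ℝ f y w - metricForm G y z w * fderiv ℝ f y (grad G f y)) • v
      - (fderiv ℝ f y z * fderiv ℝ f y v - metricForm G y z v * fderiv ℝ f y (grad G f y)) • w
      + (fderiv ℝ f y v * metricForm G y z w - fderiv ℝ f y w * metricForm G y z v)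
        • grad G f y := by
  have hg := h.base.metricForm_symm y
  have hΓ := h.base.connForm_symm y
  have hA : ∀ x, metricForm G y x (grad G f y) = fderiv ℝ f y x := fun x => by
    rw [hg, h.base.metricForm_grad]
  -- Derivatives of the metric and of the gradient are rewritten through the Christoffel symbols, so
  -- that the non-tensorial terms cancel and only Hessians, gradients and the metric remain.
  rw [curv_apply, curv_apply, h.fderiv_connForm, h.fderiv_connForm,
    fderiv_grad h.base h.smooth, fderiv_grad h.base h.smooth,
    h.base.metricForm_compat, h.base.metricForm_compat,
    hessian_symm_of_contDiffAt h.smooth.self_of_nhds w v]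
  simp only [h.connForm_eq, map_add, map_sub, map_smul, hessForm_apply,
    smul_eq_mul, hA]
  rw [hΓ w v, hΓ v z, hΓ w z, hg w v, hg w z, hg v z, hg (connForm G y z v) w,
    hg (connForm G y z w) v]
  module

/-- Trace of `curv_eq` over `v`: the multiples of `v` contribute a factor `n`, and every other term
is a single contraction `h1`–`h6`. -/
lemma ricForm_eq (z w : Model n) :
    ricForm (connForm G') y z w = ricForm (connForm G) y z w
      - ((n : ℝ) - 2) * hessForm G f y z w
      - (localLaplacian G f y + ((n : ℝ) - 2) * localGradSq G f y) * metricForm G y z w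
      + ((n : ℝ) - 2) * (fderiv ℝ f y z * fderiv ℝ f y w) := by
  have hf := h.smooth.self_of_nhds
  rw [ricForm_apply, ricForm_apply, localLaplacian_eq h.base hf, localGradSq_eq h.base]
  have h1 : ∑ k, hessForm G f y z (stdVec k) * w k = hessForm G f y z w :=
    linear_sum_apply_stdVec_mul (hessForm G f y z) w
  have h2 : ∑ k, metricForm G y z (stdVec k) * raiseEnd G y (hessForm G f y) w k
      = hessForm G f y z w := by
    rw [sum_apply_stdVec_mul (metricForm G y z), h.base.metricForm_symm, metricForm_raiseEnd h.base,
      hessForm_symm h.base hf]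
  have h3 := sum_apply_stdVec_mul (fderiv ℝ f y) w
  have h4 : ∀ c : ℝ, ∑ k, metricForm G y z (stdVec k) * (c * w k) = c * metricForm G y z w := by
    intro c
    rw [← sum_apply_stdVec_mul (metricForm G y z) w, Finset.mul_sum]
    exact Finset.sum_congr rfl fun k _ => by ring
  have h5 : ∀ c : ℝ, ∑ k, fderiv ℝ f y (stdVec k) * (c * grad G f y k)
      = c * fderiv ℝ f y (grad G f y) := by
    intro c
    rw [← sum_apply_stdVec_mul (fderiv ℝ f y) (grad G f y), Finset.mul_sum]
    exact Finset.sum_congr rfl fun k _ => by ring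
  have h6 : ∑ k, metricForm G y z (stdVec k) * grad G f y k = fderiv ℝ f y z := by
    rw [sum_apply_stdVec_mul (metricForm G y z), h.base.metricForm_symm, h.base.metricForm_grad]
  simp only [diagSum, ContinuousLinearMap.coe_coe, h.curv_eq, PiLp.add_apply, PiLp.sub_apply,
    PiLp.smul_apply, smul_eq_mul, Finset.sum_add_distrib, Finset.sum_sub_distrib, stdVec_apply,
    if_true, ← Finset.mul_sum, sub_mul, mul_assoc, hessForm_symm h.base hf _ z,
    Finset.sum_const, Finset.card_univ, Fintype.card_fin, nsmul_eq_mul, h1, h2, h3, h4, h5, h6]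
  ring

/-- The scalar curvature of a conformally changed metric. -/
theorem localScalar_eq :
    localScalar G' y = Real.exp (-(2 * f y)) * (localScalar G y
      - 2 * ((n : ℝ) - 1) * localLaplacian G f y
      - ((n : ℝ) - 1) * ((n : ℝ) - 2) * localGradSq G f y) := by
  have hf := h.smooth.self_of_nhds
  let c : ℝ := localLaplacian G f y + ((n : ℝ) - 2) * localGradSq G f y
  -- The new Ricci form with an index raised by the old metric `G`; raising by `G'` instead costs
  -- the factor `exp (-2 f)`. The claim is the trace of this identity.
  let T : Model n →ₗ[ℝ] Model n := raiseEnd G y (ricForm (connForm G) y)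
      - ((n : ℝ) - 2) • raiseEnd G y (hessForm G f y) - c • LinearMap.id
      + ((n : ℝ) - 2) • (fderiv ℝ f y : Model n →ₗ[ℝ] ℝ).smulRight (grad G f y)
  have hT : raiseEnd G' y (ricForm (connForm G') y) = Real.exp (-(2 * f y)) • T := by
    ext1 v
    refine h.isMetricAt.eq_of_metricForm_eq fun x => ?_
    rw [metricForm_raiseEnd h.isMetricAt, h.metricForm_eq, h.ricForm_eq]
    simp only [T, LinearMap.smul_apply, LinearMap.add_apply, LinearMap.sub_apply, LinearMap.id_apply,
      LinearMap.smulRight_apply, ContinuousLinearMap.coe_coe, map_add, map_sub, map_smul,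
      add_apply, sub_apply, smul_apply, smul_eq_mul, metricForm_raiseEnd h.base,
      h.base.metricForm_grad]
    rw [← mul_assoc (Real.exp _), ← Real.exp_add, add_neg_cancel, Real.exp_zero, one_mul]
  have hN : ∑ k, fderiv ℝ f y (stdVec k) * grad G f y k = localGradSq G f y := by
    rw [sum_apply_stdVec_mul, localGradSq_eq h.base]
  rw [RiemGeom.localScalar_eq h.isMetricAt, hT, RiemGeom.localScalar_eq h.base]
  have hL := localLaplacian_eq h.base hf
  simp only [diagSum] at hL ⊢
  simp only [T, LinearMap.smul_apply, LinearMap.add_apply, LinearMap.sub_apply, LinearMap.id_apply,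
    LinearMap.smulRight_apply, ContinuousLinearMap.coe_coe, PiLp.add_apply, PiLp.sub_apply,
    PiLp.smul_apply, smul_eq_mul, Finset.sum_add_distrib, Finset.sum_sub_distrib, ← Finset.mul_sum,
    stdVec_apply, if_true, Finset.sum_const, Finset.card_univ, Fintype.card_fin, nsmul_eq_mul, hN,
    ← hL, c]
  ring

end IsConformalAt

end Conformal

open MeasureTheory

/-! ### Derivative of the volume density and the Laplacian as a divergence. -/

section Divergence

variable {n : ℕ} {G : Model n → Matrix (Fin n) (Fin n) ℝ} {f : Model n → ℝ} {y : Model n}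

/-- Factor `det (A + tB) = det A * det (1 + t A⁻¹B)` and expand the second determinant as `1 + t tr
(A⁻¹B) + t² P(t)` with a polynomial `P`. -/
lemma hasDerivAt_det_add_smul (A B : Matrix (Fin n) (Fin n) ℝ) (hA : A.det ≠ 0) :
    HasDerivAt (fun t : ℝ => (A + t • B).det) (A.det * (A⁻¹ * B).trace) 0 := by
  have e : (fun t : ℝ => (A + t • B).det) = fun t => A.det * (1 + (A⁻¹ * B).trace * t
      + (Polynomial.eval t (1 + (Polynomial.X : Polynomial ℝ) • (A⁻¹ * B).map Polynomial.C).det.divX.divX)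
        * t ^ 2) := by
    ext t
    rw [← Matrix.det_one_add_smul, ← Matrix.det_mul, mul_add, mul_one, Matrix.mul_smul,
      ← mul_assoc, Matrix.mul_nonsing_inv _ hA.isUnit, one_mul]
  rw [e]
  refine HasDerivAt.const_mul _ ?_
  have h1 : HasDerivAt (fun t : ℝ => 1 + (A⁻¹ * B).trace * t) ((A⁻¹ * B).trace) 0 := by
    simpa using ((hasDerivAt_id (0 : ℝ)).const_mul (A⁻¹ * B).trace).const_add 1
  generalize (1 + (Polynomial.X : Polynomial ℝ) • (A⁻¹ * B).map Polynomial.C).det.divX.divX = P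
  have h2 : HasDerivAt (fun t : ℝ => P.eval t * t ^ 2) 0 0 := by
    have h3 := (P.hasDerivAt (0 : ℝ)).fun_mul (hasDerivAt_pow 2 (0 : ℝ))
    simpa using h3
  simpa using h1.fun_add h2

lemma differentiable_det :
    Differentiable ℝ (fun A : Fin n → Fin n → ℝ => (Matrix.of A).det) := by
  simp only [Matrix.det_apply, Matrix.of_apply]
  fun_prop

/-- Jacobi's formula for the derivative of a determinant. -/
lemma fderiv_det (hG : ∀ i j, DifferentiableAt ℝ (fun z => G z i j) y) (hd : (G y).det ≠ 0)
    (v : Model n) : fderiv ℝ (fun z => (G z).det) y v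
      = (G y).det * ∑ i, ∑ j, (G y)⁻¹ i j * fderiv ℝ (fun z => G z j i) y v := by
  let D := fun A : Fin n → Fin n → ℝ => (Matrix.of A).det
  have hF : HasFDerivAt (fun z i j => G z i j)
      (ContinuousLinearMap.pi fun i => ContinuousLinearMap.pi fun j =>
        fderiv ℝ (fun z => G z i j) y) y :=
    hasFDerivAt_pi.2 fun i => hasFDerivAt_pi.2 fun j => (hG i j).hasFDerivAt
  have hD : HasFDerivAt D (fderiv ℝ D (fun i j => G y i j)) (fun i j => G y i j) :=
    (differentiable_det _).hasFDerivAt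
  let B : Fin n → Fin n → ℝ := fun i j => fderiv ℝ (fun z => G z i j) y v
  have h1 : fderiv ℝ (fun z => (G z).det) y v = fderiv ℝ D (fun i j => G y i j) B := by
    have : HasFDerivAt (fun z => (G z).det) _ y :=
      HasFDerivAt.comp (g := D) (f := fun z i j => G z i j) y hD hF
    rw [this.fderiv]
    rfl
  -- The differential of the determinant in the direction `B` is read off along the line through `G
  -- y`.
  have hline : HasDerivAt (fun t : ℝ => (fun i j => G y i j) + t • B) B 0 := by
    simpa using ((hasDerivAt_id (0 : ℝ)).smul_const B).const_add (fun i j => G y i j)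
  have h2 : HasDerivAt (fun t : ℝ => D ((fun i j => G y i j) + t • B))
      (fderiv ℝ D (fun i j => G y i j) B) 0 := by
    refine HasFDerivAt.comp_hasDerivAt (l := D) (f := fun t : ℝ => (fun i j => G y i j) + t • B)
      (0 : ℝ) ?_ hline
    simpa using hD
  rw [h1, h2.unique (hasDerivAt_det_add_smul (G y) (Matrix.of B) hd)]
  simp [Matrix.trace, Matrix.mul_apply, B]

/-- The volume density `√det G`. -/
def volDensity (G : Model n → Matrix (Fin n) (Fin n) ℝ) (z : Model n) : ℝ :=
  Real.sqrt (G z).det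

lemma IsMetricAt.inv_symm (h : IsMetricAt G y) (a b : Fin n) : (G y)⁻¹ a b = (G y)⁻¹ b a := by
  have : (G y).transpose = G y := by ext a b; exact h.symm y b a
  conv_lhs => rw [← this, ← Matrix.transpose_nonsing_inv]
  rfl

/-- In Jacobi's formula the derivative of the metric splits by `metricForm_compat` into two
Christoffel terms, each contracting to the trace of `Γ(v, ·)`. -/
lemma IsMetricAt.fderiv_det_eq (h : IsMetricAt G y) (v : Model n) :
    fderiv ℝ (fun z => (G z).det) y v
      = 2 * (G y).det * diagSum (connForm G y v : Model n →ₗ[ℝ] Model n) := by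
  rw [fderiv_det (fun i j => (h.smooth i j).differentiableAt (by simp)) h.det_ne]
  have h1 : ∀ i j, fderiv ℝ (fun z => G z j i) y v
      = metricForm G y (connForm G y v (stdVec i)) (stdVec j)
        + metricForm G y (connForm G y v (stdVec j)) (stdVec i) := by
    intro i j
    have h2 := h.metricForm_compat v (stdVec j) (stdVec i)
    rw [h.metricForm_symm y (stdVec j)] at h2
    rw [add_comm, ← h2, ← fderiv_bilin_apply h.differentiableAt_metricForm]
    simp only [metricForm_stdVec]
  have h3 := sum_inv_mul_eq_diagSum h
    (B := fun a b => metricForm G y (connForm G y v a) b)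
    (T := (connForm G y v : Model n →ₗ[ℝ] Model n)) (fun _ _ => rfl)
  have h4 : ∑ i, ∑ j, (G y)⁻¹ i j * metricForm G y (connForm G y v (stdVec j)) (stdVec i)
      = diagSum (connForm G y v : Model n →ₗ[ℝ] Model n) := by
    rw [← h3, Finset.sum_comm]
    refine Finset.sum_congr rfl fun i _ => Finset.sum_congr rfl fun j _ => ?_
    rw [h.inv_symm]
  simp only [h1, mul_add, Finset.sum_add_distrib]
  rw [h4, h3]
  ring

lemma contDiffAt_volDensity (h : IsMetricAt G y) : ContDiffAt ℝ ∞ (volDensity G) y := by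
  unfold volDensity
  exact (contDiffAt_det h.smooth).sqrt h.det_ne

lemma fderiv_volDensity (h : IsMetricAt G y) (hpos : 0 < (G y).det) (v : Model n) :
    fderiv ℝ (volDensity G) y v
      = volDensity G y * diagSum (connForm G y v : Model n →ₗ[ℝ] Model n) := by
  unfold volDensity
  rw [fderiv_sqrt ((contDiffAt_det h.smooth).differentiableAt (by simp)) h.det_ne, smul_apply,
    h.fderiv_det_eq, smul_eq_mul]
  have h1 := Real.sq_sqrt hpos.le
  have h2 := Real.sqrt_pos.2 hpos
  field_simp
  rw [h1]

/-- The divergence form of the Laplacian. -/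
lemma sum_partialDeriv_volDensity_mul_grad (h : IsMetricAt G y) (hpos : 0 < (G y).det)
    (hf : ∀ᶠ z in 𝓝 y, ContDiffAt ℝ ∞ f z) :
    ∑ i, partialDeriv i (fun z => volDensity G z * grad G f z i) y
      = volDensity G y * localLaplacian G f y := by
  have hA := (contDiffAt_grad h hf.self_of_nhds).differentiableAt (by simp)
  have hAi : ∀ i, HasFDerivAt (fun z => grad G f z i)
      ((EuclideanSpace.proj (𝕜 := ℝ) i : Model n →L[ℝ] ℝ).comp (fderiv ℝ (grad G f) y)) y :=
    fun i => (EuclideanSpace.proj (𝕜 := ℝ) i : Model n →L[ℝ] ℝ).hasFDerivAt.comp y hA.hasFDerivAt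
  have hs := (contDiffAt_volDensity h).differentiableAt (by simp)
  have h1 : ∀ i, partialDeriv i (fun z => volDensity G z * grad G f z i) y
      = fderiv ℝ (volDensity G) y (stdVec i) * grad G f y i
        + volDensity G y * (raiseEnd G y (hessForm G f y) (stdVec i) i
          - connForm G y (grad G f y) (stdVec i) i) := by
    intro i
    have := (hs.hasFDerivAt.fun_mul (hAi i)).fderiv
    unfold partialDeriv
    rw [this]
    simp only [add_apply, smul_apply, smul_eq_mul, ContinuousLinearMap.comp_apply]
    rw [fderiv_grad h hf, h.connForm_symm y (grad G f y)]
    simp only [PiLp.proj_apply, PiLp.sub_apply]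
    ring
  simp only [h1, Finset.sum_add_distrib, ← Finset.mul_sum, Finset.sum_sub_distrib]
  -- The trace of `Γ(grad f, ·)` coming from the density cancels the one coming from the derivative
  -- of the gradient.
  rw [sum_apply_stdVec_mul, fderiv_volDensity h hpos, localLaplacian_eq h hf.self_of_nhds]
  simp only [diagSum, ContinuousLinearMap.coe_coe]
  ring

end Divergence

/-! ### Green's identity in a coordinate domain. -/

section Green

variable {n : ℕ}

/-- Integration by parts against the constant function `1`. -/
lemma integral_partialDeriv_eq_zero {X : Model n → ℝ} (hX : ContDiff ℝ ∞ X)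
    (hc : HasCompactSupport X) (i : Fin n) :
    Integrable (partialDeriv i X) ∧ ∫ y, partialDeriv i X y = 0 := by
  have h1 : Continuous (partialDeriv i X) := by
    unfold partialDeriv
    exact (hX.continuous_fderiv (by simp)).clm_apply continuous_const
  have hc' : HasCompactSupport (partialDeriv i X) := hc.fderiv_apply (𝕜 := ℝ) _
  have hint := h1.integrable_of_hasCompactSupport (μ := volume) hc'
  refine ⟨hint, ?_⟩
  have h2 := integral_mul_fderiv_eq_neg_fderiv_mul_of_integrable (μ := (volume : Measure (Model n)))
    (f := X) (g := fun _ => (1 : ℝ)) (v := stdVec i) (by simp only [mul_one]; exact hint) (by simp)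
    (by simpa using hX.continuous.integrable_of_hasCompactSupport hc)
    (fun x _ => hX.differentiable (by simp) x) (fun x _ => by fun_prop)
  simp only [fderiv_fun_const, Pi.zero_apply, zero_apply, mul_zero, integral_zero, mul_one] at h2
  have h3 : ∫ y, partialDeriv i X y = ∫ y, fderiv ℝ X y (stdVec i) := rfl
  rw [h3]
  linarith

variable {G : Model n → Matrix (Fin n) (Fin n) ℝ} {U : Set (Model n)} {s η : Model n → ℝ}

lemma localLaplacian_eq_zero {y : Model n} (hη : η =ᶠ[𝓝 y] 0) : localLaplacian G η y = 0 := by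
  have h1 : ∀ j, partialDeriv j η =ᶠ[𝓝 y] 0 := fun j => by
    filter_upwards [hη.eventually_nhds] with z hz
    have : η =ᶠ[𝓝 z] 0 := hz
    simp [partialDeriv, this.fderiv_eq]
  have h2 : ∀ i j, partialDeriv i (partialDeriv j η) y = 0 := fun i j => by
    simp [partialDeriv, (h1 j).fderiv_eq]
  unfold localLaplacian
  simp [h2, (h1 _).self_of_nhds]

/-- Green's second identity for a compactly supported function. -/
lemma integral_green (hU : IsOpen U) (hG : ∀ z ∈ U, IsMetricAt G z) (hpos : ∀ z ∈ U, 0 < (G z).det)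
    (hs : ∀ z ∈ U, ContDiffAt ℝ ∞ s z) (hη : ContDiff ℝ ∞ η) (hc : HasCompactSupport η)
    (hsub : tsupport η ⊆ U) :
    ∫ y, volDensity G y * (s y * localLaplacian G η y - η y * localLaplacian G s y) = 0 := by
  -- The vector field `√det G (s grad η - η grad s)`: its coordinate divergence is the integrand,
  -- and it vanishes off the support of `η`, hence is smooth on all of `ℝⁿ`.
  let X : Fin n → Model n → ℝ := fun i z =>
    volDensity G z * (s z * grad G η z i - η z * grad G s z i)
  have hzero : ∀ z, z ∉ tsupport η → η =ᶠ[𝓝 z] 0 := fun z hz =>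
    notMem_tsupport_iff_eventuallyEq.1 hz
  have hgrad0 : ∀ z, z ∉ tsupport η → grad G η =ᶠ[𝓝 z] 0 := fun z hz => by
    filter_upwards [(hzero z hz).eventually_nhds] with x hx
    have : η =ᶠ[𝓝 x] 0 := hx
    have hf : fderiv ℝ η x = 0 := by simp [this.fderiv_eq]
    simp [grad, hf]
  have hX0 : ∀ i z, z ∉ tsupport η → X i =ᶠ[𝓝 z] 0 := fun i z hz => by
    filter_upwards [hgrad0 z hz, hzero z hz] with x h1 h2
    simp [X, h1, h2]
  have hcoord : ∀ {F : Model n → Model n} {z : Model n}, ContDiffAt ℝ ∞ F z → ∀ i,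
      ContDiffAt ℝ ∞ (fun x => F x i) z := fun hF i =>
    (EuclideanSpace.proj (𝕜 := ℝ) i : Model n →L[ℝ] ℝ).contDiff.contDiffAt.comp _ hF
  have hηz : ∀ z, ContDiffAt ℝ ∞ η z := fun z => hη.contDiffAt
  have hX : ∀ i, ContDiff ℝ ∞ (X i) := fun i => by
    rw [contDiff_iff_contDiffAt]
    intro z
    by_cases hz : z ∈ tsupport η
    · have hz := hsub hz
      exact (contDiffAt_volDensity (hG z hz)).mul
        (((hs z hz).mul (hcoord (contDiffAt_grad (hG z hz) (hηz z)) i)).sub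
          ((hηz z).mul (hcoord (contDiffAt_grad (hG z hz) (hs z hz)) i)))
    · exact contDiffAt_const.congr_of_eventuallyEq (hX0 i z hz)
  have hXc : ∀ i, HasCompactSupport (X i) := fun i =>
    HasCompactSupport.of_support_subset_isCompact hc fun z hz => by
      by_contra h
      exact hz (hX0 i z h).self_of_nhds
  have hdiv : ∀ y, volDensity G y * (s y * localLaplacian G η y - η y * localLaplacian G s y)
      = ∑ i, partialDeriv i (X i) y := by
    intro y
    by_cases hy : y ∈ tsupport η
    · have hy := hsub hy
      have hGy := hG y hy
      have hsy : ∀ᶠ z in 𝓝 y, ContDiffAt ℝ ∞ s z := by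
        filter_upwards [hU.mem_nhds hy] with z hz using hs z hz
      have e1 := sum_partialDeriv_volDensity_mul_grad hGy (hpos y hy)
        (Eventually.of_forall hηz : ∀ᶠ z in 𝓝 y, ContDiffAt ℝ ∞ η z)
      have e2 := sum_partialDeriv_volDensity_mul_grad hGy (hpos y hy) hsy
      have hds := (hs y hy).differentiableAt (by simp)
      have hdη := (hηz y).differentiableAt (by simp)
      have hXi : ∀ i, partialDeriv i (X i) y
          = s y * partialDeriv i (fun z => volDensity G z * grad G η z i) y
            + fderiv ℝ s y (stdVec i) * (volDensity G y * grad G η y i)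
            - (η y * partialDeriv i (fun z => volDensity G z * grad G s z i) y
              + fderiv ℝ η y (stdVec i) * (volDensity G y * grad G s y i)) := by
        intro i
        have hv := contDiffAt_volDensity hGy
        have ha := ((hv.mul (hcoord (contDiffAt_grad hGy (hηz y)) i)).differentiableAt
          (by simp)).hasFDerivAt
        have hb := ((hv.mul (hcoord (contDiffAt_grad hGy (hs y hy)) i)).differentiableAt
          (by simp)).hasFDerivAt
        have hX' : X i = fun z => s z * (volDensity G z * grad G η z i)
            - η z * (volDensity G z * grad G s z i) := by
          ext z; simp only [X]; ring
        have hd : HasFDerivAt (fun z => s z * (volDensity G z * grad G η z i)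
            - η z * (volDensity G z * grad G s z i)) _ y :=
          (hds.hasFDerivAt.mul ha).sub (hdη.hasFDerivAt.mul hb)
        unfold partialDeriv
        rw [hX', hd.fderiv]
        simp only [sub_apply, add_apply, smul_apply, smul_eq_mul]
        ring
      -- The two cross terms agree, both being `√det G` times the inner product of the gradients.
      have e3 : ∑ i, fderiv ℝ s y (stdVec i) * (volDensity G y * grad G η y i)
          = ∑ i, fderiv ℝ η y (stdVec i) * (volDensity G y * grad G s y i) := by
        have l1 : ∀ a b : Model n → ℝ, ∑ i, fderiv ℝ a y (stdVec i) * (volDensity G y * grad G b y i)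
            = volDensity G y * metricForm G y (grad G a y) (grad G b y) := by
          intro a b
          rw [hGy.metricForm_grad, ← sum_apply_stdVec_mul, Finset.mul_sum]
          exact Finset.sum_congr rfl fun i _ => by ring
        rw [l1, l1, hGy.metricForm_symm]
      simp only [hXi, Finset.sum_sub_distrib, Finset.sum_add_distrib, ← Finset.mul_sum (a := s y),
        ← Finset.mul_sum (a := η y), e1, e2, e3]
      ring
    · rw [localLaplacian_eq_zero (hzero y hy), (hzero y hy).self_of_nhds]
      simp [partialDeriv, (hX0 _ y hy).fderiv_eq]
  simp only [hdiv]
  rw [integral_finsetSum _ fun i _ => (integral_partialDeriv_eq_zero (hX i) (hXc i) i).1]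
  exact Finset.sum_eq_zero fun i _ => (integral_partialDeriv_eq_zero (hX i) (hXc i) i).2

end Green

/-! ### The sign of the Laplacian at local extrema. -/

section MaximumPrinciple

variable {n : ℕ} {G : Model n → Matrix (Fin n) (Fin n) ℝ} {f : Model n → ℝ} {y : Model n}

/-- Restrict `f` to the line through `y` in the direction `u`. A positive second derivative would
make `0` a local minimum as well as a local maximum, so the restriction would be locally constant
and its second derivative zero. -/
lemma hessian_nonpos_of_isLocalMax (hf : ∀ᶠ z in 𝓝 y, ContDiffAt ℝ ∞ f z) (hmax : IsLocalMax f y)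
    (u : Model n) : fderiv ℝ (fderiv ℝ f) y u u ≤ 0 := by
  by_contra! hpos
  let l : ℝ → Model n := fun t => y + t • u
  have hl : ∀ t, HasDerivAt l u t := fun t => by
    simpa [l] using ((hasDerivAt_id t).smul_const u).const_add y
  have hl0 : l 0 = y := by simp [l]
  have hlc : Tendsto l (𝓝 0) (𝓝 y) := by
    have := (hl 0).continuousAt.tendsto
    rwa [hl0] at this
  let φ : ℝ → ℝ := fun t => f (l t)
  have hφ : ∀ᶠ t in 𝓝 (0 : ℝ), HasDerivAt φ (fderiv ℝ f (l t) u) t := by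
    filter_upwards [hlc.eventually hf] with t ht
    exact (ht.differentiableAt (by simp)).hasFDerivAt.comp_hasDerivAt t (hl t)
  have hd1 : deriv φ =ᶠ[𝓝 0] fun t => fderiv ℝ f (l t) u := by
    filter_upwards [hφ] with t ht using ht.deriv
  have hff : HasFDerivAt (fderiv ℝ f) (fderiv ℝ (fderiv ℝ f) y) (l 0) := by
    rw [hl0]
    exact ((contDiffAt_fderiv_of_contDiffAt hf.self_of_nhds).differentiableAt (by simp)).hasFDerivAt
  have hd2 : deriv (deriv φ) 0 = fderiv ℝ (fderiv ℝ f) y u u := by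
    rw [hd1.deriv_eq]
    have h1 : HasDerivAt (fun t => fderiv ℝ f (l t)) (fderiv ℝ (fderiv ℝ f) y u) 0 :=
      hff.comp_hasDerivAt (0 : ℝ) (hl 0)
    have h2 := (h1.clm_apply (hasDerivAt_const (0 : ℝ) u)).deriv
    simpa using h2
  have hφmax : IsLocalMax φ 0 := by
    have : ∀ᶠ t in 𝓝 (0 : ℝ), f (l t) ≤ f y := hlc.eventually hmax
    filter_upwards [this] with t ht
    simpa [φ, hl0] using ht
  have hφmin : IsLocalMin φ 0 :=
    isLocalMin_of_deriv_deriv_pos (by rw [hd2]; exact hpos) hφmax.deriv_eq_zero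
      hφ.self_of_nhds.continuousAt
  have hconst : φ =ᶠ[𝓝 0] fun _ => φ 0 := by
    filter_upwards [hφmax, hφmin] with t h1 h2 using le_antisymm h1 h2
  have h3 : deriv φ =ᶠ[𝓝 0] fun _ => 0 := by
    filter_upwards [hconst.eventually_nhds] with t ht
    have : φ =ᶠ[𝓝 t] fun _ => φ 0 := ht
    simp [this.deriv_eq]
  have h4 : deriv (deriv φ) 0 = 0 := by simp [h3.deriv_eq]
  rw [hd2] at h4
  exact hpos.ne' h4

/-- The Christoffel term vanishes at a critical point. The inverse metric is a sum of rank-one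
squares, so the Laplacian becomes a sum of values `D²f(u, u)`. -/
lemma localLaplacian_nonpos_of_isLocalMax (hG : (G y).PosDef)
    (hf : ∀ᶠ z in 𝓝 y, ContDiffAt ℝ ∞ f z) (hmax : IsLocalMax f y) :
    localLaplacian G f y ≤ 0 := by
  have h0 : fderiv ℝ f y = 0 := hmax.fderiv_eq_zero
  obtain ⟨m, B, hB⟩ := Matrix.posSemidef_iff_eq_sum_vecMulVec.1 hG.inv.posSemidef
  have h1 : localLaplacian G f y = ∑ k, fderiv ℝ (fderiv ℝ f) y (∑ i, B k i • stdVec i)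
      (∑ i, B k i • stdVec i) := by
    unfold localLaplacian
    have : ∀ k, fderiv ℝ (fderiv ℝ f) y (∑ i, B k i • stdVec i) (∑ i, B k i • stdVec i)
        = ∑ i, ∑ j, B k i * B k j * fderiv ℝ (fderiv ℝ f) y (stdVec i) (stdVec j) := by
      intro k
      simp only [map_sum, map_smul, sum_apply, smul_apply, smul_eq_mul, Finset.mul_sum]
      rw [Finset.sum_comm]
      exact Finset.sum_congr rfl fun i _ => Finset.sum_congr rfl fun j _ => by ring
    simp only [this]
    conv_rhs => rw [Finset.sum_comm]
    refine Finset.sum_congr rfl fun i _ => ?_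
    conv_rhs => rw [Finset.sum_comm]
    refine Finset.sum_congr rfl fun j _ => ?_
    rw [partialDeriv_partialDeriv hf.self_of_nhds, ← Finset.sum_mul, hB]
    simp [partialDeriv, h0, Matrix.sum_apply, Matrix.vecMulVec_apply]
  rw [h1]
  exact Finset.sum_nonpos fun k _ => hessian_nonpos_of_isLocalMax hf hmax _

lemma localLaplacian_neg : localLaplacian G (fun z => -f z) y = -localLaplacian G f y := by
  have h1 : ∀ i (a : Model n → ℝ), partialDeriv i (fun z => -a z) = fun z => -partialDeriv i a z := by
    intro i a
    ext z
    simp [partialDeriv]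
  unfold localLaplacian
  simp only [h1, ← Finset.sum_neg_distrib]
  refine Finset.sum_congr rfl fun i _ => Finset.sum_congr rfl fun j _ => ?_
  simp only [mul_neg, Finset.sum_neg_distrib]
  ring

lemma localLaplacian_nonneg_of_isLocalMin (hG : (G y).PosDef)
    (hf : ∀ᶠ z in 𝓝 y, ContDiffAt ℝ ∞ f z) (hmin : IsLocalMin f y) :
    0 ≤ localLaplacian G f y := by
  have h := localLaplacian_nonpos_of_isLocalMax (f := fun z => -f z) hG
    (by filter_upwards [hf] with z hz using hz.neg) hmin.neg
  rw [localLaplacian_neg] at h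
  linarith

end MaximumPrinciple

/-! ### The metric in charts and transitions between charts. -/

section Chart

variable {n : ℕ} {M : Type*} [TopologicalSpace M] [ChartedSpace (Model n) M]
  [IsManifold (𝓡 n) ∞ M]

lemma contMDiffAt_symm {c : M} {y : Model n} (hy : y ∈ (extChartAt (𝓡 n) c).target) :
    ContMDiffAt 𝓘(ℝ, Model n) (𝓡 n) ∞ (extChartAt (𝓡 n) c).symm y :=
  (contMDiffOn_extChartAt_symm (n := ∞) c).contMDiffAt
    ((isOpen_extChartAt_target c).mem_nhds hy)

lemma mdifferentiableAt_symm {c : M} {y : Model n} (hy : y ∈ (extChartAt (𝓡 n) c).target) :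
    MDifferentiableAt 𝓘(ℝ, Model n) (𝓡 n) (extChartAt (𝓡 n) c).symm y :=
  (contMDiffAt_symm hy).mdifferentiableAt (by simp)

/-- Over the chart domain the coordinate field is the constant vector `stdVec i` carried through the
inverse of the tangent bundle trivialization at `c`, which is smooth. -/
lemma contMDiffAt_coordVector (c : M) (i : Fin n) {y : Model n}
    (hy : y ∈ (extChartAt (𝓡 n) c).target) :
    ContMDiffAt 𝓘(ℝ, Model n) ((𝓡 n).prod 𝓘(ℝ, Model n)) ∞
      (fun z => (⟨(extChartAt (𝓡 n) c).symm z, coordVector c i z⟩ : TangentBundle (𝓡 n) M)) y := by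
  let e := trivializationAt (Model n) (TangentSpace (𝓡 n)) c
  have hbase : ∀ z ∈ (extChartAt (𝓡 n) c).target,
      (extChartAt (𝓡 n) c).symm z ∈ (chartAt (Model n) c).source := fun z hz => by
    simpa using (extChartAt (𝓡 n) c).map_target hz
  have hmem : ((extChartAt (𝓡 n) c).symm y, (stdVec i : Model n)) ∈ e.target :=
    e.mem_target.2 (hbase y hy)
  have h1 := (e.contMDiffOn_symm (n := ∞) (IB := 𝓡 n)).contMDiffAt (e.open_target.mem_nhds hmem)
  have h2 : ContMDiffAt 𝓘(ℝ, Model n) ((𝓡 n).prod 𝓘(ℝ, Model n)) ∞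
      (fun z => ((extChartAt (𝓡 n) c).symm z, (stdVec i : Model n))) y :=
    (contMDiffAt_symm hy).prodMk contMDiffAt_const
  refine (ContMDiffAt.comp y h1 h2).congr_of_eventuallyEq ?_
  filter_upwards [(isOpen_extChartAt_target c).mem_nhds hy] with z hz
  rw [Function.comp_apply, ← e.mk_symm (hbase z hz)]
  have h3 := TangentBundle.symmL_trivializationAt (I := 𝓡 n) (hbase z hz)
  have h4 : coordVector c i z = e.symmL ℝ ((extChartAt (𝓡 n) c).symm z) (stdVec i) := by
    rw [h3, (extChartAt (𝓡 n) c).right_inv hz, modelWithCornersSelf_coe, Set.range_id,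
      mfderivWithin_univ]
    rfl
  rw [h4, e.symmL_apply (hbase z hz)]

lemma contDiffAt_coeff (g : Metric n M) (c : M) {y : Model n}
    (hy : y ∈ (extChartAt (𝓡 n) c).target) (i j : Fin n) :
    ContDiffAt ℝ ∞ (fun z => coeff g c z i j) y := by
  have h1 : ContMDiffAt 𝓘(ℝ, Model n) ((𝓡 n).prod 𝓘(ℝ, Model n →L[ℝ] Model n →L[ℝ] ℝ)) ∞
      (fun z => Bundle.TotalSpace.mk' (Model n →L[ℝ] Model n →L[ℝ] ℝ)
        (E := fun x : M => TangentSpace (𝓡 n) x →L[ℝ] TangentSpace (𝓡 n) x →L[ℝ] ℝ)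
        ((extChartAt (𝓡 n) c).symm z) (g.inner ((extChartAt (𝓡 n) c).symm z))) y :=
    (g.contMDiff _).comp y (contMDiffAt_symm hy)
  have h2 : ContMDiffAt 𝓘(ℝ, Model n) ((𝓡 n).prod 𝓘(ℝ, ℝ)) ∞
      (fun z => Bundle.TotalSpace.mk' ℝ (E := Bundle.Trivial M ℝ) ((extChartAt (𝓡 n) c).symm z)
        (g.inner ((extChartAt (𝓡 n) c).symm z) (coordVector c i z) (coordVector c j z))) y :=
    ContMDiffAt.clm_bundle_apply₂ (F₁ := Model n) (F₂ := Model n) h1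
      (contMDiffAt_coordVector c i hy) (contMDiffAt_coordVector c j hy)
  have h3 := (Bundle.contMDiffAt_totalSpace.1 h2).2
  exact h3.contDiffAt

lemma metricForm_coeff (g : Metric n M) (c : M) (y v w : Model n) :
    metricForm (coeff g c) y v w = g.inner ((extChartAt (𝓡 n) c).symm y)
      (mfderiv 𝓘(ℝ, Model n) (𝓡 n) (extChartAt (𝓡 n) c).symm y v)
      (mfderiv 𝓘(ℝ, Model n) (𝓡 n) (extChartAt (𝓡 n) c).symm y w) := by
  let D : Model n →L[ℝ] Model n := mfderiv 𝓘(ℝ, Model n) (𝓡 n) (extChartAt (𝓡 n) c).symm y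
  let B : Model n →L[ℝ] Model n →L[ℝ] ℝ := g.inner ((extChartAt (𝓡 n) c).symm y)
  have h1 : ∀ i j, coeff g c y i j = B (D (stdVec i)) (D (stdVec j)) := fun i j => rfl
  change _ = B (D v) (D w)
  rw [metricForm_apply]
  simp only [h1]
  conv_rhs => rw [← sum_smul_stdVec v, ← sum_smul_stdVec w]
  simp only [map_sum, map_smul, sum_apply, smul_apply, smul_eq_mul, Finset.mul_sum]
  rw [Finset.sum_comm]
  exact Finset.sum_congr rfl fun i _ => Finset.sum_congr rfl fun j _ => by ring

lemma mfderiv_symm_injective {c : M} {y : Model n} (hy : y ∈ (extChartAt (𝓡 n) c).target) :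
    Function.Injective (mfderiv 𝓘(ℝ, Model n) (𝓡 n) (extChartAt (𝓡 n) c).symm y) := by
  have hx : (extChartAt (𝓡 n) c).symm y ∈ (chartAt (Model n) c).source := by
    simpa using (extChartAt (𝓡 n) c).map_target hy
  have h1 := mfderiv_comp (I := 𝓘(ℝ, Model n)) (I' := 𝓡 n) (I'' := 𝓘(ℝ, Model n)) y
    (mdifferentiableAt_extChartAt (I := 𝓡 n) hx) (mdifferentiableAt_symm hy)
  have h2 : (extChartAt (𝓡 n) c ∘ (extChartAt (𝓡 n) c).symm) =ᶠ[𝓝 y] id := by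
    filter_upwards [(isOpen_extChartAt_target c).mem_nhds hy] with z hz
    exact (extChartAt (𝓡 n) c).right_inv hz
  rw [h2.mfderiv_eq, mfderiv_id] at h1
  intro v w hvw
  have h3 := congrArg (fun L : Model n →L[ℝ] Model n => L v) h1
  have h4 := congrArg (fun L : Model n →L[ℝ] Model n => L w) h1
  have h5 : v = mfderiv (𝓡 n) 𝓘(ℝ, Model n) (extChartAt (𝓡 n) c) ((extChartAt (𝓡 n) c).symm y)
    (mfderiv 𝓘(ℝ, Model n) (𝓡 n) (extChartAt (𝓡 n) c).symm y v) := h3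
  have h6 : w = mfderiv (𝓡 n) 𝓘(ℝ, Model n) (extChartAt (𝓡 n) c) ((extChartAt (𝓡 n) c).symm y)
    (mfderiv 𝓘(ℝ, Model n) (𝓡 n) (extChartAt (𝓡 n) c).symm y w) := h4
  rw [h5, hvw, ← h6]

lemma coeff_symm (g : Metric n M) (c : M) (z : Model n) (i j : Fin n) :
    coeff g c z i j = coeff g c z j i := g.symm _ _ _

lemma metricForm_coeff_pos (g : Metric n M) (c : M) {y : Model n}
    (hy : y ∈ (extChartAt (𝓡 n) c).target) {v : Model n} (hv : v ≠ 0) :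
    0 < metricForm (coeff g c) y v v := by
  rw [metricForm_coeff]
  refine g.pos _ _ fun h => hv (mfderiv_symm_injective hy ?_)
  exact h.trans (map_zero (mfderiv 𝓘(ℝ, Model n) (𝓡 n) (extChartAt (𝓡 n) c).symm y)).symm

lemma posDef_coeff (g : Metric n M) (c : M) {y : Model n}
    (hy : y ∈ (extChartAt (𝓡 n) c).target) : (coeff g c y).PosDef := by
  refine Matrix.PosDef.of_dotProduct_mulVec_pos ?_ fun x hx => ?_
  · ext i j
    exact coeff_symm g c y j i
  · have hv : (WithLp.toLp 2 x : Model n) ≠ 0 := by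
      intro h0
      exact hx (congrArg WithLp.ofLp h0)
    have := metricForm_coeff_pos g c hy hv
    rw [metricForm_apply] at this
    have e : star x ⬝ᵥ (coeff g c y).mulVec x = ∑ i, ∑ j, coeff g c y i j * x i * x j := by
      simp only [dotProduct, Matrix.mulVec, Finset.mul_sum, Pi.star_apply, star_trivial]
      exact Finset.sum_congr rfl fun i _ => Finset.sum_congr rfl fun j _ => by ring
    rw [e]
    exact this

lemma isMetricAt_coeff (g : Metric n M) (c : M) {y : Model n}
    (hy : y ∈ (extChartAt (𝓡 n) c).target) : IsMetricAt (coeff g c) y where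
  eventually_smooth := by
    filter_upwards [(isOpen_extChartAt_target c).mem_nhds hy] with z hz i j
    exact contDiffAt_coeff g c hz i j
  det_ne := (posDef_coeff g c hy).det_pos.ne'
  symm := coeff_symm g c

/-- The coordinate change from the chart at `c` to the chart at `c'`. -/
def transition (c c' : M) (y : Model n) : Model n :=
  extChartAt (𝓡 n) c' ((extChartAt (𝓡 n) c).symm y)

lemma contDiffAt_transition {c c' : M} {y : Model n} (hy : y ∈ (extChartAt (𝓡 n) c).target)
    (hy' : (extChartAt (𝓡 n) c).symm y ∈ (extChartAt (𝓡 n) c').source) :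
    ContDiffAt ℝ ∞ (transition c c' : Model n → Model n) y := by
  rw [← contMDiffAt_iff_contDiffAt]
  exact (contMDiffAt_extChartAt' (I := 𝓡 n) (n := ∞) (by simpa using hy')).comp y
    (contMDiffAt_symm hy)

lemma eventually_mem_transition {c c' : M} {y : Model n} (hy : y ∈ (extChartAt (𝓡 n) c).target)
    (hy' : (extChartAt (𝓡 n) c).symm y ∈ (extChartAt (𝓡 n) c').source) :
    ∀ᶠ z in 𝓝 y, z ∈ (extChartAt (𝓡 n) c).target ∧
      (extChartAt (𝓡 n) c).symm z ∈ (extChartAt (𝓡 n) c').source := by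
  filter_upwards [(isOpen_extChartAt_target c).mem_nhds hy,
    (contMDiffAt_symm hy).continuousAt.preimage_mem_nhds
      ((isOpen_extChartAt_source c').mem_nhds hy')] with z h1 h2
  exact ⟨h1, h2⟩

lemma mfderiv_symm_eq {c c' : M} {y : Model n} (hy : y ∈ (extChartAt (𝓡 n) c).target)
    (hy' : (extChartAt (𝓡 n) c).symm y ∈ (extChartAt (𝓡 n) c').source) (v : Model n) :
    (mfderiv 𝓘(ℝ, Model n) (𝓡 n) (extChartAt (𝓡 n) c).symm y v : Model n)
      = mfderiv 𝓘(ℝ, Model n) (𝓡 n) (extChartAt (𝓡 n) c').symm (transition c c' y)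
        (fderiv ℝ (transition c c') y v) := by
  have ht : transition c c' y ∈ (extChartAt (𝓡 n) c').target := (extChartAt (𝓡 n) c').map_source hy'
  have h1 : (extChartAt (𝓡 n) c).symm =ᶠ[𝓝 y] (extChartAt (𝓡 n) c').symm ∘ transition c c' := by
    filter_upwards [eventually_mem_transition hy hy'] with z hz
    exact ((extChartAt (𝓡 n) c').left_inv hz.2).symm
  have h2 := mfderiv_comp (I := 𝓘(ℝ, Model n)) (I' := 𝓘(ℝ, Model n)) (I'' := 𝓡 n) y
    (mdifferentiableAt_symm ht)
    ((contDiffAt_transition hy hy').differentiableAt (by simp)).mdifferentiableAt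
  rw [← h1.mfderiv_eq, mfderiv_eq_fderiv] at h2
  exact congrArg (fun L : Model n →L[ℝ] Model n => L v) h2

lemma metricForm_coeff_transition (g : Metric n M) {c c' : M} {y : Model n}
    (hy : y ∈ (extChartAt (𝓡 n) c).target)
    (hy' : (extChartAt (𝓡 n) c).symm y ∈ (extChartAt (𝓡 n) c').source) (v w : Model n) :
    metricForm (coeff g c) y v w = metricForm (coeff g c') (transition c c' y)
      (fderiv ℝ (transition c c') y v) (fderiv ℝ (transition c c') y w) := by
  let Q : M → Model n →L[ℝ] Model n →L[ℝ] ℝ := fun x => g.inner x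
  have hx : (extChartAt (𝓡 n) c').symm (transition c c' y) = (extChartAt (𝓡 n) c).symm y :=
    (extChartAt (𝓡 n) c').left_inv hy'
  have h1 := metricForm_coeff g c y v w
  have h2 := metricForm_coeff g c' (transition c c' y)
    (fderiv ℝ (transition c c') y v) (fderiv ℝ (transition c c') y w)
  -- All tangent spaces are definitionally `Model n`. Forgetting the base point in the types allows
  -- the rewriting of base points by `hx`.
  change _ = Q _ (_ : Model n) (_ : Model n) at h1
  change _ = Q _ (_ : Model n) (_ : Model n) at h2
  rw [h1, h2, mfderiv_symm_eq hy hy' v, mfderiv_symm_eq hy hy' w, hx]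

lemma isPullbackAt_coeff (g : Metric n M) {c c' : M} {y : Model n}
    (hy : y ∈ (extChartAt (𝓡 n) c).target)
    (hy' : (extChartAt (𝓡 n) c).symm y ∈ (extChartAt (𝓡 n) c').source) :
    IsPullbackAt (coeff g c) (coeff g c') (transition c c') y where
  source := isMetricAt_coeff g c hy
  target := isMetricAt_coeff g c' ((extChartAt (𝓡 n) c').map_source hy')
  smooth := by
    filter_upwards [eventually_mem_transition hy hy'] with z hz using
      contDiffAt_transition hz.1 hz.2
  eq := by
    filter_upwards [eventually_mem_transition hy hy'] with z hz v w using
      metricForm_coeff_transition g hz.1 hz.2 v w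

/-- The scalar curvature may be computed in any chart. -/
theorem scalarCurvature_eq (g : Metric n M) {c x : M} (hx : x ∈ (extChartAt (𝓡 n) c).source) :
    scalarCurvature g x = localScalar (coeff g c) (extChartAt (𝓡 n) c x) := by
  have hy := mem_extChartAt_target (I := 𝓡 n) x
  have hl := extChartAt_to_inv (I := 𝓡 n) x
  have h := (isPullbackAt_coeff g (c := x) (c' := c) hy (by rw [hl]; exact hx)).localScalar_eq
  unfold scalarCurvature
  rw [h]
  unfold transition
  rw [hl]

lemma contDiffAt_localScalar_coeff (g : Metric n M) (c : M) {y : Model n}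
    (hy : y ∈ (extChartAt (𝓡 n) c).target) : ContDiffAt ℝ ∞ (localScalar (coeff g c)) y :=
  (isMetricAt_coeff g c hy).contDiffAt_localScalar

/-- The chart in the definition moves with the point; chart independence lets the chart at `x` be
kept fixed on a neighbourhood. -/
lemma continuous_scalarCurvature (g : Metric n M) : Continuous (scalarCurvature g) := by
  rw [continuous_iff_continuousAt]
  intro x
  have h1 : scalarCurvature g =ᶠ[𝓝 x]
      fun z => localScalar (coeff g x) (extChartAt (𝓡 n) x z) := by
    filter_upwards [extChartAt_source_mem_nhds (I := 𝓡 n) x] with z hz using scalarCurvature_eq g hz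
  refine ContinuousAt.congr ?_ h1.symm
  exact ContinuousAt.comp (g := localScalar (coeff g x))
    (contDiffAt_localScalar_coeff g x (mem_extChartAt_target x)).continuousAt
    (continuousAt_extChartAt x)

end Chart

/-! ### The Riemannian measure in charts and under rescaling. -/

section Measure

set_option linter.unusedSectionVars false

variable {n : ℕ} {M : Type*} [TopologicalSpace M] [ChartedSpace (Model n) M]
  [IsManifold (𝓡 n) ∞ M]

lemma continuousOn_volDensity (g : Metric n M) (c : M) :
    ContinuousOn (volDensity (coeff g c)) (extChartAt (𝓡 n) c).target := fun _ hy =>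
  (contDiffAt_volDensity (isMetricAt_coeff g c hy)).continuousAt.continuousWithinAt

lemma measurableSet_target (c : M) : MeasurableSet (extChartAt (𝓡 n) c).target :=
  (isOpen_extChartAt_target c).measurableSet

lemma aemeasurable_volDensity (g : Metric n M) (c : M) :
    AEMeasurable (fun y => ENNReal.ofReal (volDensity (coeff g c) y))
      (volume.restrict (extChartAt (𝓡 n) c).target) :=
  ((continuousOn_volDensity g c).aemeasurable (measurableSet_target c)).ennreal_ofReal

/-- Transformation of the volume density under coordinate changes. -/
lemma volDensity_transition (g : Metric n M) {c c' : M} {y : Model n}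
    (hy : y ∈ (extChartAt (𝓡 n) c).target)
    (hy' : (extChartAt (𝓡 n) c).symm y ∈ (extChartAt (𝓡 n) c').source) :
    volDensity (coeff g c) y = |(fderiv ℝ (transition c c') y).det|
      * volDensity (coeff g c') (transition c c' y) := by
  let J := LinearMap.toMatrix (EuclideanSpace.basisFun (Fin n) ℝ).toBasis
    (EuclideanSpace.basisFun (Fin n) ℝ).toBasis
    (fderiv ℝ (transition c c') y : Model n →ₗ[ℝ] Model n)
  have hJ : ∀ a i, J a i = fderiv ℝ (transition c c') y (stdVec i) a := fun a i => by
    simp [J, LinearMap.toMatrix_apply]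
  have hdet : J.det = (fderiv ℝ (transition c c') y).det := LinearMap.det_toMatrix _ _
  have hm : coeff g c y = J.transpose * coeff g c' (transition c c' y) * J := by
    ext i j
    rw [← metricForm_stdVec (coeff g c) y i j, metricForm_coeff_transition g hy hy', metricForm_apply,
      Matrix.mul_apply]
    simp only [Matrix.mul_apply, Matrix.transpose_apply, hJ, Finset.sum_mul]
    rw [Finset.sum_comm]
    exact Finset.sum_congr rfl fun a _ => Finset.sum_congr rfl fun b _ => by ring
  unfold volDensity
  rw [hm, Matrix.det_mul, Matrix.det_mul, Matrix.det_transpose, hdet, mul_right_comm,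
    Real.sqrt_mul (mul_self_nonneg _), Real.sqrt_mul_self_eq_abs]

variable [MeasurableSpace M] [BorelSpace M]

lemma aemeasurable_symm (c : M) : AEMeasurable (extChartAt (𝓡 n) c).symm
    (volume.restrict (extChartAt (𝓡 n) c).target) :=
  (continuousOn_extChartAt_symm c).aemeasurable (measurableSet_target c)

lemma aemeasurable_symm_withDensity (g : Metric n M) (c : M) :
    AEMeasurable (extChartAt (𝓡 n) c).symm
      ((volume.restrict (extChartAt (𝓡 n) c).target).withDensity
        (fun y => ENNReal.ofReal (volDensity (coeff g c) y))) :=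
  (aemeasurable_symm c).mono_ac (withDensity_absolutelyContinuous _ _)

lemma chartMeasure_eq (g : Metric n M) (c : M) : chartMeasure g c =
    ((volume.restrict (extChartAt (𝓡 n) c).target).withDensity
      (fun y => ENNReal.ofReal (volDensity (coeff g c) y))).map (extChartAt (𝓡 n) c).symm := rfl

lemma lintegral_chartMeasure (g : Metric n M) (c : M) {h : M → ENNReal} (hh : Measurable h) :
    ∫⁻ x, h x ∂(chartMeasure g c) = ∫⁻ y in (extChartAt (𝓡 n) c).target,
      ENNReal.ofReal (volDensity (coeff g c) y) * h ((extChartAt (𝓡 n) c).symm y) := by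
  rw [chartMeasure_eq, lintegral_map' hh.aemeasurable (aemeasurable_symm_withDensity g c),
    lintegral_withDensity_eq_lintegral_mul₀ (g := fun y => h ((extChartAt (𝓡 n) c).symm y))
      (aemeasurable_volDensity g c) (hh.comp_aemeasurable (aemeasurable_symm c))]
  rfl

/-- The part of the chart at `c` which is covered by the chart at `c'`, in coordinates. -/
def overlap (c c' : M) : Set (Model n) :=
  (extChartAt (𝓡 n) c).target ∩ (extChartAt (𝓡 n) c).symm ⁻¹' (extChartAt (𝓡 n) c').source

lemma isOpen_overlap (c c' : M) : IsOpen (overlap c c' : Set (Model n)) :=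
  (continuousOn_extChartAt_symm c).isOpen_inter_preimage (isOpen_extChartAt_target c)
    (isOpen_extChartAt_source c')

lemma transition_mem_overlap {c c' : M} {y : Model n} (hy : y ∈ overlap c c') :
    transition c c' y ∈ overlap c' c ∧ transition c' c (transition c c' y) = y := by
  have h1 : (extChartAt (𝓡 n) c').symm (transition c c' y) = (extChartAt (𝓡 n) c).symm y :=
    (extChartAt (𝓡 n) c').left_inv hy.2
  refine ⟨⟨(extChartAt (𝓡 n) c').map_source hy.2, ?_⟩, ?_⟩
  · rw [Set.mem_preimage, h1]
    exact (extChartAt (𝓡 n) c).map_target hy.1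
  · unfold transition at h1 ⊢
    rw [h1]
    exact (extChartAt (𝓡 n) c).right_inv hy.1

lemma image_overlap (c c' : M) :
    transition c c' '' (overlap c c' : Set (Model n)) = overlap c' c := by
  ext y
  constructor
  · rintro ⟨z, hz, rfl⟩
    exact (transition_mem_overlap hz).1
  · intro hy
    exact ⟨_, (transition_mem_overlap hy).1, (transition_mem_overlap hy).2⟩

lemma lintegral_chartMeasure_overlap (g : Metric n M) (c c' : M) {h : M → ENNReal}
    (hh : Measurable h) (h0 : ∀ x, x ∉ (extChartAt (𝓡 n) c').source → h x = 0) :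
    ∫⁻ x, h x ∂(chartMeasure g c) = ∫⁻ y in overlap c c',
      ENNReal.ofReal (volDensity (coeff g c) y) * h ((extChartAt (𝓡 n) c).symm y) := by
  rw [lintegral_chartMeasure g c hh]
  rw [← lintegral_indicator (measurableSet_target c),
    ← lintegral_indicator (isOpen_overlap c c').measurableSet]
  congr 1
  ext y
  by_cases hy : y ∈ overlap c c'
  · rw [Set.indicator_of_mem hy, Set.indicator_of_mem hy.1]
  · rw [Set.indicator_of_notMem hy]
    by_cases hy1 : y ∈ (extChartAt (𝓡 n) c).target
    · rw [Set.indicator_of_mem hy1, h0 _ fun h => hy ⟨hy1, h⟩, mul_zero]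
    · exact Set.indicator_of_notMem hy1 _

/-- Both integrals live on the overlap of the charts. The change of variables formula relates them,
its Jacobian being absorbed by `volDensity_transition`. -/
lemma lintegral_chartMeasure_eq (g : Metric n M) (c c' : M) {h : M → ENNReal} (hh : Measurable h)
    (h0 : ∀ x, x ∉ (extChartAt (𝓡 n) c).source → h x = 0)
    (h0' : ∀ x, x ∉ (extChartAt (𝓡 n) c').source → h x = 0) :
    ∫⁻ x, h x ∂(chartMeasure g c) = ∫⁻ x, h x ∂(chartMeasure g c') := by
  rw [lintegral_chartMeasure_overlap g c c' hh h0', lintegral_chartMeasure_overlap g c' c hh h0,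
    ← image_overlap c c', lintegral_image_eq_lintegral_abs_det_fderiv_mul volume
      (isOpen_overlap c c').measurableSet (f' := fderiv ℝ (transition c c'))]
  · refine setLIntegral_congr_fun (isOpen_overlap c c').measurableSet fun y hy => ?_
    have h1 : (extChartAt (𝓡 n) c').symm (transition c c' y) = (extChartAt (𝓡 n) c).symm y :=
      (extChartAt (𝓡 n) c').left_inv hy.2
    rw [h1, volDensity_transition g hy.1 hy.2, ENNReal.ofReal_mul (abs_nonneg _), mul_assoc]
  · intro y hy
    exact ((contDiffAt_transition hy.1 hy.2).differentiableAt
      (by simp)).hasFDerivAt.hasFDerivWithinAt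
  · intro y hy z hz hyz
    rw [← (transition_mem_overlap hy).2, hyz, (transition_mem_overlap hz).2]

variable [T2Space M] [CompactSpace M]

lemma chartPartition_eq_zero {c x : M} (hx : x ∉ (extChartAt (𝓡 n) c).source) :
    chartPartition n M c x = 0 := by
  by_contra h
  have h1 := (SmoothPartitionOfUnity.exists_isSubordinate_chartAt_source (𝓡 n) M).choose_spec c
  refine hx ?_
  rw [extChartAt_source]
  exact h1 (subset_tsupport _ h)

lemma exists_finset_chartPartition : ∃ F : Finset M, (∀ c ∉ F, ∀ x, chartPartition n M c x = 0) ∧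
    ∀ x, ∑ c ∈ F, chartPartition n M c x = 1 := by
  have hfin := (chartPartition n M).locallyFinite.finite_nonempty_of_compact
  have hF : ∀ c ∉ hfin.toFinset, ∀ x, chartPartition n M c x = 0 := by
    intro c hc x
    by_contra h
    exact hc (hfin.mem_toFinset.2 ⟨x, h⟩)
  refine ⟨hfin.toFinset, hF, fun x => ?_⟩
  rw [← (chartPartition n M).sum_eq_one (Set.mem_univ x)]
  refine (finsum_eq_sum_of_support_subset _ fun c hc => ?_).symm
  by_contra h
  exact hc (hF c h x)

lemma measurable_chartPartition (c : M) :
    Measurable fun x => ENNReal.ofReal (chartPartition n M c x) :=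
  ((chartPartition n M c).contMDiff.continuous.measurable).ennreal_ofReal

lemma lintegral_riemMeasure (g : Metric n M) {h : M → ENNReal} (hh : Measurable h) :
    ∫⁻ x, h x ∂(riemMeasure g) = ∑' c : M,
      ∫⁻ x, ENNReal.ofReal (chartPartition n M c x) * h x ∂(chartMeasure g c) := by
  unfold riemMeasure
  rw [lintegral_sum_measure]
  congr 1
  ext c
  rw [lintegral_withDensity_eq_lintegral_mul _ (measurable_chartPartition c) hh]
  rfl

/-- Every piece of the partition of unity can be integrated in the chart at `c` instead of its own;
there the pieces add up to `h`. -/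
lemma lintegral_riemMeasure_eq (g : Metric n M) (c : M) {h : M → ENNReal} (hh : Measurable h)
    (h0 : ∀ x, x ∉ (extChartAt (𝓡 n) c).source → h x = 0) :
    ∫⁻ x, h x ∂(riemMeasure g) = ∫⁻ x, h x ∂(chartMeasure g c) := by
  obtain ⟨F, hF0, hF1⟩ := exists_finset_chartPartition (n := n) (M := M)
  rw [lintegral_riemMeasure g hh, tsum_eq_sum (s := F)]
  · calc ∑ a ∈ F, ∫⁻ x, ENNReal.ofReal (chartPartition n M a x) * h x ∂(chartMeasure g a)
        = ∑ a ∈ F, ∫⁻ x, ENNReal.ofReal (chartPartition n M a x) * h x ∂(chartMeasure g c) := by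
          refine Finset.sum_congr rfl fun a _ => ?_
          refine lintegral_chartMeasure_eq g a c ((measurable_chartPartition a).mul hh) ?_ ?_
          · intro x hx
            rw [chartPartition_eq_zero hx]; simp
          · intro x hx
            rw [h0 x hx, mul_zero]
      _ = ∫⁻ x, ∑ a ∈ F, ENNReal.ofReal (chartPartition n M a x) * h x ∂(chartMeasure g c) :=
          (lintegral_finsetSum F fun a _ => (measurable_chartPartition a).mul hh).symm
      _ = ∫⁻ x, h x ∂(chartMeasure g c) := by
          congr 1
          ext x
          rw [← Finset.sum_mul, ← ENNReal.ofReal_sum_of_nonneg fun a _ =>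
            (chartPartition n M).nonneg a x, hF1, ENNReal.ofReal_one, one_mul]
  · intro a ha
    simp [hF0 a ha]

lemma measurableSet_source (c : M) : MeasurableSet (extChartAt (𝓡 n) c).source :=
  (isOpen_extChartAt_source c).measurableSet

/-- In the domain of a chart the Riemannian measure is the measure of the chart. -/
lemma riemMeasure_restrict_source (g : Metric n M) (c : M) :
    (riemMeasure g).restrict (extChartAt (𝓡 n) c).source = chartMeasure g c := by
  ext s hs
  have hss := hs.inter (measurableSet_source (n := n) c)
  rw [Measure.restrict_apply hs, ← lintegral_indicator_one hss,
    lintegral_riemMeasure_eq g c (measurable_one.indicator hss), ← lintegral_indicator_one hs,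
    lintegral_chartMeasure g c (measurable_one.indicator hss),
    lintegral_chartMeasure g c (measurable_one.indicator hs)]
  · refine setLIntegral_congr_fun (measurableSet_target c) fun y hy => ?_
    have h1 := (extChartAt (𝓡 n) c).map_target hy
    congr 1
    by_cases h2 : (extChartAt (𝓡 n) c).symm y ∈ s
    · rw [Set.indicator_of_mem (Set.mem_inter h2 h1), Set.indicator_of_mem h2]
    · rw [Set.indicator_of_notMem fun h => h2 h.1, Set.indicator_of_notMem h2]
  · intro x hx
    exact Set.indicator_of_notMem (fun h => hx h.2) _

/-- Integration of a function supported in the domain of a chart. -/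
lemma integral_riemMeasure_eq (g : Metric n M) (c : M) {k : M → ℝ} (hk : Measurable k)
    (h0 : ∀ x, x ∉ (extChartAt (𝓡 n) c).source → k x = 0) :
    ∫ x, k x ∂(riemMeasure g) = ∫ y in (extChartAt (𝓡 n) c).target,
      volDensity (coeff g c) y * k ((extChartAt (𝓡 n) c).symm y) := by
  rw [← setIntegral_eq_integral_of_forall_compl_eq_zero h0, riemMeasure_restrict_source,
    chartMeasure_eq, integral_map (aemeasurable_symm_withDensity g c)
      hk.stronglyMeasurable.aestronglyMeasurable,
    integral_withDensity_eq_integral_toReal_smul₀ (aemeasurable_volDensity g c)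
      (ae_of_all _ fun _ => ENNReal.ofReal_lt_top)]
  refine integral_congr_ae (ae_of_all _ fun y => ?_)
  simp only [smul_eq_mul]
  rw [ENNReal.toReal_ofReal (show 0 ≤ volDensity (coeff g c) y from Real.sqrt_nonneg _)]

lemma volDensity_pos (g : Metric n M) {c : M} {y : Model n}
    (hy : y ∈ (extChartAt (𝓡 n) c).target) : 0 < volDensity (coeff g c) y :=
  Real.sqrt_pos.2 (posDef_coeff g c hy).det_pos

/-- The volume density is positive on a chart and Lebesgue measure charges open sets. Consequently a
nonnegative continuous function with zero integral vanishes. -/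
lemma riemMeasure_pos (g : Metric n M) {V : Set M} (hV : IsOpen V) (hne : V.Nonempty) :
    riemMeasure g V ≠ 0 := by
  obtain ⟨x, hx⟩ := hne
  intro h
  have h1 : chartMeasure g x V = 0 := by
    rw [← riemMeasure_restrict_source, Measure.restrict_apply hV.measurableSet]
    exact measure_mono_null Set.inter_subset_left h
  have hW := (continuousOn_extChartAt_symm (I := 𝓡 n) x).isOpen_inter_preimage
    (isOpen_extChartAt_target x) hV
  rw [chartMeasure_eq, Measure.map_apply_of_aemeasurable (aemeasurable_symm_withDensity g x)
    hV.measurableSet, withDensity_apply_eq_zero' (aemeasurable_volDensity g x)] at h1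
  have h2 : volume ((extChartAt (𝓡 n) x).target ∩ (extChartAt (𝓡 n) x).symm ⁻¹' V) = 0 := by
    refine measure_mono_null ?_ (le_antisymm
      ((Measure.le_restrict_apply (extChartAt (𝓡 n) x).target _).trans h1.le) zero_le)
    intro y hy
    refine ⟨⟨?_, hy.2⟩, hy.1⟩
    simpa using volDensity_pos g hy.1
  refine hW.measure_ne_zero volume ⟨extChartAt (𝓡 n) x x, mem_extChartAt_target x, ?_⟩ h2
  rw [Set.mem_preimage, extChartAt_to_inv]
  exact hx

instance isOpenPosMeasure_riemMeasure (g : Metric n M) : (riemMeasure g).IsOpenPosMeasure :=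
  ⟨fun _ hV hne => riemMeasure_pos g hV hne⟩

/-- The Riemannian measure of a rescaled metric. -/
lemma riemMeasure_rescale (g g' : Metric n M) {u : M → ℝ} (hu : ∀ x, 0 < u x)
    (hc : Continuous u) (h : ∀ x v w, g'.inner x v w = u x * g.inner x v w) :
    riemMeasure g' = (riemMeasure g).withDensity fun x => ENNReal.ofReal (Real.sqrt (u x ^ n)) := by
  have hd : Measurable fun x => ENNReal.ofReal (Real.sqrt (u x ^ n)) :=
    ((hc.pow n).sqrt.measurable).ennreal_ofReal
  have hcoeff : ∀ c y, coeff g' c y = u ((extChartAt (𝓡 n) c).symm y) • coeff g c y := by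
    intro c y
    ext i j
    exact h _ _ _
  have hvol : ∀ c y, volDensity (coeff g' c) y
      = Real.sqrt (u ((extChartAt (𝓡 n) c).symm y) ^ n) * volDensity (coeff g c) y := by
    intro c y
    unfold volDensity
    rw [hcoeff, Matrix.det_smul, Fintype.card_fin, Real.sqrt_mul (pow_nonneg (hu _).le _)]
  ext s hs
  rw [withDensity_apply _ hs, ← lintegral_indicator_one hs,
    ← lintegral_indicator hs, lintegral_riemMeasure g' (measurable_one.indicator hs),
    lintegral_riemMeasure g (hd.indicator hs)]
  congr 1
  ext c
  have e1 := lintegral_chartMeasure g' c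
    ((measurable_chartPartition (n := n) c).mul (measurable_one.indicator hs))
  have e2 := lintegral_chartMeasure g c ((measurable_chartPartition (n := n) c).mul (hd.indicator hs))
  simp only [Pi.mul_apply] at e1 e2
  rw [e1, e2]
  congr 1
  ext y
  rw [hvol, ENNReal.ofReal_mul (Real.sqrt_nonneg _)]
  by_cases h2 : (extChartAt (𝓡 n) c).symm y ∈ s
  · rw [Set.indicator_of_mem h2, Set.indicator_of_mem h2, Pi.one_apply]
    ring
  · rw [Set.indicator_of_notMem h2, Set.indicator_of_notMem h2]
    simp

end Measure

/-! ### Laplacian and gradient of a composition. -/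

section ChainRule

variable {n : ℕ} {G : Model n → Matrix (Fin n) (Fin n) ℝ} {h : Model n → ℝ} {y : Model n}
  {Φ Φ₁ : ℝ → ℝ} {Φ₂ : ℝ}

lemma partialDeriv_comp {z : Model n} {d : ℝ} (hΦ : HasDerivAt Φ d (h z))
    (hh : DifferentiableAt ℝ h z) (j : Fin n) :
    partialDeriv j (fun x => Φ (h x)) z = d * partialDeriv j h z := by
  have h1 : HasFDerivAt (fun x => Φ (h x)) _ z := hΦ.comp_hasFDerivAt z hh.hasFDerivAt
  unfold partialDeriv
  rw [h1.fderiv]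
  simp

lemma localGradSq_comp {d : ℝ} (hΦ : HasDerivAt Φ d (h y)) (hh : DifferentiableAt ℝ h y) :
    localGradSq G (fun x => Φ (h x)) y = d ^ 2 * localGradSq G h y := by
  unfold localGradSq
  simp only [partialDeriv_comp hΦ hh, Finset.mul_sum]
  exact Finset.sum_congr rfl fun i _ => Finset.sum_congr rfl fun j _ => by ring

/-- `Φ₁` has to be the derivative of `Φ` only at the values of `h` near `y`, which accommodates the
logarithm. -/
lemma localLaplacian_comp (hh : ContDiffAt ℝ ∞ h y)
    (hΦ : ∀ᶠ z in 𝓝 y, HasDerivAt Φ (Φ₁ (h z)) (h z))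
    (hd : ∀ᶠ z in 𝓝 y, DifferentiableAt ℝ h z) (hΦ₂ : HasDerivAt Φ₁ Φ₂ (h y)) :
    localLaplacian G (fun x => Φ (h x)) y
      = Φ₁ (h y) * localLaplacian G h y + Φ₂ * localGradSq G h y := by
  have h1 : ∀ j, partialDeriv j (fun x => Φ (h x)) =ᶠ[𝓝 y]
      fun z => Φ₁ (h z) * partialDeriv j h z := fun j => by
    filter_upwards [hΦ, hd] with z a b using partialDeriv_comp a b j
  have hhd := hh.differentiableAt (by simp)
  have h2 : ∀ i j, partialDeriv i (partialDeriv j (fun x => Φ (h x))) y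
      = Φ₁ (h y) * partialDeriv i (partialDeriv j h) y
        + Φ₂ * (partialDeriv i h y * partialDeriv j h y) := by
    intro i j
    have h3 : HasFDerivAt (fun z => Φ₁ (h z) * partialDeriv j h z) _ y :=
      (hΦ₂.comp_hasFDerivAt y hhd.hasFDerivAt).mul
        ((contDiffAt_partialDeriv hh j).differentiableAt (by simp)).hasFDerivAt
    have h4 : partialDeriv i (partialDeriv j (fun x => Φ (h x))) y
        = fderiv ℝ (fun z => Φ₁ (h z) * partialDeriv j h z) y (stdVec i) := by
      conv_lhs => unfold partialDeriv
      rw [← (h1 j).fderiv_eq]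
      rfl
    rw [h4, h3.fderiv]
    simp only [add_apply, smul_apply, smul_eq_mul]
    unfold partialDeriv
    simp only [Function.comp_apply]
    ring
  unfold localLaplacian localGradSq
  rw [Finset.mul_sum, Finset.mul_sum, ← Finset.sum_add_distrib]
  refine Finset.sum_congr rfl fun i _ => ?_
  rw [Finset.mul_sum, Finset.mul_sum, ← Finset.sum_add_distrib]
  refine Finset.sum_congr rfl fun j _ => ?_
  rw [h2]
  simp only [(h1 _).self_of_nhds]
  have h5 : ∑ k, christoffel G k i j y * (Φ₁ (h y) * partialDeriv k h y)
      = Φ₁ (h y) * ∑ k, christoffel G k i j y * partialDeriv k h y := by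
    rw [Finset.mul_sum]
    exact Finset.sum_congr rfl fun k _ => by ring
  rw [h5]
  ring

lemma localGradSq_eq_zero (hh : h =ᶠ[𝓝 y] 0) : localGradSq G h y = 0 := by
  unfold localGradSq
  simp [partialDeriv, hh.fderiv_eq]

lemma contDiffAt_localLaplacian (hG : IsMetricAt G y) (hh : ContDiffAt ℝ ∞ h y) :
    ContDiffAt ℝ ∞ (localLaplacian G h) y := by
  unfold localLaplacian
  refine ContDiffAt.sum fun i _ => ContDiffAt.sum fun j _ => (hG.contDiffAt_inv i j).mul ?_
  refine (contDiffAt_partialDeriv (contDiffAt_partialDeriv hh j) i).sub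
    (ContDiffAt.sum fun k _ => ?_)
  exact (hG.contDiffAt_christoffel k i j).mul (contDiffAt_partialDeriv hh k)

lemma contDiffAt_localGradSq (hG : IsMetricAt G y) (hh : ContDiffAt ℝ ∞ h y) :
    ContDiffAt ℝ ∞ (localGradSq G h) y := by
  unfold localGradSq
  exact ContDiffAt.sum fun i _ => ContDiffAt.sum fun j _ => (hG.contDiffAt_inv i j).mul
    ((contDiffAt_partialDeriv hh i).mul (contDiffAt_partialDeriv hh j))

end ChainRule

/-! ### Smooth multiples of sections along a map. -/

section SmulBundle

variable {k : WithTop ℕ∞} {B F EB HB EM HM M : Type*} {E : B → Type*}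
  [NormedAddCommGroup F] [NormedSpace ℝ F] [TopologicalSpace (Bundle.TotalSpace F E)]
  [∀ x, TopologicalSpace (E x)] [∀ x, AddCommGroup (E x)] [∀ x, Module ℝ (E x)]
  [NormedAddCommGroup EB] [NormedSpace ℝ EB] [TopologicalSpace HB]
  {IB : ModelWithCorners ℝ EB HB} [TopologicalSpace B] [ChartedSpace HB B]
  [FiberBundle F E] [VectorBundle ℝ F E]
  [NormedAddCommGroup EM] [NormedSpace ℝ EM] [TopologicalSpace HM]
  {IM : ModelWithCorners ℝ EM HM} [TopologicalSpace M] [ChartedSpace HM M]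

/-- A smooth section along a map may be multiplied by a smooth function. -/
lemma contMDiffAt_smul_bundle {b : M → B} {v : ∀ m, E (b m)} {u : M → ℝ} {x : M}
    (hu : ContMDiffAt IM 𝓘(ℝ, ℝ) k u x)
    (hv : ContMDiffAt IM (IB.prod 𝓘(ℝ, F)) k (fun m => Bundle.TotalSpace.mk' F (b m) (v m)) x) :
    ContMDiffAt IM (IB.prod 𝓘(ℝ, F)) k
      (fun m => Bundle.TotalSpace.mk' F (b m) (u m • v m)) x := by
  rw [Bundle.contMDiffAt_totalSpace] at hv ⊢
  refine ⟨hv.1, (hu.smul hv.2).congr_of_eventuallyEq ?_⟩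
  filter_upwards [hv.1.continuousAt.preimage_mem_nhds
    ((trivializationAt F E (b x)).open_baseSet.mem_nhds
      (FiberBundle.mem_baseSet_trivializationAt' (b x)))] with q hq
  exact ((trivializationAt F E (b x)).linear ℝ hq).2 (u q) (v q)

end SmulBundle

/-! ### Conformally rescaled metrics on the manifold. -/

section Rescale

variable {n : ℕ} {M : Type*} [TopologicalSpace M] [ChartedSpace (Model n) M]
  [IsManifold (𝓡 n) ∞ M]

set_option synthInstance.maxHeartbeats 200000 in
/-- The metric `u g` for a positive smooth function `u`. -/
def rescale (g : Metric n M) (u : M → ℝ) (hu : ContMDiff (𝓡 n) 𝓘(ℝ, ℝ) ∞ u)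
    (hpos : ∀ x, 0 < u x) : Metric n M where
  inner x := u x • g.inner x
  symm x v w := by
    change u x * g.inner x v w = u x * g.inner x w v
    rw [g.symm]
  pos x v hv := mul_pos (hpos x) (g.pos x v hv)
  isVonNBounded x := by
    -- The unit ball of `u g` is contained in the image of the unit ball of `g` under multiplication
    -- by `u ^ (-1/2)`.
    have h1 := (g.isVonNBounded x).image
      ((Real.sqrt (u x))⁻¹ • ContinuousLinearMap.id ℝ (TangentSpace (𝓡 n) x))
    refine h1.subset fun v hv => ?_
    have hs := Real.sqrt_pos.2 (hpos x)
    refine ⟨Real.sqrt (u x) • v, ?_, ?_⟩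
    · have hv' : u x * g.inner x v v < 1 := hv
      change g.inner x (Real.sqrt (u x) • v) (Real.sqrt (u x) • v) < 1
      rw [map_smul, map_smul]
      change Real.sqrt (u x) * (Real.sqrt (u x) * g.inner x v v) < 1
      rwa [← mul_assoc, Real.mul_self_sqrt (hpos x).le]
    · change (Real.sqrt (u x))⁻¹ • (Real.sqrt (u x) • v) = v
      rw [smul_smul, inv_mul_cancel₀ hs.ne', one_smul]
  contMDiff := hu.smul_section g.contMDiff

lemma rescale_eq_self (g : Metric n M) {u : M → ℝ} (hu : ContMDiff (𝓡 n) 𝓘(ℝ, ℝ) ∞ u)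
    (hpos : ∀ x, 0 < u x) (h1 : ∀ x, u x = 1) : rescale g u hu hpos = g := by
  have : (fun x => u x • g.inner x) = g.inner := by
    ext1 x
    rw [h1, one_smul]
  cases g
  unfold rescale
  congr

lemma coeff_rescale (g : Metric n M) {u : M → ℝ} (hu : ContMDiff (𝓡 n) 𝓘(ℝ, ℝ) ∞ u)
    (hpos : ∀ x, 0 < u x) (c : M) (y : Model n) :
    coeff (rescale g u hu hpos) c y = u ((extChartAt (𝓡 n) c).symm y) • coeff g c y := rfl

set_option maxHeartbeats 1000000 in
set_option synthInstance.maxHeartbeats 400000 in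
/-- A jointly smooth family of conformal factors gives a smooth curve of metrics. -/
lemma isSmoothCurve_rescale (g : Metric n M) {u : ℝ → M → ℝ}
    (hu : ∀ t, ContMDiff (𝓡 n) 𝓘(ℝ, ℝ) ∞ (u t)) (hpos : ∀ t x, 0 < u t x)
    (hjoint : ContMDiff (𝓘(ℝ, ℝ).prod (𝓡 n)) 𝓘(ℝ, ℝ) ∞ fun p : ℝ × M => u p.1 p.2) :
    IsSmoothCurve fun t => rescale g (u t) (hu t) (hpos t) := by
  intro p
  have hg : ContMDiffAt (𝓘(ℝ, ℝ).prod (𝓡 n))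
      ((𝓡 n).prod 𝓘(ℝ, Model n →L[ℝ] Model n →L[ℝ] ℝ)) ∞
      (fun p : ℝ × M => Bundle.TotalSpace.mk' (Model n →L[ℝ] Model n →L[ℝ] ℝ)
        (E := fun x : M => TangentSpace (𝓡 n) x →L[ℝ] TangentSpace (𝓡 n) x →L[ℝ] ℝ)
        p.2 (g.inner p.2)) p :=
    (g.contMDiff p.2).comp p contMDiffAt_snd
  exact contMDiffAt_smul_bundle (F := Model n →L[ℝ] Model n →L[ℝ] ℝ)
    (E := fun x : M => TangentSpace (𝓡 n) x →L[ℝ] TangentSpace (𝓡 n) x →L[ℝ] ℝ)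
    (b := fun p : ℝ × M => p.2) (v := fun p => g.inner p.2) (u := fun p : ℝ × M => u p.1 p.2)
    (hjoint p) hg

lemma contDiffAt_comp_symm {f : M → ℝ} (hf : ContMDiff (𝓡 n) 𝓘(ℝ, ℝ) ∞ f) {c : M} {y : Model n}
    (hy : y ∈ (extChartAt (𝓡 n) c).target) :
    ContDiffAt ℝ ∞ (fun z => f ((extChartAt (𝓡 n) c).symm z)) y := by
  rw [← contMDiffAt_iff_contDiffAt]
  exact (hf _).comp y (contMDiffAt_symm hy)

/-- The scalar curvature of `u g` in terms of the metric `g`. -/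
lemma scalarCurvature_rescale (g : Metric n M) {u f : M → ℝ}
    (hu : ContMDiff (𝓡 n) 𝓘(ℝ, ℝ) ∞ u) (hpos : ∀ x, 0 < u x)
    {a b m : ℝ} (hf : ContMDiff (𝓡 n) 𝓘(ℝ, ℝ) ∞ f) (hw : ∀ x, 0 < 1 + a * (f x - m))
    (huf : ∀ x, u x = Real.exp (2 * (b * Real.log (1 + a * (f x - m)))))
    {c x : M} (hx : x ∈ (extChartAt (𝓡 n) c).source) :
    scalarCurvature (rescale g u hu hpos) x
      = Real.exp (-(2 * (b * Real.log (1 + a * (f x - m))))) * (scalarCurvature g x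
        - 2 * ((n : ℝ) - 1) * (b * a / (1 + a * (f x - m))
            * localLaplacian (coeff g c) (fun z => f ((extChartAt (𝓡 n) c).symm z))
              (extChartAt (𝓡 n) c x)
          - b * a ^ 2 / (1 + a * (f x - m)) ^ 2
            * localGradSq (coeff g c) (fun z => f ((extChartAt (𝓡 n) c).symm z))
              (extChartAt (𝓡 n) c x))
        - ((n : ℝ) - 1) * ((n : ℝ) - 2) * ((b * a / (1 + a * (f x - m))) ^ 2
            * localGradSq (coeff g c) (fun z => f ((extChartAt (𝓡 n) c).symm z))
              (extChartAt (𝓡 n) c x))) := by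
  let h : Model n → ℝ := fun z => f ((extChartAt (𝓡 n) c).symm z)
  let y := extChartAt (𝓡 n) c x
  have hy : y ∈ (extChartAt (𝓡 n) c).target := (extChartAt (𝓡 n) c).map_source hx
  have hyx : (extChartAt (𝓡 n) c).symm y = x := (extChartAt (𝓡 n) c).left_inv hx
  have hhy : h y = f x := congrArg f hyx
  have hwz : ∀ z, 0 < 1 + a * (h z - m) := fun z => hw _
  -- The conformal exponent is `Φ ∘ f`, so the conformal law and the chain rule express everything
  -- through the Laplacian and the gradient of `f`.
  let Φ : ℝ → ℝ := fun r => b * Real.log (1 + a * (r - m))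
  let Φ₁ : ℝ → ℝ := fun r => b * a / (1 + a * (r - m))
  have hsm : ∀ᶠ z in 𝓝 y, ContDiffAt ℝ ∞ h z := by
    filter_upwards [(isOpen_extChartAt_target c).mem_nhds hy] with z hz
      using contDiffAt_comp_symm hf hz
  have hlin : ∀ r, HasDerivAt (fun r => 1 + a * (r - m)) a r := fun r => by
    simpa using (((hasDerivAt_id r).sub_const m).const_mul a).const_add 1
  have hΦ : ∀ z, HasDerivAt Φ (Φ₁ (h z)) (h z) := fun z => by
    have := ((hlin (h z)).log (hwz z).ne').const_mul b
    simpa only [Φ, Φ₁, mul_div_assoc] using this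
  have hΦ₁ : HasDerivAt Φ₁ (-(b * a ^ 2 / (1 + a * (h y - m)) ^ 2)) (h y) := by
    have := (hasDerivAt_const (h y) (b * a)).fun_div (hlin (h y)) (hwz y).ne'
    have e : -(b * a ^ 2 / (1 + a * (h y - m)) ^ 2)
        = (0 * (1 + a * (h y - m)) - b * a * a) / (1 + a * (h y - m)) ^ 2 := by ring
    rw [e]
    exact this
  have hcf : IsConformalAt (coeff (rescale g u hu hpos) c) (coeff g c) (fun z => Φ (h z)) y := by
    refine ⟨isMetricAt_coeff g c hy, ?_, coeff_symm _ c, Eventually.of_forall fun z => ?_⟩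
    · filter_upwards [hsm] with z hz
      exact contDiffAt_const.mul ((contDiffAt_const.add (contDiffAt_const.mul
        (hz.sub contDiffAt_const))).log (hwz z).ne')
    · rw [coeff_rescale, huf]
  rw [scalarCurvature_eq _ hx, scalarCurvature_eq g hx, hcf.localScalar_eq,
    localLaplacian_comp hsm.self_of_nhds (Eventually.of_forall hΦ)
      (hsm.mono fun z hz => hz.differentiableAt (by simp)) hΦ₁,
    localGradSq_comp (hΦ y) (hsm.self_of_nhds.differentiableAt (by simp))]
  simp only [Φ, Φ₁, hhy]
  ring

end Rescale

/-! ### Differentiation under the integral sign. -/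

section ParametricIntegral

/-- Differentiation under the integral sign for an integrand depending on a parameter and on a
continuous map from a compact space. -/
lemma hasDerivAt_integral_comp {X E : Type*} [TopologicalSpace X] [CompactSpace X]
    [MeasurableSpace X] [BorelSpace X] {μ : Measure X} [IsFiniteMeasure μ]
    [NormedAddCommGroup E] [NormedSpace ℝ E] [SecondCountableTopology E]
    {H : ℝ × E → ℝ} {O : Set (ℝ × E)} (hO : IsOpen O) (hH : ContDiffOn ℝ 1 H O)
    {Φ : X → E} (hΦ : Continuous Φ) {δ : ℝ} (hδ : 0 < δ)
    (hmem : ∀ θ ∈ Set.Icc (-δ) δ, ∀ x, (θ, Φ x) ∈ O) {D : X → ℝ}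
    (hD : ∀ x, HasDerivAt (fun θ => H (θ, Φ x)) (D x) 0) :
    HasDerivAt (fun θ => ∫ x, H (θ, Φ x) ∂μ) (∫ x, D x ∂μ) 0 := by
  have hd : ∀ p ∈ O, HasFDerivAt H (fderiv ℝ H p) p := fun p hp =>
    ((hH.contDiffAt (hO.mem_nhds hp)).differentiableAt (by simp)).hasFDerivAt
  have hD' : ∀ θ ∈ Set.Icc (-δ) δ, ∀ x,
      HasDerivAt (fun θ => H (θ, Φ x)) (fderiv ℝ H (θ, Φ x) (1, 0)) θ := by
    intro θ hθ x
    exact (hd _ (hmem θ hθ x)).comp_hasDerivAt θ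
      ((hasDerivAt_id θ).prodMk (hasDerivAt_const θ (Φ x)))
  have hcont : ∀ θ ∈ Set.Icc (-δ) δ, Continuous fun x => H (θ, Φ x) := fun θ hθ =>
    hH.continuousOn.comp_continuous (continuous_const.prodMk hΦ) (hmem θ hθ)
  have hfd : ContinuousOn (fderiv ℝ H) O := hH.continuousOn_fderiv_of_isOpen hO le_rfl
  -- Compactness gives a uniform bound on the parameter derivative, which is the dominating
  -- constant.
  have hK : IsCompact (Set.Icc (-δ) δ ×ˢ Set.range Φ) :=
    isCompact_Icc.prod (isCompact_range hΦ)
  have hKO : Set.Icc (-δ) δ ×ˢ Set.range Φ ⊆ O := by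
    rintro ⟨θ, e⟩ ⟨h1, x, rfl⟩
    exact hmem θ h1 x
  obtain ⟨C, hC⟩ := hK.exists_bound_of_continuousOn (f := fun p => fderiv ℝ H p (1, 0))
    ((hfd.mono hKO).clm_apply continuousOn_const)
  have h0 : (0 : ℝ) ∈ Set.Icc (-δ) δ := ⟨by linarith, hδ.le⟩
  have hnhds : Set.Icc (-δ) δ ∈ 𝓝 (0 : ℝ) := Icc_mem_nhds (by linarith) hδ
  have hcont' : Continuous fun x => fderiv ℝ H (0, Φ x) (1, 0) :=
    (hfd.comp_continuous (continuous_const.prodMk hΦ) (hmem 0 h0)).clm_apply continuous_const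
  have key := (hasDerivAt_integral_of_dominated_loc_of_deriv_le (μ := μ) (bound := fun _ => C)
    (F := fun θ x => H (θ, Φ x)) (F' := fun θ x => fderiv ℝ H (θ, Φ x) (1, 0)) (x₀ := 0) hnhds
    (by
      filter_upwards [hnhds] with θ hθ
      exact (hcont θ hθ).aestronglyMeasurable_of_compactSpace)
    ((hcont 0 h0).integrable_of_hasCompactSupport (HasCompactSupport.of_compactSpace _))
    hcont'.aestronglyMeasurable_of_compactSpace
    (ae_of_all _ fun x θ hθ => hC (θ, Φ x) ⟨hθ, x, rfl⟩)
    (integrable_const C)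
    (ae_of_all _ fun x θ hθ => hD' θ hθ x)).2
  have e : ∀ x, D x = fderiv ℝ H (0, Φ x) (1, 0) := fun x => (hD x).unique (hD' 0 h0 x)
  simp only [e]
  exact key

end ParametricIntegral

/-! ### The energy density along a conformal variation. -/

section EnergyIntegrand

/-- The integrand of the energy along the conformal variation with volume factor `1 + θ F`, as a
function of `θ`, of `F`, of the scalar curvature and of the Laplacian and the squared gradient
of `F`. -/
def energyIntegrand (n : ℕ) (q : ℝ × ℝ × ℝ × ℝ × ℝ) : ℝ :=
  (1 + q.1 * q.2.1) * (Real.exp (-(2 * ((n : ℝ)⁻¹ * Real.log (1 + q.1 * q.2.1)))) * (q.2.2.1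
    - 2 * ((n : ℝ) - 1) * ((n : ℝ)⁻¹ * (q.1 / (1 + q.1 * q.2.1)) * q.2.2.2.1
      - (n : ℝ)⁻¹ * (q.1 / (1 + q.1 * q.2.1)) ^ 2 * q.2.2.2.2)
    - ((n : ℝ) - 1) * ((n : ℝ) - 2)
      * (((n : ℝ)⁻¹ * (q.1 / (1 + q.1 * q.2.1))) ^ 2 * q.2.2.2.2))) ^ 2

lemma contDiffOn_energyIntegrand (n : ℕ) :
    ContDiffOn ℝ 1 (energyIntegrand n) {q | 0 < 1 + q.1 * q.2.1} := by
  intro q hq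
  have hpos : 0 < 1 + q.1 * q.2.1 := hq
  have hq' := hpos.ne'
  refine ContDiffAt.contDiffWithinAt ?_
  unfold energyIntegrand
  have h1 : ContDiffAt ℝ 1 (fun q : ℝ × ℝ × ℝ × ℝ × ℝ => 1 + q.1 * q.2.1) q := by fun_prop
  have hl := h1.log hq'
  have hd : ContDiffAt ℝ 1 (fun q : ℝ × ℝ × ℝ × ℝ × ℝ => q.1 / (1 + q.1 * q.2.1)) q :=
    contDiffAt_fst.div h1 hq'
  fun_prop

/-- The volume factor contributes `F s²`, the squared exponential `-(4/n) F s²` and the Laplacian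
term the rest. The gradient terms are of second order in `θ`, so `Q` does not appear. -/
lemma hasDerivAt_energyIntegrand (n : ℕ) (F s L Q : ℝ) :
    HasDerivAt (fun θ => energyIntegrand n (θ, F, s, L, Q))
      ((1 - 4 * (n : ℝ)⁻¹) * F * s ^ 2 - 4 * (n : ℝ)⁻¹ * ((n : ℝ) - 1) * s * L) 0 := by
  unfold energyIntegrand
  have hw : HasDerivAt (fun θ : ℝ => 1 + θ * F) F 0 := by
    simpa using ((hasDerivAt_id (0 : ℝ)).mul_const F).const_add 1
  have hw0 : (1 : ℝ) + 0 * F ≠ 0 := by simp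
  have he : HasDerivAt (fun θ : ℝ => Real.exp (-(2 * ((n : ℝ)⁻¹ * Real.log (1 + θ * F)))))
      (-(2 * ((n : ℝ)⁻¹ * F))) 0 := by
    simpa using (((hw.log hw0).const_mul (n : ℝ)⁻¹).const_mul 2).fun_neg.exp
  have hq : HasDerivAt (fun θ : ℝ => θ / (1 + θ * F)) 1 0 := by
    simpa using (hasDerivAt_id (0 : ℝ)).fun_div hw hw0
  have hq2 : HasDerivAt (fun θ : ℝ => (θ / (1 + θ * F)) ^ 2) 0 0 := by
    simpa using hq.fun_pow 2
  have hq3 : HasDerivAt (fun θ : ℝ => ((n : ℝ)⁻¹ * (θ / (1 + θ * F))) ^ 2) 0 0 := by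
    simpa using (hq.const_mul (n : ℝ)⁻¹).fun_pow 2
  have hX : HasDerivAt (fun θ : ℝ => s
      - 2 * ((n : ℝ) - 1) * ((n : ℝ)⁻¹ * (θ / (1 + θ * F)) * L
        - (n : ℝ)⁻¹ * (θ / (1 + θ * F)) ^ 2 * Q)
      - ((n : ℝ) - 1) * ((n : ℝ) - 2) * (((n : ℝ)⁻¹ * (θ / (1 + θ * F))) ^ 2 * Q))
      (-(2 * ((n : ℝ) - 1) * ((n : ℝ)⁻¹ * L))) 0 := by
    have := (((((hq.const_mul (n : ℝ)⁻¹).mul_const L).fun_sub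
      ((hq2.const_mul (n : ℝ)⁻¹).mul_const Q)).const_mul (2 * ((n : ℝ) - 1))).const_sub s).fun_sub
      ((hq3.mul_const Q).const_mul (((n : ℝ) - 1) * ((n : ℝ) - 2)))
    simpa using this
  refine (hw.fun_mul ((he.fun_mul hX).fun_pow 2)).congr_deriv ?_
  simp
  ring

end EnergyIntegrand

/-! ### The first variation for conformal deformations. -/

section Variation

variable {n : ℕ} {M : Type*} [TopologicalSpace M] [ChartedSpace (Model n) M]
  [IsManifold (𝓡 n) ∞ M]

-- Near the support of `f` the function is `K` read in the chart, and off the support it is locally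
-- zero; these two open conditions cover `M`.
omit [IsManifold (𝓡 n) ∞ M] in
lemma continuous_indicator_source {c : M} {f : M → ℝ}
    (hsupp : tsupport f ⊆ (extChartAt (𝓡 n) c).source) {K : Model n → ℝ}
    (hK : ContinuousOn K (extChartAt (𝓡 n) c).target)
    (h0 : ∀ x ∈ (extChartAt (𝓡 n) c).source, x ∉ tsupport f → K (extChartAt (𝓡 n) c x) = 0) :
    Continuous ((extChartAt (𝓡 n) c).source.indicator fun x => K (extChartAt (𝓡 n) c x)) := by
  rw [continuous_iff_continuousAt]
  intro x
  by_cases hx : x ∈ tsupport f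
  · have hs := hsupp hx
    have hev : (extChartAt (𝓡 n) c).source.indicator (fun x => K (extChartAt (𝓡 n) c x))
        =ᶠ[𝓝 x] fun x => K (extChartAt (𝓡 n) c x) := by
      filter_upwards [(isOpen_extChartAt_source c).mem_nhds hs] with z hz
      exact Set.indicator_of_mem hz _
    refine ContinuousAt.congr ?_ hev.symm
    exact ContinuousAt.comp (g := K) (hK.continuousAt ((isOpen_extChartAt_target c).mem_nhds
      ((extChartAt (𝓡 n) c).map_source hs))) (continuousAt_extChartAt' hs)
  · have hev : (extChartAt (𝓡 n) c).source.indicator (fun x => K (extChartAt (𝓡 n) c x))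
        =ᶠ[𝓝 x] fun _ => 0 := by
      filter_upwards [(isClosed_tsupport f).isOpen_compl.mem_nhds hx] with z hz
      by_cases hz' : z ∈ (extChartAt (𝓡 n) c).source
      · rw [Set.indicator_of_mem hz', h0 z hz' hz]
      · exact Set.indicator_of_notMem hz' _
    exact ContinuousAt.congr continuousAt_const hev.symm

lemma comp_symm_eventuallyEq_zero {c x : M} {f : M → ℝ} (hx : x ∈ (extChartAt (𝓡 n) c).source)
    (hf : x ∉ tsupport f) :
    (fun z => f ((extChartAt (𝓡 n) c).symm z)) =ᶠ[𝓝 (extChartAt (𝓡 n) c x)] 0 := by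
  have h1 : Tendsto (extChartAt (𝓡 n) c).symm (𝓝 (extChartAt (𝓡 n) c x)) (𝓝 x) := by
    have := (contMDiffAt_symm ((extChartAt (𝓡 n) c).map_source hx)).continuousAt
    rwa [ContinuousAt, (extChartAt (𝓡 n) c).left_inv hx] at this
  exact h1.eventually (notMem_tsupport_iff_eventuallyEq.1 hf)

/-- The Laplacian of a function supported in the domain of the chart at `c`. -/
def chartLaplacian (g : Metric n M) (c : M) (f : M → ℝ) : M → ℝ :=
  (extChartAt (𝓡 n) c).source.indicator fun x =>
    localLaplacian (coeff g c) (fun z => f ((extChartAt (𝓡 n) c).symm z)) (extChartAt (𝓡 n) c x)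

/-- The squared gradient of a function supported in the domain of the chart at `c`. -/
def chartGradSq (g : Metric n M) (c : M) (f : M → ℝ) : M → ℝ :=
  (extChartAt (𝓡 n) c).source.indicator fun x =>
    localGradSq (coeff g c) (fun z => f ((extChartAt (𝓡 n) c).symm z)) (extChartAt (𝓡 n) c x)

variable {c : M} {f : M → ℝ} (g : Metric n M)

lemma continuous_chartLaplacian (hf : ContMDiff (𝓡 n) 𝓘(ℝ, ℝ) ∞ f)
    (hsupp : tsupport f ⊆ (extChartAt (𝓡 n) c).source) : Continuous (chartLaplacian g c f) :=
  continuous_indicator_source hsupp (fun _ hy => (contDiffAt_localLaplacian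
    (isMetricAt_coeff g c hy) (contDiffAt_comp_symm hf hy)).continuousAt.continuousWithinAt)
    fun _ hx hx' => localLaplacian_eq_zero (comp_symm_eventuallyEq_zero hx hx')

lemma continuous_chartGradSq (hf : ContMDiff (𝓡 n) 𝓘(ℝ, ℝ) ∞ f)
    (hsupp : tsupport f ⊆ (extChartAt (𝓡 n) c).source) : Continuous (chartGradSq g c f) :=
  continuous_indicator_source hsupp (fun _ hy => (contDiffAt_localGradSq
    (isMetricAt_coeff g c hy) (contDiffAt_comp_symm hf hy)).continuousAt.continuousWithinAt)
    fun _ hx hx' => localGradSq_eq_zero (comp_symm_eventuallyEq_zero hx hx')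

/-- Outside the chart at `c` the function `f` vanishes near `x`, and the chart at `x` itself gives
zero. This makes `scalarCurvature_rescale` usable at every point with globally defined continuous
data. -/
lemma exists_chart_laplacian_eq (hsupp : tsupport f ⊆ (extChartAt (𝓡 n) c).source) (x : M) :
    ∃ c', x ∈ (extChartAt (𝓡 n) c').source ∧
      localLaplacian (coeff g c') (fun z => f ((extChartAt (𝓡 n) c').symm z))
        (extChartAt (𝓡 n) c' x) = chartLaplacian g c f x ∧
      localGradSq (coeff g c') (fun z => f ((extChartAt (𝓡 n) c').symm z))
        (extChartAt (𝓡 n) c' x) = chartGradSq g c f x := by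
  by_cases hx : x ∈ (extChartAt (𝓡 n) c).source
  · exact ⟨c, hx, by rw [chartLaplacian, Set.indicator_of_mem hx],
      by rw [chartGradSq, Set.indicator_of_mem hx]⟩
  · have h0 := comp_symm_eventuallyEq_zero (mem_extChartAt_source (I := 𝓡 n) x)
      fun h => hx (hsupp h)
    refine ⟨x, mem_extChartAt_source x, ?_, ?_⟩
    · rw [localLaplacian_eq_zero h0]
      exact (Set.indicator_of_notMem hx _).symm
    · rw [localGradSq_eq_zero h0]
      exact (Set.indicator_of_notMem hx _).symm

omit [IsManifold (𝓡 n) ∞ M] in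
lemma contMDiff_slice {u : ℝ → M → ℝ}
    (hu : ContMDiff (𝓘(ℝ, ℝ).prod (𝓡 n)) 𝓘(ℝ, ℝ) ∞ fun p : ℝ × M => u p.1 p.2) (t : ℝ) :
    ContMDiff (𝓡 n) 𝓘(ℝ, ℝ) ∞ (u t) := by
  have h1 : ContMDiff (𝓡 n) (𝓘(ℝ, ℝ).prod (𝓡 n)) ∞ (fun x : M => (t, x)) :=
    contMDiff_const.prodMk contMDiff_id
  exact ContMDiff.comp (g := fun p : ℝ × M => u p.1 p.2) (f := fun x : M => (t, x)) hu h1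

variable [T2Space M] [CompactSpace M] [MeasurableSpace M] [BorelSpace M]

/-- The first variation of the energy of a critical metric along volume preserving conformal
deformations. -/
theorem first_variation (hn : n ≠ 0) {g : Metric n M} (hg : IsCritical g)
    (hf : ContMDiff (𝓡 n) 𝓘(ℝ, ℝ) ∞ f) (hsupp : tsupport f ⊆ (extChartAt (𝓡 n) c).source)
    (h0 : ∀ x, 0 ≤ f x) (h1 : ∀ x, f x ≤ 1) :
    ∫ x, ((1 - 4 * (n : ℝ)⁻¹) * (f x - ∫ z, f z ∂(riemMeasure g)) * scalarCurvature g x ^ 2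
      - 4 * (n : ℝ)⁻¹ * ((n : ℝ) - 1) * scalarCurvature g x * chartLaplacian g c f x)
        ∂(riemMeasure g) = 0 := by
  let μ := riemMeasure g
  have : IsProbabilityMeasure μ := ⟨hg.1⟩
  set m : ℝ := ∫ z, f z ∂(riemMeasure g) with hm
  have hfi : Integrable f μ :=
    hf.continuous.integrable_of_hasCompactSupport (HasCompactSupport.of_compactSpace _)
  have hm0 : 0 ≤ m := integral_nonneg h0
  have hm1 : m ≤ 1 := by
    have := integral_mono hfi (integrable_const (1 : ℝ)) h1
    simpa using this
  have hF : ∀ x, |f x - m| ≤ 1 := fun x => by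
    rw [abs_le]
    constructor <;> linarith [h0 x, h1 x]
  have hmem : ∀ θ ∈ Set.Icc (-(1 / 2 : ℝ)) (1 / 2), ∀ x, 0 < 1 + θ * (f x - m) := by
    intro θ hθ x
    have h2 : |θ * (f x - m)| ≤ 1 / 2 * 1 := by
      rw [abs_mul]
      exact mul_le_mul (abs_le.2 hθ) (hF x) (abs_nonneg _) (by norm_num)
    linarith [(abs_le.1 h2).1]
  -- A curve of metrics must be defined for all real `t`. The sine keeps `|a| ≤ 1/2`, so by `|f - m|
  -- ≤ 1` the factor `1 + a (f - m)` stays positive, while `a'(0) = 1/2` is nonzero.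
  let a : ℝ → ℝ := fun t => 1 / 2 * Real.sin t
  have ha : ∀ t, a t ∈ Set.Icc (-(1 / 2 : ℝ)) (1 / 2) := fun t => by
    constructor <;> simp only [a] <;> linarith [Real.sin_le_one t, Real.neg_one_le_sin t]
  have hw : ∀ t x, 0 < 1 + a t * (f x - m) := fun t x => hmem _ (ha t) x
  -- With this exponent the conformal factor is `w ^ (2 / n)` for `w = 1 + a (f - m)`, and the
  -- volume element is multiplied by exactly `w`, whose mean is one.
  let b : ℝ := (n : ℝ)⁻¹
  have hnb : (n : ℝ) * b = 1 := mul_inv_cancel₀ (Nat.cast_ne_zero.2 hn)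
  let u : ℝ → M → ℝ := fun t x => Real.exp (2 * (b * Real.log (1 + a t * (f x - m))))
  have hpos : ∀ t x, 0 < u t x := fun t x => Real.exp_pos _
  have hjoint : ContMDiff (𝓘(ℝ, ℝ).prod (𝓡 n)) 𝓘(ℝ, ℝ) ∞ fun p : ℝ × M => u p.1 p.2 := by
    intro p
    have hsin : ContMDiffAt (𝓘(ℝ, ℝ).prod (𝓡 n)) 𝓘(ℝ, ℝ) ∞ (fun p : ℝ × M => a p.1) p :=
      ((contDiff_const.mul Real.contDiff_sin).contMDiff _).comp p contMDiffAt_fst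
    have hfs : ContMDiffAt (𝓘(ℝ, ℝ).prod (𝓡 n)) 𝓘(ℝ, ℝ) ∞ (fun p : ℝ × M => f p.2) p :=
      (hf _).comp p contMDiffAt_snd
    have hww : ContMDiffAt (𝓘(ℝ, ℝ).prod (𝓡 n)) 𝓘(ℝ, ℝ) ∞
        (fun p : ℝ × M => 1 + a p.1 * (f p.2 - m)) p :=
      contMDiffAt_const.add (hsin.mul (hfs.sub contMDiffAt_const))
    have hψ : ContDiffAt ℝ ∞ (fun r => Real.exp (2 * (b * Real.log r)))
        (1 + a p.1 * (f p.2 - m)) :=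
      (contDiffAt_const.mul (contDiffAt_const.mul
        (contDiffAt_id.log (hw p.1 p.2).ne'))).exp
    exact ContMDiffAt.comp (g := fun r => Real.exp (2 * (b * Real.log r))) p hψ.contMDiffAt hww
  have hu : ∀ t, ContMDiff (𝓡 n) 𝓘(ℝ, ℝ) ∞ (u t) := fun t => contMDiff_slice hjoint t
  let γ : ℝ → Metric n M := fun t => rescale g (u t) (hu t) (hpos t)
  have hγ0 : γ 0 = g := rescale_eq_self g _ _ fun x => by simp [u, a]
  have hcurve : IsSmoothCurve γ := isSmoothCurve_rescale g hu hpos hjoint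
  have hun : ∀ t x, Real.sqrt (u t x ^ n) = 1 + a t * (f x - m) := by
    intro t x
    have : u t x ^ n = (1 + a t * (f x - m)) ^ 2 := by
      rw [← Real.exp_nat_mul]
      have e : (n : ℝ) * (2 * (b * Real.log (1 + a t * (f x - m))))
          = ((2 : ℕ) : ℝ) * Real.log (1 + a t * (f x - m)) := by
        push_cast
        linear_combination (2 * Real.log (1 + a t * (f x - m))) * hnb
      rw [e, Real.exp_nat_mul, Real.exp_log (hw t x)]
    rw [this, Real.sqrt_sq (hw t x).le]
  have hmeas : ∀ t, riemMeasure (γ t)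
      = μ.withDensity fun x => ENNReal.ofReal (1 + a t * (f x - m)) := by
    intro t
    have := riemMeasure_rescale g (γ t) (hpos t) (hu t).continuous fun x v w => rfl
    rw [this]
    simp only [hun]
    rfl
  have hvol : ∀ t, riemMeasure (γ t) Set.univ = 1 := by
    intro t
    have hint : Integrable (fun x => a t * (f x - m)) μ :=
      (hfi.sub (integrable_const m)).const_mul (a t)
    have hint1 : Integrable (fun x => 1 + a t * (f x - m)) μ := (integrable_const 1).add hint
    have hI : ∫ x, (1 + a t * (f x - m)) ∂μ = 1 := by
      have : ∫ x, f x ∂μ = m := rfl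
      rw [integral_add (integrable_const 1) hint, integral_const_mul,
        integral_sub hfi (integrable_const m), this]
      simp
    rw [hmeas, withDensity_apply _ MeasurableSet.univ, Measure.restrict_univ,
      ← ofReal_integral_eq_lintegral_ofReal hint1 (ae_of_all _ fun x => (hw t x).le), hI,
      ENNReal.ofReal_one]
  -- The energy density depends on the point only through these four continuous functions, which is
  -- the setting of `hasDerivAt_integral_comp`.
  let Φ : M → ℝ × ℝ × ℝ × ℝ := fun x =>
    (f x - m, scalarCurvature g x, chartLaplacian g c f x, chartGradSq g c f x)
  have hΦ : Continuous Φ := (hf.continuous.sub continuous_const).prodMk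
    ((continuous_scalarCurvature g).prodMk
      ((continuous_chartLaplacian g hf hsupp).prodMk (continuous_chartGradSq g hf hsupp)))
  have henergy : ∀ t, energy (γ t) = ∫ x, energyIntegrand n (a t, Φ x) ∂μ := by
    intro t
    have hmw : Measurable fun x => ENNReal.ofReal (1 + a t * (f x - m)) :=
      (show Continuous fun x => 1 + a t * (f x - m) from continuous_const.add
        (continuous_const.mul (hf.continuous.sub continuous_const))).measurable.ennreal_ofReal
    unfold energy
    rw [hmeas, integral_withDensity_eq_integral_toReal_smul hmw
      (ae_of_all _ fun _ => ENNReal.ofReal_lt_top)]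
    refine integral_congr_ae (ae_of_all _ fun x => ?_)
    obtain ⟨c', hx, hL, hQ⟩ := exists_chart_laplacian_eq g hsupp x
    simp only [smul_eq_mul]
    rw [ENNReal.toReal_ofReal (hw t x).le, scalarCurvature_rescale g (hu t) (hpos t) hf (hw t)
      (fun _ => rfl) hx, hL, hQ]
    simp only [energyIntegrand, Φ, b]
    congr 3
    generalize 1 + a t * (f x - m) = w
    ring
  have hder := hasDerivAt_integral_comp (μ := μ) (H := energyIntegrand n)
    (O := {q | 0 < 1 + q.1 * q.2.1}) (isOpen_lt continuous_const (by fun_prop))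
    (contDiffOn_energyIntegrand n) hΦ (δ := 1 / 2) (by norm_num) hmem
    (fun x => hasDerivAt_energyIntegrand n _ _ _ _)
  have ha' : HasDerivAt a (1 / 2) 0 := by
    have := (Real.hasDerivAt_sin 0).const_mul (1 / 2 : ℝ)
    rwa [Real.cos_zero, mul_one] at this
  have ha0 : a 0 = 0 := by simp [a]
  have hcomp := HasDerivAt.comp (0 : ℝ) (h₂ := fun θ => ∫ x, energyIntegrand n (θ, Φ x) ∂μ)
    (by rw [ha0]; exact hder) ha'
  have hcrit := hg.2 γ hcurve hγ0 hvol
  simp only [henergy] at hcrit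
  -- The chain rule gives half the desired integral as the derivative of the energy at `0`;
  -- criticality makes it zero.
  have := hcomp.unique hcrit
  have h2 : ∫ x, ((1 - 4 * (n : ℝ)⁻¹) * (f x - m) * scalarCurvature g x ^ 2
      - 4 * (n : ℝ)⁻¹ * ((n : ℝ) - 1) * scalarCurvature g x * chartLaplacian g c f x) ∂μ = 0 := by
    linarith
  exact h2

end Variation

lemma continuous_of_continuousOn_of_eq_zero {X : Type*} [TopologicalSpace X] {U T : Set X}
    {F : X → ℝ} (hU : IsOpen U) (hT : IsClosed T) (hTU : T ⊆ U) (hF : ContinuousOn F U)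
    (h0 : ∀ y ∉ T, F y = 0) : Continuous F := by
  rw [continuous_iff_continuousAt]
  intro y
  by_cases hy : y ∈ T
  · exact hF.continuousAt (hU.mem_nhds (hTU hy))
  · refine ContinuousAt.congr (f := fun _ => (0 : ℝ)) continuousAt_const ?_
    filter_upwards [hT.isOpen_compl.mem_nhds hy] with z hz using (h0 z hz).symm

lemma localLaplacian_congr {n : ℕ} {G : Model n → Matrix (Fin n) (Fin n) ℝ} {f₁ f₂ : Model n → ℝ}
    {y : Model n} (h : f₁ =ᶠ[𝓝 y] f₂) : localLaplacian G f₁ y = localLaplacian G f₂ y := by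
  have h1 : ∀ j, partialDeriv j f₁ =ᶠ[𝓝 y] partialDeriv j f₂ := fun j => by
    filter_upwards [h.eventually_nhds] with z hz
    have : f₁ =ᶠ[𝓝 z] f₂ := hz
    simp only [partialDeriv, this.fderiv_eq]
  have h2 : ∀ i j, partialDeriv i (partialDeriv j f₁) y = partialDeriv i (partialDeriv j f₂) y :=
    fun i j => by
    simp only [partialDeriv] at h1 ⊢
    rw [(h1 j).fderiv_eq]
  unfold localLaplacian
  simp only [h2, (h1 _).self_of_nhds]

/-! ### The pointwise Euler–Lagrange equation. -/

section EulerLagrange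

variable {n : ℕ} {M : Type*} [TopologicalSpace M] [ChartedSpace (Model n) M]
  [IsManifold (𝓡 n) ∞ M]

omit [IsManifold (𝓡 n) ∞ M] in
lemma tsupport_toContDiffBump_subset {p : M} (f : SmoothBumpFunction (𝓡 n) p) :
    tsupport f.toContDiffBump ⊆ (extChartAt (𝓡 n) p).target := by
  rw [f.toContDiffBump.tsupport_eq]
  simpa using f.closedBall_subset

omit [IsManifold (𝓡 n) ∞ M] in
lemma bump_symm {p : M} (f : SmoothBumpFunction (𝓡 n) p) {y : Model n}
    (hy : y ∈ (extChartAt (𝓡 n) p).target) :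
    f ((extChartAt (𝓡 n) p).symm y) = f.toContDiffBump y := by
  have h := (extChartAt (𝓡 n) p).map_target hy
  rw [extChartAt_source] at h
  rw [f.eqOn_source h, Function.comp_apply, (extChartAt (𝓡 n) p).right_inv hy]

variable [T2Space M] [CompactSpace M] [MeasurableSpace M]

/-- The Euler–Lagrange expression `(n - 4) (s² - S(g)) - 4 (n - 1) Δ s` in the chart at `p`. -/
def eulerLagrange (g : Metric n M) (p : M) (y : Model n) : ℝ :=
  ((n : ℝ) - 4) * (localScalar (coeff g p) y ^ 2 - energy g)
    - 4 * ((n : ℝ) - 1) * localLaplacian (coeff g p) (localScalar (coeff g p)) y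

variable [BorelSpace M]

omit [BorelSpace M] in
lemma continuousOn_eulerLagrange (g : Metric n M) (p : M) :
    ContinuousOn (eulerLagrange g p) (extChartAt (𝓡 n) p).target := by
  intro y hy
  have hs := contDiffAt_localScalar_coeff g p hy
  have hL := contDiffAt_localLaplacian (isMetricAt_coeff g p hy) hs
  exact ((continuousAt_const.mul ((hs.continuousAt.pow 2).sub continuousAt_const)).sub
    (continuousAt_const.mul hL.continuousAt)).continuousWithinAt

/-- Multiply the first variation by `n`, then replace `m s²` by `f S(g)`: both integrate to `m
S(g)`. This makes the integrand local in `f`. -/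
lemma first_variation_bump (hn : n ≠ 0) {g : Metric n M} (hg : IsCritical g) {p : M}
    (f : SmoothBumpFunction (𝓡 n) p) :
    ∫ x, (((n : ℝ) - 4) * (f x * (scalarCurvature g x ^ 2 - energy g))
      - 4 * ((n : ℝ) - 1) * (scalarCurvature g x * chartLaplacian g p f x)) ∂(riemMeasure g)
        = 0 := by
  have : IsProbabilityMeasure (riemMeasure g) := ⟨hg.1⟩
  have hint : ∀ {F : M → ℝ}, Continuous F → Integrable F (riemMeasure g) := fun {F} hF =>
    hF.integrable_of_hasCompactSupport (HasCompactSupport.of_compactSpace F)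
  have hs := continuous_scalarCurvature g
  have hf := f.continuous
  have hL : Continuous (chartLaplacian g p f) :=
    continuous_chartLaplacian g f.contMDiff f.tsupport_subset_extChartAt_source
  have H := first_variation hn hg f.contMDiff f.tsupport_subset_extChartAt_source
    (fun x => f.nonneg) (fun x => f.le_one)
  set m := ∫ z, f z ∂(riemMeasure g) with hm
  have h1 : ∫ x, (f x * energy g - m * scalarCurvature g x ^ 2) ∂(riemMeasure g) = 0 := by
    rw [integral_sub (hint (by fun_prop)) (hint (by fun_prop)),
      integral_mul_const, integral_const_mul, ← hm, energy, sub_self]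
  have hn' : (n : ℝ) ≠ 0 := Nat.cast_ne_zero.2 hn
  have h2 : ∀ x, ((n : ℝ) - 4) * (f x * (scalarCurvature g x ^ 2 - energy g))
      - 4 * ((n : ℝ) - 1) * (scalarCurvature g x * chartLaplacian g p f x)
      = n * ((1 - 4 * (n : ℝ)⁻¹) * (f x - m) * scalarCurvature g x ^ 2
      - 4 * (n : ℝ)⁻¹ * ((n : ℝ) - 1) * scalarCurvature g x * chartLaplacian g p f x)
      - ((n : ℝ) - 4) * (f x * energy g - m * scalarCurvature g x ^ 2) := fun x => by
    field_simp
    ring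
  simp only [h2]
  rw [integral_sub (hint (by fun_prop)) (hint (by fun_prop)), integral_const_mul,
    integral_const_mul, H, h1]
  simp

/-- In the chart at `p`, Green's identity moves the Laplacian from the bump function to the scalar
curvature. -/
lemma integral_eulerLagrange_bump (hn : n ≠ 0) {g : Metric n M} (hg : IsCritical g) {p : M}
    (f : SmoothBumpFunction (𝓡 n) p) :
    ∫ y, volDensity (coeff g p) y * f.toContDiffBump y * eulerLagrange g p y = 0 := by
  let U := (extChartAt (𝓡 n) p).target
  let G := coeff g p
  let s := localScalar G
  let η : Model n → ℝ := f.toContDiffBump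
  have hU : IsOpen U := isOpen_extChartAt_target p
  have hTU : tsupport η ⊆ U := tsupport_toContDiffBump_subset f
  have hc : HasCompactSupport η := f.toContDiffBump.hasCompactSupport
  have hη : ContDiff ℝ ∞ η := f.toContDiffBump.contDiff
  have hη0 : ∀ y ∉ tsupport η, η y = 0 := fun y hy => image_eq_zero_of_notMem_tsupport hy
  have hLη0 : ∀ y ∉ tsupport η, localLaplacian G η y = 0 := fun y hy =>
    localLaplacian_eq_zero (notMem_tsupport_iff_eventuallyEq.1 hy)
  have hGreen := integral_green hU (fun z hz => isMetricAt_coeff g p hz)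
    (fun z hz => (posDef_coeff g p hz).det_pos)
    (fun z hz => contDiffAt_localScalar_coeff g p hz) hη hc hTU
  have hint : ∀ {F : Model n → ℝ}, ContinuousOn F U → (∀ y ∉ tsupport η, F y = 0) →
      Integrable F := fun {F} hF h0 =>
    (continuous_of_continuousOn_of_eq_zero hU (isClosed_tsupport _) hTU hF
      h0).integrable_of_hasCompactSupport (HasCompactSupport.intro hc h0)
  have hv : ContinuousOn (volDensity G) U := continuousOn_volDensity g p
  have hs : ContinuousOn s U := fun y hy =>
    (contDiffAt_localScalar_coeff g p hy).continuousAt.continuousWithinAt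
  have hLs : ContinuousOn (localLaplacian G s) U := fun y hy =>
    (contDiffAt_localLaplacian (isMetricAt_coeff g p hy)
      (contDiffAt_localScalar_coeff g p hy)).continuousAt.continuousWithinAt
  have hLη : ContinuousOn (localLaplacian G η) U := fun y hy =>
    (contDiffAt_localLaplacian (isMetricAt_coeff g p hy)
      hη.contDiffAt).continuousAt.continuousWithinAt
  have hηc : ContinuousOn η U := hη.continuous.continuousOn
  have hcs := continuous_scalarCurvature g
  have hcL : Continuous (chartLaplacian g p f) :=
    continuous_chartLaplacian g f.contMDiff f.tsupport_subset_extChartAt_source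
  have hcf := f.continuous
  have H := first_variation_bump hn hg f
  rw [integral_riemMeasure_eq g p (Continuous.measurable (by fun_prop)) fun x hx => ?_] at H
  swap
  · have h1 : f x = 0 := image_eq_zero_of_notMem_tsupport fun h =>
      hx (f.tsupport_subset_extChartAt_source h)
    have h2 : chartLaplacian g p f x = 0 := Set.indicator_of_notMem hx _
    simp [h1, h2]
  let K : Model n → ℝ := fun y => volDensity G y * (((n : ℝ) - 4) * (η y * (s y ^ 2 - energy g))
    - 4 * ((n : ℝ) - 1) * (s y * localLaplacian G η y))
  have hK : ∫ y, K y = 0 := by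
    rw [← setIntegral_eq_integral_of_forall_compl_eq_zero (s := U), ← H]
    · refine setIntegral_congr_fun (measurableSet_target p) fun y hy => ?_
      have hx := (extChartAt (𝓡 n) p).map_target hy
      have h1 : chartLaplacian g p f ((extChartAt (𝓡 n) p).symm y) = localLaplacian G η y := by
        rw [chartLaplacian, Set.indicator_of_mem hx, (extChartAt (𝓡 n) p).right_inv hy]
        refine localLaplacian_congr ?_
        filter_upwards [hU.mem_nhds hy] with z hz using bump_symm f hz
      simp only [K]
      rw [h1, bump_symm f hy, scalarCurvature_eq g hx, (extChartAt (𝓡 n) p).right_inv hy]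
    · intro y hy
      have hy' : y ∉ tsupport η := fun h => hy (hTU h)
      simp [K, hη0 y hy', hLη0 y hy']
  have hsum : ∀ y, volDensity G y * η y * eulerLagrange g p y = K y + 4 * ((n : ℝ) - 1) *
      (volDensity G y * (s y * localLaplacian G η y - η y * localLaplacian G s y)) := fun y => by
    simp only [K, eulerLagrange]
    ring
  change ∫ y, volDensity G y * η y * eulerLagrange g p y = 0
  simp only [hsum]
  rw [integral_add (hint (by fun_prop) fun y hy => by simp [K, hη0 y hy, hLη0 y hy])
    (hint (by fun_prop) fun y hy => by simp [hη0 y hy, hLη0 y hy]), integral_const_mul, hK, hGreen]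
  simp

/-- The Euler–Lagrange equation of the `L²`-norm of the scalar curvature for conformal
variations. -/
theorem eulerLagrange_eq_zero (hn : n ≠ 0) {g : Metric n M} (hg : IsCritical g) (p : M) :
    eulerLagrange g p (extChartAt (𝓡 n) p p) = 0 := by
  by_contra hB
  set y₀ := extChartAt (𝓡 n) p p with hy₀
  set b := eulerLagrange g p y₀ with hb
  have hU := isOpen_extChartAt_target (I := 𝓡 n) p
  have hmem : y₀ ∈ (extChartAt (𝓡 n) p).target := mem_extChartAt_target p
  have hBc := continuousOn_eulerLagrange g p
  -- Multiplication by the nonzero value `b` at `y₀` treats both signs at once: the product is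
  -- positive near `y₀`, and a bump supported there has a positive integral against it.
  have hpos : ∀ᶠ y in 𝓝 y₀, y ∈ (extChartAt (𝓡 n) p).target ∧ 0 < eulerLagrange g p y * b :=
    (hU.eventually_mem hmem).and <| ((hBc.continuousAt (hU.mem_nhds hmem)).mul continuousAt_const).eventually
      (lt_mem_nhds (mul_self_pos.2 hB))
  obtain ⟨δ, hδ, hball⟩ := Metric.eventually_nhds_iff_ball.1 hpos
  obtain ⟨f, hf⟩ : ∃ f : SmoothBumpFunction (𝓡 n) p, f.rOut < δ :=
    ⟨{rIn := δ / 4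
      rOut := δ / 2
      rIn_pos := by positivity
      rIn_lt_rOut := by linarith
      closedBall_subset := fun y hy =>
        (hball y (Metric.closedBall_subset_ball (by linarith) hy.1)).1}, half_lt_self hδ⟩
  have hTU := tsupport_toContDiffBump_subset f
  have hsupp : tsupport f.toContDiffBump ⊆ Metric.ball y₀ δ := by
    rw [f.toContDiffBump.tsupport_eq]
    exact Metric.closedBall_subset_ball hf
  let F : Model n → ℝ := fun y =>
    volDensity (coeff g p) y * f.toContDiffBump y * eulerLagrange g p y * b
  have h0 : ∀ y ∉ tsupport f.toContDiffBump, F y = 0 := fun y hy =>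
    mul_eq_zero_of_left (mul_eq_zero_of_left
      (mul_eq_zero_of_right _ (image_eq_zero_of_notMem_tsupport hy)) _) _
  have hF : Continuous F := continuous_of_continuousOn_of_eq_zero hU (isClosed_tsupport _) hTU
    ((((continuousOn_volDensity g p).mul f.toContDiffBump.continuous.continuousOn).mul
      hBc).mul continuousOn_const) h0
  have hF0 : 0 ≤ F := fun y => by
    by_cases hy : y ∈ tsupport f.toContDiffBump
    · have := (hball y (hsupp hy)).2
      have h1 := volDensity_pos g (hTU hy)
      have h2 : 0 ≤ f.toContDiffBump y := f.toContDiffBump.nonneg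
      simp only [F, Pi.zero_apply]
      rw [mul_assoc]
      positivity
    · rw [h0 y hy]
      rfl
  have hFy : F y₀ ≠ 0 := by
    have h1 := volDensity_pos g hmem
    have h2 : f.toContDiffBump y₀ = 1 :=
      f.toContDiffBump.one_of_mem_closedBall (Metric.mem_closedBall_self f.rIn_pos.le)
    simp only [F, h2]
    exact mul_ne_zero (mul_ne_zero (by simpa using h1.ne') hB) hB
  have := hF.integral_pos_of_hasCompactSupport_nonneg_nonzero (μ := volume)
    (HasCompactSupport.intro f.toContDiffBump.hasCompactSupport h0) hF0 hFy
  rw [integral_mul_const, integral_eulerLagrange_bump hn hg f, zero_mul] at this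
  exact lt_irrefl _ this

end EulerLagrange

/-! ### From the Euler–Lagrange equation to constancy. -/

section Conclusion

variable {n : ℕ} {M : Type*} [TopologicalSpace M] [ChartedSpace (Model n) M]
  [IsManifold (𝓡 n) ∞ M]

lemma localScalar_comp_eventuallyEq (g : Metric n M) (p : M) :
    (fun y => scalarCurvature g ((extChartAt (𝓡 n) p).symm y))
      =ᶠ[𝓝 (extChartAt (𝓡 n) p p)] localScalar (coeff g p) := by
  filter_upwards [extChartAt_target_mem_nhds (I := 𝓡 n) p] with y hy
  rw [scalarCurvature_eq g ((extChartAt (𝓡 n) p).map_target hy), (extChartAt (𝓡 n) p).right_inv hy]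

lemma localScalar_coeff (g : Metric n M) (p : M) :
    localScalar (coeff g p) (extChartAt (𝓡 n) p p) = scalarCurvature g p := rfl

lemma localLaplacian_nonpos_of_forall_le (g : Metric n M) {p : M}
    (h : ∀ x, scalarCurvature g x ≤ scalarCurvature g p) :
    localLaplacian (coeff g p) (localScalar (coeff g p)) (extChartAt (𝓡 n) p p) ≤ 0 := by
  refine localLaplacian_nonpos_of_isLocalMax (posDef_coeff g p (mem_extChartAt_target p)) ?_ ?_
  · filter_upwards [extChartAt_target_mem_nhds (I := 𝓡 n) p] with y hy using
      contDiffAt_localScalar_coeff g p hy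
  · filter_upwards [localScalar_comp_eventuallyEq g p] with y hy
    rw [← hy]
    exact h _

lemma localLaplacian_nonneg_of_forall_le (g : Metric n M) {p : M}
    (h : ∀ x, scalarCurvature g p ≤ scalarCurvature g x) :
    0 ≤ localLaplacian (coeff g p) (localScalar (coeff g p)) (extChartAt (𝓡 n) p p) := by
  refine localLaplacian_nonneg_of_isLocalMin (posDef_coeff g p (mem_extChartAt_target p)) ?_ ?_
  · filter_upwards [extChartAt_target_mem_nhds (I := 𝓡 n) p] with y hy using
      contDiffAt_localScalar_coeff g p hy
  · filter_upwards [localScalar_comp_eventuallyEq g p] with y hy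
    rw [← hy]
    exact h _

/-- A continuous function of constant nonzero absolute value cannot change sign on a connected
space. -/
lemma eq_of_sq_eq {X : Type*} [TopologicalSpace X] [PreconnectedSpace X] {s : X → ℝ}
    (hs : Continuous s) {p : X} (h : ∀ x, s x ^ 2 = s p ^ 2) (x : X) : s x = s p := by
  rcases eq_or_ne (s p) 0 with h0 | h0
  · have := h x
    rw [h0] at this ⊢
    simpa using this
  · exact isPreconnected_univ.eq_of_sq_eq hs.continuousOn continuousOn_const
      (fun y _ => h y) (fun {y} _ => h0) (Set.mem_univ p) rfl (Set.mem_univ x)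

variable [T2Space M] [CompactSpace M] [MeasurableSpace M] [BorelSpace M]

/-- For volume one the energy is the mean of `s²`. If the maximum `s(p)²` does not exceed it, the
nonnegative continuous function `s(p)² - s²` has nonpositive integral and vanishes. -/
lemma sq_scalarCurvature_eq {g : Metric n M} (hvol : riemMeasure g Set.univ = 1) {p : M}
    (hle : ∀ x, |scalarCurvature g x| ≤ |scalarCurvature g p|)
    (hE : scalarCurvature g p ^ 2 ≤ energy g) (x : M) :
    scalarCurvature g x ^ 2 = scalarCurvature g p ^ 2 := by
  have : IsProbabilityMeasure (riemMeasure g) := ⟨hvol⟩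
  have hs := continuous_scalarCurvature g
  have hint : ∀ {F : M → ℝ}, Continuous F → Integrable F (riemMeasure g) := fun {F} hF =>
    hF.integrable_of_hasCompactSupport (HasCompactSupport.of_compactSpace F)
  have hc : Continuous fun x => scalarCurvature g p ^ 2 - scalarCurvature g x ^ 2 := by fun_prop
  have h0 : ∀ x, 0 ≤ scalarCurvature g p ^ 2 - scalarCurvature g x ^ 2 := fun x =>
    sub_nonneg.2 (sq_le_sq.2 (hle x))
  by_contra hx
  have hpos := hc.integral_pos_of_hasCompactSupport_nonneg_nonzero (μ := riemMeasure g)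
    (HasCompactSupport.of_compactSpace _) h0 (x := x) (sub_ne_zero.2 (Ne.symm hx))
  rw [integral_sub (hint (by fun_prop)) (hint (by fun_prop))] at hpos
  simp only [integral_const, probReal_univ, one_smul] at hpos
  unfold energy at hE
  linarith

end Conclusion

end RiemGeom

end

theorem lemma2p3 {n : ℕ} {M : Type*} [TopologicalSpace M] [T2Space M] [CompactSpace M]
    [ConnectedSpace M] [ChartedSpace (EuclideanSpace ℝ (Fin n)) M] [IsManifold (𝓡 n) ∞ M]
    [MeasurableSpace M] [BorelSpace M]
    (g : RiemGeom.Metric n M) (hg : RiemGeom.IsCritical g) :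
    ∃ smax smin : ℝ,
      IsGreatest (Set.range (RiemGeom.scalarCurvature g)) smax ∧
      IsLeast (Set.range (RiemGeom.scalarCurvature g)) smin ∧
      (4 < n → |smin| ≤ smax → ∃ c : ℝ, 0 ≤ c ∧ ∀ x : M, RiemGeom.scalarCurvature g x = c) ∧
      (n < 4 → smin ≤ -|smax| → ∃ c : ℝ, c ≤ 0 ∧ ∀ x : M, RiemGeom.scalarCurvature g x = c) := by
  have hs := RiemGeom.continuous_scalarCurvature g
  have hne : (Set.univ : Set M).Nonempty := Set.univ_nonempty
  obtain ⟨p, -, hp⟩ := isCompact_univ.exists_isMaxOn hne hs.continuousOn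
  obtain ⟨q, -, hq⟩ := isCompact_univ.exists_isMinOn hne hs.continuousOn
  replace hp : ∀ x, RiemGeom.scalarCurvature g x ≤ RiemGeom.scalarCurvature g p :=
    fun x => hp (Set.mem_univ x)
  replace hq : ∀ x, RiemGeom.scalarCurvature g q ≤ RiemGeom.scalarCurvature g x :=
    fun x => hq (Set.mem_univ x)
  refine ⟨RiemGeom.scalarCurvature g p, RiemGeom.scalarCurvature g q,
    ⟨⟨p, rfl⟩, Set.forall_mem_range.2 hp⟩, ⟨⟨q, rfl⟩, Set.forall_mem_range.2 hq⟩,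
    fun hn h => ⟨RiemGeom.scalarCurvature g p, (abs_nonneg _).trans h, ?_⟩,
    fun hn h => ⟨RiemGeom.scalarCurvature g q, h.trans (neg_nonpos.2 (abs_nonneg _)), ?_⟩⟩
  · have hEL := RiemGeom.eulerLagrange_eq_zero (by omega) hg p
    have hL := RiemGeom.localLaplacian_nonpos_of_forall_le g hp
    rw [RiemGeom.eulerLagrange, RiemGeom.localScalar_coeff] at hEL
    have hn' : (4 : ℝ) < n := by exact_mod_cast hn
    refine RiemGeom.eq_of_sq_eq hs (RiemGeom.sq_scalarCurvature_eq hg.1 (fun x => ?_) ?_)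
    · rw [abs_of_nonneg ((abs_nonneg _).trans h), abs_le]
      exact ⟨by linarith [hq x, neg_abs_le (RiemGeom.scalarCurvature g q)], hp x⟩
    -- At the maximum point `(n - 4) (s² - S(g)) = 4 (n - 1) Δs ≤ 0` with `n - 4 > 0`, so `s² >
    -- S(g)` is impossible.
    · have h1 := mul_nonneg (show (0 : ℝ) ≤ 4 * ((n : ℝ) - 1) by linarith) (neg_nonneg.2 hL)
      by_contra! h2
      have h3 := mul_pos (sub_pos.2 hn') (sub_pos.2 h2)
      linarith
  -- The exponent `1 / n` of the variation excludes dimension zero; there the scalar curvature is an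
  -- empty sum.
  · rcases Nat.eq_zero_or_pos n with rfl | hn0
    · intro x
      simp [RiemGeom.scalarCurvature, RiemGeom.localScalar]
    have hEL := RiemGeom.eulerLagrange_eq_zero hn0.ne' hg q
    have hL := RiemGeom.localLaplacian_nonneg_of_forall_le g hq
    rw [RiemGeom.eulerLagrange, RiemGeom.localScalar_coeff] at hEL
    have hn' : (n : ℝ) < 4 := by exact_mod_cast hn
    have hn1 : (1 : ℝ) ≤ n := by exact_mod_cast hn0
    refine RiemGeom.eq_of_sq_eq hs (RiemGeom.sq_scalarCurvature_eq hg.1 (fun x => ?_) ?_)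
    · rw [abs_of_nonpos (h.trans (neg_nonpos.2 (abs_nonneg _))), abs_le]
      exact ⟨by linarith [hq x], by linarith [hp x, le_abs_self (RiemGeom.scalarCurvature g p)]⟩
    -- Both signs are reversed: `Δs ≥ 0` at the minimum point and `n - 4 < 0`. Nonnegativity of `n -
    -- 1` suffices, so `n = 1` is included.
    · have h1 := mul_nonneg (show (0 : ℝ) ≤ 4 * ((n : ℝ) - 1) by linarith) hL
      by_contra! h2
      have h3 := mul_pos (sub_pos.2 hn') (sub_pos.2 h2)
      linarith
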